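/- **Notation.** For integers write $e\,\|\,N$ if $e\mid N$ and $\gcd(e,N/e)=1$; the exact divisors of $N$ form a group under $e_1*e_2=e_1e_2/\gcd(e_1,e_2)^2$. Let $n\ge 1$ and $h\mid\gcd(n,24)$. For $e\,\|\,n/h$ let $w_e$ be the set of matrices $\begin{pmatrix} ae & b/h\\ cn & de\end{pmatrix}$ with $a,b,c,d\in\mathbb Z$ and determinant $e$, regarded up to scalars. For a subgroup $S$ of the group of exact divisors of $n/h$, the group generated by $\bigcup_{e\in S}w_e$ is called an *$n|h$-type group*; $\Gamma_0(n|h)=w_1$. For $E\,\|\,N$ write $W_E$ for any matrix $\begin{pmatrix} aE & b\\ cN & dE\end{pmatrix}$ with $a,b,c,d\in\mathbb Z$ and determinant $E$ (an Atkin–Lehner matrix of level $N$). For an $n|h$-type group $\Gamma$ let $\mathrm{AL}(\Gamma)$ be the set of $E\,\|\,nh$ such that $W_E\in\Gamma$ (level $nh$) and every prime dividing $E$ divides $n/h$. An *eigenvalue map* on $\Gamma$ is a homomorphism $\eta:\Gamma\to\mu_{2h}$ to the $2h$-th roots of unity that is trivial on $\Gamma_0(nh)$. With $(f|_k\gamma)(\tau)=(\det\gamma)^{k/2}(c\tau+d)^{-k}f(\gamma\tau)$,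 a weight $k$ (weakly holomorphic) modular form $f$ on $\Gamma_0(nh)$ is *on $(\Gamma,\eta)$* if $f|_k\gamma=\eta(\gamma)f$ for all $\gamma\in\Gamma$; here "weakly holomorphic" means holomorphic on the upper half plane and meromorphic at the cusps. $M_k^{\mathbb Q}(\Gamma,\eta)\subset\mathbb Q[[q]]$ is the set of $q$-expansions with rational coefficients of (everywhere holomorphic) modular forms of weight $k$ on $(\Gamma,\eta)$. For a prime $p$, a series $F\in\mathbb Q_p[[q]]$ is a *$p$-adic modular form of weight $0$ on $(\Gamma,\eta)$* if there are integers $k_m$ and $F_m\in M_{k_m}^{\mathbb Q}(\Gamma,\eta)$ such that $v_p(F_m-F)\to\infty$ ($v_p$ of a series being the infimum of the valuations of its coefficients) and $k_m\to 0$ in $\mathbb Z_p\times\mathbb Z/(2p-2)\mathbb Z$ (hence also in $\mathbb Z_p\times\mathbb Z/(p-1)\mathbb Z$). Finally $(f|U_p)(\tau)=\frac1p\sum_{\mu=0}^{p-1}f\left(\frac{\tau+\mu}{p}\right)$, i.e. $\left(\sum a(m)q^m\right)|U_p=\sum a(pm)q^m$. **Lemma.** Let $p$ be a prime, $\alpha\ge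 0$, $p\nmid nh$, let $\Gamma$ be a $p^\alpha n|h$-type group and $\eta$ an eigenvalue map on $\Gamma$. Let $f$ be a weight $0$ weakly holomorphic modular form on $(\Gamma,\eta)$ that is holomorphic at all cusps not $\Gamma$-equivalent to $\infty$. Let $\beta=\max\{1,\alpha-1\}$ and assume that the $q$-expansion of $f|U_p^\beta$ lies in $\mathbb Q[[q]]$, i.e. has rational coefficients and no negative powers of $q$ (for example, $f$ has rational coefficients and a pole of order less than $p^\beta$ at $\infty$). Let $\Gamma'$ be the $n|h$-type group with $\mathrm{AL}(\Gamma')=\{E\in\mathrm{AL}(\Gamma): p\nmid E\}$. Put $$x=\begin{pmatrix}1&1/h\\0&1\end{pmatrix},\qquad y=\begin{pmatrix}1&0\\p^\alpha n&1\end{pmatrix},\qquad y'=\begin{pmatrix}1&0\\n&1\end{pmatrix}.$$ Then there is a unique eigenvalue map $\eta'$ on $\Gamma'$ with $$\eta'(x)=\eta\big(x^{p^\beta}\big),\qquad \eta'(y')=\eta\big(y^{p^{\alpha+\beta}}\big),\qquad \eta'(W_E)=\eta(W_E)\quad\text{for } E\in\mathrm{AL}(\Gamma'),$$ where $W_E$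 denotes any Atkin–Lehner matrix of level $nh$ on the left and of level $p^\alpha nh$ on the right; and $f|U_p^\beta$ is a $p$-adic modular form of weight $0$ on $(\Gamma',\eta')$. -/

import Mathlib

open UpperHalfPlane Matrix Filter Topology
open scoped MatrixGroups ModularForm Manifold

noncomputable section

namespace Moonshine

/-! ### `n|h`-type groups

Groups of Möbius transformations are represented by their preimages in `SL(2, ℝ)`: a real matrix
`A` of determinant `e > 0` is replaced by `A / √e`.  For such matrices the slash operator
`(det A)^{k/2} (cτ+d)^{-k} f(Aτ)` is Mathlib's slash operator. -/

/-- `e` is an exact divisor of `N`. -/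
def ExactDvd (e N : ℕ) : Prop := e ∣ N ∧ Nat.Coprime e (N / e)

/-- The product `e₁ * e₂ = e₁ e₂ / gcd(e₁, e₂)²` of exact divisors. -/
def exactMul (e₁ e₂ : ℕ) : ℕ := e₁ * e₂ / Nat.gcd e₁ e₂ ^ 2

/-- `S` is a subgroup of the group of exact divisors of `N` (in which every element is its own
inverse). -/
structure IsExactDivisorSubgroup (N : ℕ) (S : Set ℕ) : Prop where
  exact : ∀ e ∈ S, ExactDvd e N
  one_mem : 1 ∈ S
  mul_mem : ∀ e₁ ∈ S, ∀ e₂ ∈ S, exactMul e₁ e₂ ∈ S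

/-- The set `w_e` of all matrices `[ae, b/h; cn, de]` of determinant `e` with `a, b, c, d ∈ ℤ`,
each of them divided by `√e`. -/
def wCoset (n h e : ℕ) : Set SL(2, ℝ) :=
  {γ | ∃ a b c d : ℤ, √(e : ℝ) • (γ : Matrix (Fin 2) (Fin 2) ℝ) =
    !![(a : ℝ) * e, (b : ℝ) / h; (c : ℝ) * n, (d : ℝ) * e]}

/-- The Atkin–Lehner matrices `W_E = [aE, b; cN, dE]` of determinant `E` at level `N`, divided
by `√E`. -/
def atkinLehner (N E : ℕ) : Set SL(2, ℝ) := wCoset N 1 E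

/-- `Γ` is an `n|h`-type group `Γ₀(n|h)+e₁,e₂,…`. -/
def IsTypeGroup (n h : ℕ) (Γ : Subgroup SL(2, ℝ)) : Prop :=
  0 < n ∧ h ∣ Nat.gcd n 24 ∧ ∃ S : Set ℕ, IsExactDivisorSubgroup (n / h) S ∧
    Γ = Subgroup.closure (⋃ e ∈ S, wCoset n h e)

/-- `AL(Γ)`, for an `n|h`-type group `Γ`. -/
def AL (n h : ℕ) (Γ : Subgroup SL(2, ℝ)) : Set ℕ :=
  {E | ExactDvd E (n * h) ∧ atkinLehner (n * h) E ⊆ Γ ∧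
    ∀ ℓ : ℕ, ℓ.Prime → ℓ ∣ E → ℓ ∣ n / h}

/-- The matrix `x = [1, 1/h; 0, 1]`. -/
def xMat (h : ℕ) : SL(2, ℝ) := ⟨!![1, 1 / (h : ℝ); 0, 1], by simp [Matrix.det_fin_two]⟩

/-- The matrix `y = [1, 0; n, 1]`. -/
def yMat (n : ℕ) : SL(2, ℝ) := ⟨!![1, 0; (n : ℝ), 1], by simp [Matrix.det_fin_two]⟩

theorem IsTypeGroup.xMat_mem {n h : ℕ} {Γ : Subgroup SL(2, ℝ)} (hΓ : IsTypeGroup n h Γ) :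
    xMat h ∈ Γ := by
  obtain ⟨-, -, S, hS, rfl⟩ := hΓ
  refine Subgroup.subset_closure (Set.mem_biUnion hS.one_mem ⟨1, 1, 0, 1, ?_⟩)
  simp [xMat]

theorem IsTypeGroup.yMat_mem {n h : ℕ} {Γ : Subgroup SL(2, ℝ)} (hΓ : IsTypeGroup n h Γ) :
    yMat n ∈ Γ := by
  obtain ⟨-, -, S, hS, rfl⟩ := hΓ
  refine Subgroup.subset_closure (Set.mem_biUnion hS.one_mem ⟨1, 0, 1, 1, ?_⟩)
  simp [yMat]

/-- `Γ₀(N)` as a subgroup of `SL(2, ℝ)`. -/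
def Gamma0R (N : ℕ) : Subgroup SL(2, ℝ) :=
  (CongruenceSubgroup.Gamma0 N).map (SpecialLinearGroup.map (Int.castRingHom ℝ))

/-- An eigenvalue map on an `n|h`-type group: a homomorphism to the `2h`-th roots of unity whose
kernel contains `Γ₀(nh)`. -/
def IsEigenvalueMap (n h : ℕ) {Γ : Subgroup SL(2, ℝ)} (χ : Γ →* rootsOfUnity (2 * h) ℂ) : Prop :=
  ∀ γ : Γ, (γ : SL(2, ℝ)) ∈ Gamma0R (n * h) → χ γ = 1

/-! ### Modular forms on `(Γ, χ)` -/

/-- `f |_k γ = χ(γ) f` for all `γ ∈ Γ`. -/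
def HasEigenvalues {h : ℕ} {Γ : Subgroup SL(2, ℝ)} (χ : Γ →* rootsOfUnity (2 * h) ℂ)
    (k : ℤ) (f : ℍ → ℂ) : Prop :=
  ∀ γ : Γ, f ∣[k] (SpecialLinearGroup.toGL (γ : SL(2, ℝ)) : GL (Fin 2) ℝ) =
    (((χ γ : ℂˣ) : ℂ)) • f

/-- Weakly holomorphic modular forms of weight `k` on `Γ₀(N)`: holomorphic on `ℍ`, invariant under
`Γ₀(N)`, meromorphic at every cusp (i.e. of at most exponential growth in `Im τ`, hence of at most
polynomial growth in `1/|q|`, after moving the cusp to `∞`). -/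
structure IsWeaklyHolomorphic (N : ℕ) (k : ℤ) (f : ℍ → ℂ) : Prop where
  holo : MDiff f
  slash_eq : ∀ γ ∈ CongruenceSubgroup.Gamma0 N, f ∣[k] γ = f
  mero_at_cusps : ∀ γ : SL(2, ℤ), ∃ C : ℝ,
    (f ∣[k] γ) =O[atImInfty] fun τ : ℍ => Real.exp (C * τ.im)

/-- Weakly holomorphic modular forms of weight `k` on `(Γ, χ)`, for an `n|h`-type group `Γ`. -/
structure IsWeaklyHolomorphicOn (n h : ℕ) {Γ : Subgroup SL(2, ℝ)}
    (χ : Γ →* rootsOfUnity (2 * h) ℂ) (k : ℤ) (f : ℍ → ℂ) : Prop where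
  weaklyHolomorphic : IsWeaklyHolomorphic (n * h) k f
  eigenvalues : HasEigenvalues χ k f

/-- `f` is holomorphic at all cusps that are not `Γ`-equivalent to `∞`. -/
def HolomorphicAwayFromInfty (Γ : Subgroup SL(2, ℝ)) (k : ℤ) (f : ℍ → ℂ) : Prop :=
  ∀ c : OnePoint ℝ, IsCusp c 𝒮ℒ →
    (∀ γ ∈ Γ, (SpecialLinearGroup.toGL γ : GL (Fin 2) ℝ) • (OnePoint.infty : OnePoint ℝ) ≠ c) →
    c.IsBoundedAt f k

/-- `f = ∑_{m ≥ 0} a(m) q^m` on `ℍ`, with `q = e^{2πiτ}` and `∑ a(m) q^m = F ∈ ℚ⟦q⟧`. -/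
def HasRatQExpansion (f : ℍ → ℂ) (F : PowerSeries ℚ) : Prop :=
  ∀ τ : ℍ, HasSum (fun m : ℕ => ((PowerSeries.coeff m F : ℚ) : ℂ) *
    Complex.exp (2 * Real.pi * Complex.I * τ) ^ m) (f τ)

/-- `M_k^ℚ(Γ, χ)`, as a set of `q`-expansions: the expansions in `ℚ⟦q⟧` of the (everywhere
holomorphic) modular forms of weight `k` on `Γ₀(nh)` that are on `(Γ, χ)`. -/
def MQ (n h : ℕ) {Γ : Subgroup SL(2, ℝ)} (χ : Γ →* rootsOfUnity (2 * h) ℂ) (k : ℤ) :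
    Set (PowerSeries ℚ) :=
  {F | ∃ f : ModularForm ((CongruenceSubgroup.Gamma0 (n * h)).map
      (SpecialLinearGroup.mapGL ℝ)) k, HasEigenvalues χ k f ∧ HasRatQExpansion f F}

/-- The operator `U_p`: `(f|U_p)(τ) = (1/p) ∑_{μ = 0}^{p-1} f((τ + μ)/p)`. -/
def Up (p : ℕ) [hp : Fact p.Prime] (f : ℍ → ℂ) (τ : ℍ) : ℂ :=
  (1 / (p : ℂ)) * ∑ μ ∈ Finset.range p, f ⟨((τ : ℂ) + μ) / p, by
    have h0 : (0 : ℝ) < p := by exact_mod_cast hp.out.pos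
    rw [Complex.div_natCast_im]
    simpa using div_pos τ.im_pos h0⟩

/-- `F ∈ ℚ_p⟦q⟧` is a `p`-adic modular form of weight `w` on `(Γ, χ)`: it is the limit, uniformly
in the coefficients (`v_p(F_m - F) → ∞`), of forms `F_m ∈ M_{k_m}^ℚ(Γ, χ)` whose weights `k_m`
tend to `w`.  Weights live in `ℤ_p × ℤ/(2p-2)`, so that this determines in particular the weight
in `ℤ_p × ℤ/(p-1)`. -/
def IsPadicModularForm (p : ℕ) [Fact p.Prime] (n h : ℕ) {Γ : Subgroup SL(2, ℝ)}
    (χ : Γ →* rootsOfUnity (2 * h) ℂ) (w : ℤ_[p] × ZMod (2 * (p - 1)))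
    (F : PowerSeries ℚ_[p]) : Prop :=
  ∃ (k : ℕ → ℤ) (G : ℕ → PowerSeries ℚ),
    (∀ m, G m ∈ MQ n h χ (k m)) ∧
    TendstoUniformly (fun (m i : ℕ) => ((PowerSeries.coeff i (G m) : ℚ) : ℚ_[p]))
      (fun i => PowerSeries.coeff i F) atTop ∧
    Tendsto (fun m => (k m : ℤ_[p])) atTop (𝓝 w.1) ∧
    ∀ᶠ m in atTop, (k m : ZMod (2 * (p - 1))) = w.2

/-- The conditions that specify the eigenvalue map `χ'` on the `n|h`-type group `Γ'` in terms of
the eigenvalue map `χ` on the `p^α n|h`-type group `Γ`: with `x = [1, 1/h; 0, 1]`,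
`y = [1, 0; p^α n, 1]` and `y' = [1, 0; n, 1]`,
`χ'(x) = χ(x^(p^β))`, `χ'(y') = χ(y^(p^(α+β)))` and `χ'(W_E) = χ(W_E)` for `E ∈ AL(Γ')`, where
`W_E` is any Atkin–Lehner matrix of level `nh` on the left, of level `p^α nh` on the right. -/
structure IsInducedEigenvalueMap (p α β n h : ℕ) {Γ Γ' : Subgroup SL(2, ℝ)}
    (hΓ : IsTypeGroup (p ^ α * n) h Γ) (hΓ' : IsTypeGroup n h Γ')
    (χ : Γ →* rootsOfUnity (2 * h) ℂ) (χ' : Γ' →* rootsOfUnity (2 * h) ℂ) : Prop where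
  isEigenvalueMap : IsEigenvalueMap n h χ'
  map_x : χ' ⟨xMat h, hΓ'.xMat_mem⟩ = χ (⟨xMat h, hΓ.xMat_mem⟩ ^ p ^ β)
  map_y : χ' ⟨yMat n, hΓ'.yMat_mem⟩ = χ (⟨yMat (p ^ α * n), hΓ.yMat_mem⟩ ^ p ^ (α + β))
  map_W : ∀ E ∈ AL n h Γ', ∀ (γ' : Γ') (γ : Γ), (γ' : SL(2, ℝ)) ∈ atkinLehner (n * h) E →
    (γ : SL(2, ℝ)) ∈ atkinLehner (p ^ α * n * h) E → χ' γ' = χ γ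

end Moonshine

end

/-! ### Matrices of n|h-type groups, their generators, and the induced eigenvalue map. -/

noncomputable section

namespace Moonshine

/-! ### Exact divisors -/

/-! Write N = nh, g = f|U_p^β, and let S be the set of e with Γ' = ⋃ w_e. The argument is Serre's: g
lives on Γ₀(pN); it is multiplied by a high power of a form congruent to 1 modulo p which removes
the remaining poles, and the product is traced down to Γ₀(N).

Eigenvalues. Conjugation by diag(1, p^β) carries a matrix of w_e at level n|h whose upper right
entry is divisible by p^β and whose lower left entry has an extra factor p into w_e at level p^α
n|h, because α ≤ β + 1. As p ∤ N, every class of Γ'/Γ₀(N) contains such a matrix, so χ composed with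
the conjugation descends to Γ' (`exists_inducedEigenvalueMap`). Such a matrix permutes the p^β
summands of U_p^β up to Γ₀(p^α N), so g has the induced eigenvalues on it (`Up_iterate_smul`).
Uniqueness holds since Γ' is generated by Γ₀(N), x, y' and Atkin–Lehner matrices
(`inducedEigenvalueMap_unique`).

Growth. At a cusp whose denominator is divisible by p, the summands of g are values of f near
certain cusps. Either none of these is equivalent to ∞ and f is bounded at all of them, or a matrix
of which g is an eigenfunction carries the cusp to ∞, where the expansion of g has no negative
powers (`Up_iterate_isBigO`).

Auxiliary form. Ê = ∏_{e ∈ S} Δ(ehτ)^p / Δ(pehτ) has weight 12(p-1)|S| and is congruent to 1 modulo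
p. It is invariant under the matrices above and vanishes at all cusps of denominator prime to p
(`exists_lexp_eHat`, `eHat_smul_wM`, `exists_eHat_isBigO`). So for large m the trace of g Ê^(p^m) is
a holomorphic form on (Γ', χ'), of a weight that tends to 0.

Convergence. The trace is g Ê^(p^m) plus the p translates of (g|σ)(Ê|σ)^(p^m), with σ ∈ Γ₀(N) whose
lower right entry is divisible by p. Up to the denominators of g, the first term is g modulo
p^(m+1). In the second, Ê|σ is p^(12|S|) times a series over ℤ, so it tends to 0 once g|σ has
bounded denominators at p (`exists_approximation`).

Bounded denominators (`conj_rat_and_bdd`). Lagrange interpolation at the conjugates of θ = j(pNτ)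
writes g as a quotient of polynomials in j and θ; since g and θ have rational expansions, the
coefficients can be taken in ℚ. Applying σ leaves these polynomials unchanged. The denominator
becomes a product of differences of conjugates of θ, and the leading coefficient of each difference
divides p among the p-integral algebraic numbers (`good_jfun_sub`). -/

theorem ExactDvd.pos {e N : ℕ} (h : ExactDvd e N) (hN : 0 < N) : 0 < e :=
  Nat.pos_of_dvd_of_pos h.1 hN

/-- Two exact divisors of `N` have the form `g u` and `g v`, where `g`, `u`, `v` are pairwise
coprime and `g u v ∣ N`. -/
theorem ExactDvd.exists_decomp {e₁ e₂ N : ℕ} (hN : 0 < N) (h₁ : ExactDvd e₁ N)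
    (h₂ : ExactDvd e₂ N) : ∃ g u v m : ℕ, 0 < g ∧ 0 < u ∧ 0 < v ∧ e₁ = g * u ∧ e₂ = g * v ∧
      Nat.gcd e₁ e₂ = g ∧ Nat.Coprime u v ∧ Nat.Coprime u g ∧ Nat.Coprime v g ∧
      N = g * u * v * m ∧ exactMul e₁ e₂ = u * v := by
  have p₁ := h₁.pos hN
  have p₂ := h₂.pos hN
  obtain ⟨g, u, v, hg, huv, rfl, rfl⟩ :=
    Nat.exists_coprime' (m := e₁) (n := e₂) (Nat.gcd_pos_of_pos_left _ p₁)
  have hu : 0 < u := Nat.pos_of_mul_pos_right (by simpa using p₁)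
  have hv : 0 < v := Nat.pos_of_mul_pos_right (by simpa using p₂)
  have hlcm : Nat.lcm (u * g) (v * g) ∣ N := Nat.lcm_dvd h₁.1 h₂.1
  have hgcd : Nat.gcd (u * g) (v * g) = g := by
    rw [Nat.gcd_mul_right, huv, one_mul]
  have hl : Nat.lcm (u * g) (v * g) = g * u * v := by
    rw [Nat.lcm, hgcd]
    apply Nat.div_eq_of_eq_mul_left hg; ring
  rw [hl] at hlcm
  obtain ⟨m, rfl⟩ := hlcm
  have c1 : Nat.Coprime (v * g) u := by
    have := h₂.2
    rw [show g * u * v * m / (v * g) = u * m from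
      Nat.div_eq_of_eq_mul_left (by positivity) (by ring)] at this
    exact Nat.Coprime.coprime_mul_right_right this
  have c2 : Nat.Coprime (u * g) v := by
    have := h₁.2
    rw [show g * u * v * m / (u * g) = v * m from
      Nat.div_eq_of_eq_mul_left (by positivity) (by ring)] at this
    exact Nat.Coprime.coprime_mul_right_right this
  refine ⟨g, u, v, m, hg, hu, hv, mul_comm _ _, mul_comm _ _, hgcd, huv,
    (Nat.Coprime.coprime_mul_left c1).symm, (Nat.Coprime.coprime_mul_left c2).symm, rfl, ?_⟩
  rw [exactMul, hgcd]
  apply Nat.div_eq_of_eq_mul_left (by positivity); ring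

/-- With e₁ = gu and e₂ = gv the product is uv, and multiplying by gv again removes v and restores
g. Hence e ↦ e * e' is an involution, which permutes the factors of Ê in `eHat_smul_wM`. -/
theorem exactMul_exactMul_cancel {e₁ e₂ N : ℕ} (hN : 0 < N) (h₁ : ExactDvd e₁ N)
    (h₂ : ExactDvd e₂ N) : exactMul (exactMul e₁ e₂) e₂ = e₁ := by
  obtain ⟨g, u, v, m, hg, hu, hv, rfl, rfl, -, -, hug, -, -, he⟩ := h₁.exists_decomp hN h₂
  rw [he, exactMul, show Nat.gcd (u * v) (g * v) = v by rw [Nat.gcd_mul_right, hug, one_mul]]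
  apply Nat.div_eq_of_eq_mul_left (by positivity); ring

/-! ### The matrices in `w_e` -/

/-- The matrix `[ae, b/h; cn, de] / √e`, where `n = h e m`. -/
def wM (h e m : ℕ) (a b c d : ℤ) : Matrix (Fin 2) (Fin 2) ℝ :=
  !![a * √e, b / (h * √e); c * h * m * √e, d * √e]

theorem det_wM {h e m : ℕ} (hh : 0 < h) (he : 0 < e) (a b c d : ℤ) :
    (wM h e m a b c d).det = ((a * d * e - b * c * m : ℤ) : ℝ) := by
  have h1 : (0 : ℝ) < √(e : ℝ) := Real.sqrt_pos.2 (by exact_mod_cast he)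
  have h2 : √(e : ℝ) ^ 2 = e := Real.sq_sqrt (by positivity)
  have h3 : (h : ℝ) ≠ 0 := by positivity
  rw [wM, Matrix.det_fin_two_of]
  push_cast
  generalize √(e : ℝ) = s at *
  rw [← h2]
  field_simp

/-- The element of `SL(2, ℝ)` with matrix `wM h e m a b c d`. -/
def wSL {h e m : ℕ} (hh : 0 < h) (he : 0 < e) {a b c d : ℤ} (hd : a * d * e - b * c * m = 1) :
    SL(2, ℝ) :=
  ⟨wM h e m a b c d, by rw [det_wM hh he, hd, Int.cast_one]⟩

theorem mem_wCoset_iff {h e m : ℕ} (hh : 0 < h) (he : 0 < e) {γ : SL(2, ℝ)} :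
    γ ∈ wCoset (h * e * m) h e ↔ ∃ a b c d : ℤ, a * d * e - b * c * m = 1 ∧
      (γ : Matrix (Fin 2) (Fin 2) ℝ) = wM h e m a b c d := by
  have h1 : (0 : ℝ) < √(e : ℝ) := Real.sqrt_pos.2 (by exact_mod_cast he)
  have h2 : √(e : ℝ) * √(e : ℝ) = e := Real.mul_self_sqrt (by positivity)
  have h3 : (h : ℝ) ≠ 0 := by positivity
  have key : ∀ a b c d : ℤ, √(e : ℝ) • wM h e m a b c d =
      !![(a : ℝ) * e, (b : ℝ) / h; (c : ℝ) * (h * e * m : ℕ), (d : ℝ) * e] := by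
    intro a b c d
    simp only [wM, Nat.cast_mul]
    generalize √(e : ℝ) = s at *
    rw [← h2]
    ext i j
    fin_cases i <;> fin_cases j <;> simp <;> field_simp
  constructor
  · rintro ⟨a, b, c, d, hγ⟩
    rw [← key] at hγ
    have hγ' : (γ : Matrix (Fin 2) (Fin 2) ℝ) = wM h e m a b c d :=
      smul_right_injective _ h1.ne' hγ
    refine ⟨a, b, c, d, ?_, hγ'⟩
    have := det_wM (m := m) hh he a b c d
    rw [← hγ', γ.det_coe] at this
    exact_mod_cast this.symm
  · rintro ⟨a, b, c, d, -, hγ⟩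
    exact ⟨a, b, c, d, by rw [hγ, key]⟩

/-- √(gu) √(gv) = g √(uv), and all other factors are absorbed by integral coefficients. This is the
rule w_{e₁} w_{e₂} ⊆ w_{e₁ * e₂} for e₁ = gu, e₂ = gv. -/
theorem wM_mul {h g u v m : ℕ} (hh : 0 < h) (hg : 0 < g) (hu : 0 < u) (hv : 0 < v)
    (a b c d a' b' c' d' : ℤ) :
    wM h (g * u) (v * m) a b c d * wM h (g * v) (u * m) a' b' c' d' =
      wM h (u * v) (g * m) (a * a' * g + b * c' * m) (a * b' * u + b * d' * v)
        (c * a' * v + d * c' * u) (c * b' * m + d * d' * g) := by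
  have hG : (0 : ℝ) < √(g : ℝ) := Real.sqrt_pos.2 (by exact_mod_cast hg)
  have hU : (0 : ℝ) < √(u : ℝ) := Real.sqrt_pos.2 (by exact_mod_cast hu)
  have hV : (0 : ℝ) < √(v : ℝ) := Real.sqrt_pos.2 (by exact_mod_cast hv)
  have hG2 : (g : ℝ) = √(g : ℝ) ^ 2 := (Real.sq_sqrt (by positivity)).symm
  have hU2 : (u : ℝ) = √(u : ℝ) ^ 2 := (Real.sq_sqrt (by positivity)).symm
  have hV2 : (v : ℝ) = √(v : ℝ) ^ 2 := (Real.sq_sqrt (by positivity)).symm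
  have h3 : (h : ℝ) ≠ 0 := by positivity
  simp only [wM, Nat.cast_mul, Real.sqrt_mul (Nat.cast_nonneg _), Int.cast_add, Int.cast_mul,
    Int.cast_natCast]
  set G := √(g : ℝ)
  set U := √(u : ℝ)
  set V := √(v : ℝ)
  rw [hG2, hU2, hV2]
  ext i j
  fin_cases i <;> fin_cases j <;> simp [Matrix.mul_apply, Fin.sum_univ_two] <;> field_simp

theorem inv_eq_wM {h e m : ℕ} {γ : SL(2, ℝ)} {a b c d : ℤ}
    (hγ : (γ : Matrix (Fin 2) (Fin 2) ℝ) = wM h e m a b c d) :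
    ((γ⁻¹ : SL(2, ℝ)) : Matrix (Fin 2) (Fin 2) ℝ) = wM h e m d (-b) (-c) a := by
  rw [Matrix.SpecialLinearGroup.coe_inv, hγ, wM, wM, Matrix.adjugate_fin_two_of]
  ext i j
  fin_cases i <;> fin_cases j <;> simp; ring

theorem inv_mem_wCoset {h e m : ℕ} (hh : 0 < h) (he : 0 < e) {γ : SL(2, ℝ)}
    (hγ : γ ∈ wCoset (h * e * m) h e) : γ⁻¹ ∈ wCoset (h * e * m) h e := by
  rw [mem_wCoset_iff hh he] at hγ ⊢
  obtain ⟨a, b, c, d, hd, hγ⟩ := hγ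
  exact ⟨d, -b, -c, a, by linear_combination hd, inv_eq_wM hγ⟩

theorem mul_mem_wCoset {n h e₁ e₂ : ℕ} (hn : 0 < n) (hh : h ∣ n) {γ₁ γ₂ : SL(2, ℝ)}
    (h₁ : ExactDvd e₁ (n / h)) (h₂ : ExactDvd e₂ (n / h))
    (hγ₁ : γ₁ ∈ wCoset n h e₁) (hγ₂ : γ₂ ∈ wCoset n h e₂) :
    γ₁ * γ₂ ∈ wCoset n h (exactMul e₁ e₂) := by
  obtain ⟨k, rfl⟩ := hh
  have hh0 : 0 < h := Nat.pos_of_mul_pos_right hn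
  rw [Nat.mul_div_cancel_left _ hh0] at h₁ h₂
  have hk : 0 < k := Nat.pos_of_mul_pos_left hn
  obtain ⟨g, u, v, m, hg, hu, hv, rfl, rfl, -, -, -, -, rfl, he⟩ := h₁.exists_decomp hk h₂
  rw [he]
  rw [show h * (g * u * v * m) = h * (g * u) * (v * m) by ring,
    mem_wCoset_iff hh0 (by positivity)] at hγ₁
  rw [show h * (g * u * v * m) = h * (g * v) * (u * m) by ring,
    mem_wCoset_iff hh0 (by positivity)] at hγ₂
  rw [show h * (g * u * v * m) = h * (u * v) * (g * m) by ring,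
    mem_wCoset_iff hh0 (by positivity)]
  obtain ⟨a, b, c, d, hd, hγ⟩ := hγ₁
  obtain ⟨a', b', c', d', hd', hγ'⟩ := hγ₂
  refine ⟨_, _, _, _, ?_, by
    rw [Matrix.SpecialLinearGroup.coe_mul, hγ, hγ', wM_mul hh0 hg hu hv]⟩
  push_cast at hd hd' ⊢
  linear_combination (a' * d' * (g * v) - b' * c' * (u * m)) * hd + hd'

/-- An `n|h`-type group is the union of its cosets `w_e`. -/
theorem mem_closure_wCoset_iff {n h : ℕ} (hn : 0 < n) (hh : h ∣ n) {S : Set ℕ}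
    (hS : IsExactDivisorSubgroup (n / h) S) {γ : SL(2, ℝ)} :
    γ ∈ Subgroup.closure (⋃ e ∈ S, wCoset n h e) ↔ ∃ e ∈ S, γ ∈ wCoset n h e := by
  constructor
  · intro hγ
    induction hγ using Subgroup.closure_induction with
    | mem x hx => simpa using hx
    | one => exact ⟨1, hS.one_mem, 1, 0, 0, 1, by simp [Matrix.one_fin_two]⟩
    | mul x y _ _ hx hy =>
      obtain ⟨e₁, he₁, hx⟩ := hx
      obtain ⟨e₂, he₂, hy⟩ := hy
      exact ⟨_, hS.mul_mem _ he₁ _ he₂,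
        mul_mem_wCoset hn hh (hS.exact _ he₁) (hS.exact _ he₂) hx hy⟩
    | inv x _ hx =>
      obtain ⟨e, he, hx⟩ := hx
      refine ⟨e, he, ?_⟩
      obtain ⟨k, rfl⟩ := hh
      have hh0 : 0 < h := Nat.pos_of_mul_pos_right hn
      obtain ⟨⟨m, hm⟩, -⟩ := hS.exact _ he
      rw [Nat.mul_div_cancel_left _ hh0] at hm
      subst hm
      rw [← mul_assoc] at hx ⊢
      have : 0 < e := by
        rcases Nat.eq_zero_or_pos e with rfl | h'
        · simp at hn
        · exact h'
      exact inv_mem_wCoset hh0 this hx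
  · rintro ⟨e, he, hγ⟩
    exact Subgroup.subset_closure (Set.mem_biUnion he hγ)

theorem IsTypeGroup.pos_left {n h : ℕ} {Γ : Subgroup SL(2, ℝ)} (hΓ : IsTypeGroup n h Γ) : 0 < n :=
  hΓ.1

theorem IsTypeGroup.dvd {n h : ℕ} {Γ : Subgroup SL(2, ℝ)} (hΓ : IsTypeGroup n h Γ) : h ∣ n :=
  hΓ.2.1.trans (Nat.gcd_dvd_left _ _)

theorem IsTypeGroup.dvd_24 {n h : ℕ} {Γ : Subgroup SL(2, ℝ)} (hΓ : IsTypeGroup n h Γ) : h ∣ 24 :=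
  hΓ.2.1.trans (Nat.gcd_dvd_right _ _)

theorem IsTypeGroup.pos_right {n h : ℕ} {Γ : Subgroup SL(2, ℝ)} (hΓ : IsTypeGroup n h Γ) :
    0 < h :=
  Nat.pos_of_dvd_of_pos hΓ.dvd hΓ.1

/-! ### `Γ₀(nh)` inside `n|h`-type groups -/

/-- The element `[a, b; c, d]` of `SL(2, ℤ)`. -/
def mkSL (a b c d : ℤ) (hd : a * d - b * c = 1) : SL(2, ℤ) :=
  ⟨!![a, b; c, d], by rw [Matrix.det_fin_two_of, hd]⟩

@[simp] theorem mkSL_zero_zero (a b c d : ℤ) (hd : a * d - b * c = 1) :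
    mkSL a b c d hd 0 0 = a := rfl

@[simp] theorem mkSL_zero_one (a b c d : ℤ) (hd : a * d - b * c = 1) :
    mkSL a b c d hd 0 1 = b := rfl

@[simp] theorem mkSL_one_zero (a b c d : ℤ) (hd : a * d - b * c = 1) :
    mkSL a b c d hd 1 0 = c := rfl

@[simp] theorem mkSL_one_one (a b c d : ℤ) (hd : a * d - b * c = 1) :
    mkSL a b c d hd 1 1 = d := rfl

theorem mem_Gamma0R_iff {N : ℕ} {γ : SL(2, ℝ)} : γ ∈ Gamma0R N ↔ ∃ a b c d : ℤ,
    a * d - b * c * N = 1 ∧ (γ : Matrix (Fin 2) (Fin 2) ℝ) = !![(a : ℝ), b; c * N, d] := by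
  rw [Gamma0R, Subgroup.mem_map]
  constructor
  · rintro ⟨δ, hδ, rfl⟩
    rw [CongruenceSubgroup.Gamma0_mem, ZMod.intCast_zmod_eq_zero_iff_dvd] at hδ
    obtain ⟨c, hc⟩ := hδ
    have hdet := δ.det_coe
    rw [Matrix.det_fin_two] at hdet
    refine ⟨δ 0 0, δ 0 1, c, δ 1 1, by rw [hc] at hdet; linear_combination hdet, ?_⟩
    ext i j
    fin_cases i <;> fin_cases j <;> simp [hc, mul_comm]
  · rintro ⟨a, b, c, d, hd, hγ⟩
    refine ⟨mkSL a b (c * N) d (by linear_combination hd), ?_, ?_⟩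
    · rw [CongruenceSubgroup.Gamma0_mem]; simp
    · ext i j
      rw [hγ]
      fin_cases i <;> fin_cases j <;> simp

theorem mem_Gamma0R_iff_mem_wCoset {N : ℕ} {γ : SL(2, ℝ)} :
    γ ∈ Gamma0R N ↔ γ ∈ wCoset N 1 1 := by
  have := mem_wCoset_iff (h := 1) (e := 1) (m := N) one_pos one_pos (γ := γ)
  simp only [one_mul] at this
  rw [this, mem_Gamma0R_iff]
  simp [wM]

theorem Gamma0R_le_wCoset {n h : ℕ} (hh : 0 < h) {γ : SL(2, ℝ)} (hγ : γ ∈ Gamma0R (n * h)) :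
    γ ∈ wCoset n h 1 := by
  obtain ⟨a, b, c, d, -, hγ⟩ := mem_Gamma0R_iff.1 hγ
  refine ⟨a, b * h, c * h, d, ?_⟩
  have h3 : (h : ℝ) ≠ 0 := by positivity
  rw [hγ]
  ext i j
  fin_cases i <;> fin_cases j <;> simp [h3]; ring

/-- Modulo a divisor of 24 every unit is its own inverse. For the diagonal entries of an element of
Γ₀(nh) this gives a ≡ d modulo h, which is why Γ₀(nh) is normal in n|h-type groups. -/
theorem dvd_sub_of_dvd_24 {h : ℕ} (hh : h ∣ 24) {a d : ℤ} (had : (h : ℤ) ∣ a * d - 1) :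
    (h : ℤ) ∣ a - d := by
  have h24 : ∀ x y : ZMod h, x * y = 1 → x = y := by
    have : h ∈ Nat.divisors 24 := by simpa using hh
    rw [show Nat.divisors 24 = {1, 2, 3, 4, 6, 8, 12, 24} by decide +kernel] at this
    simp only [Finset.mem_insert, Finset.mem_singleton] at this
    rcases this with rfl | rfl | rfl | rfl | rfl | rfl | rfl | rfl <;> decide +kernel
  have h1 : ((a * d - 1 : ℤ) : ZMod h) = 0 := (ZMod.intCast_zmod_eq_zero_iff_dvd _ _).2 had
  rw [← ZMod.intCast_zmod_eq_zero_iff_dvd]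
  push_cast at h1 ⊢
  rw [sub_eq_zero] at h1 ⊢
  exact h24 _ _ h1

/-- Since `h ∣ 24`, the group `Γ₀(nh)` is normalized by the cosets `w_e`. -/
theorem conj_mem_Gamma0R {n h e : ℕ} (hn : 0 < n) (hh : h ∣ n) (h24 : h ∣ 24)
    (he : e ∣ n / h) {w δ : SL(2, ℝ)} (hw : w ∈ wCoset n h e) (hδ : δ ∈ Gamma0R (n * h)) :
    w⁻¹ * δ * w ∈ Gamma0R (n * h) := by
  obtain ⟨k, rfl⟩ := hh
  have hh0 : 0 < h := Nat.pos_of_mul_pos_right hn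
  rw [Nat.mul_div_cancel_left _ hh0] at he
  obtain ⟨m, rfl⟩ := he
  have he0 : 0 < e := by
    rcases Nat.eq_zero_or_pos e with rfl | h'
    · simp at hn
    · exact h'
  rw [← mul_assoc] at hw
  obtain ⟨a, b, c, d, hd, hw⟩ := (mem_wCoset_iff hh0 he0).1 hw
  obtain ⟨A, B, C, D, hD, hδ⟩ := mem_Gamma0R_iff.1 hδ
  obtain ⟨t, ht⟩ := dvd_sub_of_dvd_24 h24 (a := A) (d := D)
    ⟨B * C * (e * m * h), by push_cast at hD; linear_combination hD⟩
  have h1 : (0 : ℝ) < √(e : ℝ) := Real.sqrt_pos.2 (by exact_mod_cast he0)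
  have h2 : (e : ℝ) = √(e : ℝ) ^ 2 := (Real.sq_sqrt (by positivity)).symm
  have h3 : (h : ℝ) ≠ 0 := by positivity
  have ht' : (A : ℝ) = D + h * t := by
    have : ((A - D : ℤ) : ℝ) = ((h * t : ℤ) : ℝ) := by rw [ht]
    push_cast at this; linear_combination this
  rw [mem_Gamma0R_iff]
  -- The upper right entry of the conjugate contains bd(A - D)/h and the lower left one a multiple
  -- of ac(A - D). With t = (A - D)/h the first is integral and the second divisible by nh.
  refine ⟨d * e * (A * a + B * c * h * m) - b * m * (C * h * e * a + D * c),
    d * b * t + B * d ^ 2 * e - b ^ 2 * C * m,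
    -a * c * t - B * c ^ 2 * m + C * e * a ^ 2,
    a * (C * h * m * b + D * d) * e - c * m * (A * b + B * h * d * e), ?_, ?_⟩
  · push_cast at hd hD ⊢
    have hA : A = D + h * t := by linear_combination ht
    subst hA
    linear_combination ((a * d * e - b * c * m) ^ 2) * hD + (a * d * e - b * c * m + 1) * hd
  · rw [Matrix.SpecialLinearGroup.coe_mul, Matrix.SpecialLinearGroup.coe_mul, inv_eq_wM hw, hδ,
      hw]
    simp only [wM, Nat.cast_mul]
    push_cast
    rw [ht']
    generalize √(e : ℝ) = s at *
    rw [h2]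
    ext i j
    fin_cases i <;> fin_cases j <;> simp [Matrix.mul_apply, Fin.sum_univ_two] <;>
      field_simp <;> ring

end Moonshine

end


noncomputable section

namespace Moonshine

/-! ### Generators of `n|h`-type groups -/

theorem exists_isCoprime_add_mul {a b : ℤ} (hab : IsCoprime a b) {h : ℕ} (hh : 0 < h) :
    ∃ i : ℕ, IsCoprime (a + i * b) h := by
  classical
  -- A prime of h dividing a divides neither this product nor b; a prime of h not dividing a divides
  -- the product. In both cases it does not divide a + ib.
  refine ⟨∏ q ∈ h.primeFactors.filter (fun q : ℕ => ¬ (q : ℤ) ∣ a), q, ?_⟩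
  set i : ℕ := ∏ q ∈ h.primeFactors.filter (fun q : ℕ => ¬ (q : ℤ) ∣ a), q with hi
  rw [Int.isCoprime_iff_gcd_eq_one]
  refine Nat.Coprime.symm (Nat.coprime_of_dvd fun q hq hqh hqa => ?_)
  simp only [Int.natAbs_natCast] at hqh
  have hqa' : (q : ℤ) ∣ a + i * b := Int.natCast_dvd.2 hqa
  have hqZ : Prime (q : ℤ) := Nat.prime_iff_prime_int.1 hq
  by_cases hqd : (q : ℤ) ∣ a
  · have h1 : (q : ℤ) ∣ i * b := (dvd_add_right hqd).1 hqa'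
    rcases hqZ.dvd_or_dvd h1 with h2 | h2
    · rw [Int.natCast_dvd_natCast, hi, hq.prime.dvd_finsetProd_iff] at h2
      obtain ⟨r, hr, hqr⟩ := h2
      rw [Finset.mem_filter, Nat.mem_primeFactors] at hr
      rw [(Nat.prime_dvd_prime_iff_eq hq hr.1.1).1 hqr] at hqd
      exact hr.2 hqd
    · exact hqZ.not_isUnit (hab.isUnit_of_dvd' hqd h2)
  · have h1 : (q : ℤ) ∣ i := by
      rw [Int.natCast_dvd_natCast]
      exact Finset.dvd_prod_of_mem _ (Finset.mem_filter.2
        ⟨Nat.mem_primeFactors.2 ⟨hq, hqh, hh.ne'⟩, hqd⟩)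
    exact hqd ((dvd_add_left (h1.mul_right b)).1 hqa')

theorem exists_dvd_add_mul {u : ℤ} {P : ℕ} (hP : 0 < P) (hu : IsCoprime u P) (b : ℤ) :
    ∃ i : ℕ, (P : ℤ) ∣ b + i * u := by
  obtain ⟨s, t, hst⟩ := hu
  have hpos : (0 : ℤ) < P := by exact_mod_cast hP
  refine ⟨((-b * s) % P).toNat, ?_⟩
  rw [Int.toNat_of_nonneg (Int.emod_nonneg _ hpos.ne')]
  obtain ⟨k, hk⟩ : (P : ℤ) ∣ (-b * s) % P - (-b * s) := by
    rw [Int.emod_def]; exact ⟨-((-b * s) / P), by ring⟩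
  rw [sub_eq_iff_eq_add] at hk
  rw [hk]
  exact ⟨k * u + b * t, by linear_combination (-b) * hst⟩

theorem xMat_pow (h i : ℕ) : ((xMat h ^ i : SL(2, ℝ)) : Matrix (Fin 2) (Fin 2) ℝ) =
    !![1, i / (h : ℝ); 0, 1] := by
  induction i with
  | zero => simp [Matrix.one_fin_two]
  | succ i ih =>
    rw [pow_succ, Matrix.SpecialLinearGroup.coe_mul, ih, xMat]
    ext k l
    fin_cases k <;> fin_cases l <;> simp [Matrix.mul_apply, Fin.sum_univ_two]
    ring

theorem yMat_pow (n i : ℕ) : ((yMat n ^ i : SL(2, ℝ)) : Matrix (Fin 2) (Fin 2) ℝ) =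
    !![1, 0; i * (n : ℝ), 1] := by
  induction i with
  | zero => simp [Matrix.one_fin_two]
  | succ i ih =>
    rw [pow_succ, Matrix.SpecialLinearGroup.coe_mul, ih, yMat]
    ext k l
    fin_cases k <;> fin_cases l <;> simp [Matrix.mul_apply, Fin.sum_univ_two]
    ring

/-- The group `Γ₀(n|h)` is generated by `Γ₀(nh)`, `x` and `y`. -/
theorem exists_mul_mem_Gamma0R {n h : ℕ} (hn : 0 < n) (hh : h ∣ n) {γ : SL(2, ℝ)}
    (hγ : γ ∈ wCoset n h 1) :
    ∃ i j l : ℕ, yMat n ^ j * xMat h ^ i * γ * xMat h ^ l ∈ Gamma0R (n * h) := by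
  obtain ⟨k, rfl⟩ := hh
  have hh0 : 0 < h := Nat.pos_of_mul_pos_right hn
  have h3 : (h : ℝ) ≠ 0 := by positivity
  obtain ⟨a, b, c, d, hd, hγ⟩ := (mem_wCoset_iff (e := 1) (m := k) hh0 one_pos).1 (by simpa using hγ)
  -- Left multiplication by x^i turns a into a + ick, which can be made prime to h. Then a power of
  -- y on the left clears the lower left entry modulo h, and a power of x on the right the upper
  -- right one.
  obtain ⟨i, hi⟩ := exists_isCoprime_add_mul (a := a) (b := c * k)
    ⟨d, -b, by push_cast at hd; linear_combination hd⟩ hh0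
  obtain ⟨j, c', hj⟩ := exists_dvd_add_mul hh0 hi c
  obtain ⟨l, b', hl⟩ := exists_dvd_add_mul hh0 hi (b + i * d)
  refine ⟨i, j, l, mem_Gamma0R_iff.2
    ⟨a + i * (c * k), b', c', d + j * k * (b + i * d) + l * k * (h * c'), ?_, ?_⟩⟩
  · push_cast at hd ⊢
    linear_combination hd + k * c' * h * hl + k * (b + i * d) * hj
  · have hj' : (c : ℝ) = h * c' - j * (a + i * (c * k)) := by
      have : ((c + j * (a + i * (c * k)) : ℤ) : ℝ) = ((h * c' : ℤ) : ℝ) := by rw [hj]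
      push_cast at this; linear_combination this
    have hl' : (b : ℝ) = h * b' - l * (a + i * (c * k)) - i * d := by
      have : ((b + i * d + l * (a + i * (c * k)) : ℤ) : ℝ) = ((h * b' : ℤ) : ℝ) := by rw [hl]
      push_cast at this; linear_combination this
    simp only [Matrix.SpecialLinearGroup.coe_mul, xMat_pow, yMat_pow, hγ, wM]
    ext r s
    fin_cases r <;> fin_cases s <;> simp [Matrix.mul_apply, Fin.sum_univ_two]
    · field_simp
    · field_simp
      linear_combination hl'
    · field_simp
      linear_combination k * hj'
    · field_simp
      linear_combination l * k * hj'

theorem wM_mul_T {h e m : ℕ} (hh : 0 < h) (he : 0 < e) (a b c d i : ℤ) :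
    wM h e m a b c d * !![1, (i : ℝ); 0, 1] =
      wM h e m a (b + i * (a * e * h)) c (d + i * (c * h * m)) := by
  have h1 : (0 : ℝ) < √(e : ℝ) := Real.sqrt_pos.2 (by exact_mod_cast he)
  have h2 : (e : ℝ) = √(e : ℝ) ^ 2 := (Real.sq_sqrt (by positivity)).symm
  have h3 : (h : ℝ) ≠ 0 := by positivity
  simp only [wM]
  push_cast
  generalize √(e : ℝ) = s at *
  rw [h2]
  ext r t
  fin_cases r <;> fin_cases t <;> simp [Matrix.mul_apply, Fin.sum_univ_two] <;> field_simp <;> ring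

theorem wM_mul_L {h e m : ℕ} (hh : 0 < h) (he : 0 < e) (a b c d j : ℤ) :
    wM h e m a b c d * !![1, 0; (j : ℝ) * (h * e * m * h), 1] =
      wM h e m (a + j * (h * m * b)) b (c + j * (h * e * d)) d := by
  have h1 : (0 : ℝ) < √(e : ℝ) := Real.sqrt_pos.2 (by exact_mod_cast he)
  have h2 : (e : ℝ) = √(e : ℝ) ^ 2 := (Real.sq_sqrt (by positivity)).symm
  have h3 : (h : ℝ) ≠ 0 := by positivity
  simp only [wM]
  push_cast
  generalize √(e : ℝ) = s at *
  rw [h2]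
  ext r t
  fin_cases r <;> fin_cases t <;> simp [Matrix.mul_apply, Fin.sum_univ_two] <;> field_simp

theorem exists_T_mem_Gamma0R (N : ℕ) (i : ℤ) : ∃ δ ∈ Gamma0R N,
    (δ : Matrix (Fin 2) (Fin 2) ℝ) = !![1, (i : ℝ); 0, 1] :=
  ⟨⟨!![1, (i : ℝ); 0, 1], by simp⟩, mem_Gamma0R_iff.2 ⟨1, i, 0, 1, by simp, by simp⟩, rfl⟩

theorem exists_L_mem_Gamma0R (N : ℕ) (j : ℤ) : ∃ δ ∈ Gamma0R N,
    (δ : Matrix (Fin 2) (Fin 2) ℝ) = !![1, 0; (j : ℝ) * N, 1] :=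
  ⟨⟨!![1, 0; (j : ℝ) * N, 1], by simp⟩, mem_Gamma0R_iff.2 ⟨1, 0, j, 1, by simp, by simp⟩, rfl⟩

/-- Modulo `Γ₀(nh)`, the elements of `w_e` have representatives with prescribed divisibility of
the off-diagonal entries by powers of a prime `p ∤ nh`. -/
theorem exists_mul_eq_wM {h e m p : ℕ} (hh : 0 < h) (he : 0 < e) (hp : p.Prime)
    (hph : ¬ p ∣ h) (hpe : ¬ p ∣ e) (hpm : ¬ p ∣ m) (β : ℕ) {γ : SL(2, ℝ)}
    (hγ : γ ∈ wCoset (h * e * m) h e) :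
    ∃ δ ∈ Gamma0R (h * e * m * h), ∃ a b c d : ℤ, a * d * e - (p ^ β : ℕ) * b * (p * c) * m = 1 ∧
      ((γ * δ : SL(2, ℝ)) : Matrix (Fin 2) (Fin 2) ℝ) =
        wM h e m a ((p ^ β : ℕ) * b) (p * c) d := by
  obtain ⟨a, b, c, d, hd, hγ⟩ := (mem_wCoset_iff hh he).1 hγ
  have hpZ : Prime (p : ℤ) := Nat.prime_iff_prime_int.1 hp
  have cop : ∀ u : ℤ, ¬ (p : ℤ) ∣ u → IsCoprime u p := fun u hu =>
    ((hpZ.irreducible.coprime_iff_not_dvd).2 hu).symm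
  have hph' : ¬ (p : ℤ) ∣ h := by exact_mod_cast hph
  have hpe' : ¬ (p : ℤ) ∣ e := by exact_mod_cast hpe
  have hpm' : ¬ (p : ℤ) ∣ m := by exact_mod_cast hpm
  -- A translation makes d prime to p: if p ∣ d, the determinant forces p ∤ c, so chm is prime to p.
  obtain ⟨i, hi⟩ : ∃ i : ℤ, ¬ (p : ℤ) ∣ d + i * (c * h * m) := by
    by_cases hpd : (p : ℤ) ∣ d
    · refine ⟨1, fun hdvd => ?_⟩
      rw [one_mul, dvd_add_right hpd] at hdvd
      have hc : (p : ℤ) ∣ c := by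
        rcases hpZ.dvd_or_dvd hdvd with h1 | h1
        · exact (hpZ.dvd_or_dvd h1).resolve_right hph'
        · exact absurd h1 hpm'
      refine hpZ.not_isUnit (isUnit_of_dvd_one (hd ▸ dvd_sub ?_ ?_))
      · exact (hpd.mul_left a).mul_right _
      · exact (hc.mul_left b).mul_right _
    · exact ⟨0, by simpa using hpd⟩
  set b₁ := b + i * (a * e * h)
  set d₁ := d + i * (c * h * m)
  have hd₁ : a * d₁ * e - b₁ * c * m = 1 := by simp only [b₁, d₁]; linear_combination hd
  -- Since d₁ is now prime to p, a lower triangular element of Γ₀(nh) makes c divisible by p. Then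
  -- the determinant shows that a₁ is prime to p, and a second translation makes the upper right
  -- entry divisible by p^β.
  obtain ⟨j, c', hc'⟩ := exists_dvd_add_mul (u := h * e * d₁) hp.pos
    (((cop _ hph').mul_left (cop _ hpe')).mul_left (cop _ hi)) c
  set a₁ := a + j * (h * m * b₁)
  have hd₂ : a₁ * d₁ * e - b₁ * (p * c') * m = 1 := by
    simp only [a₁]; linear_combination hd₁ + b₁ * m * hc'
  have ha₁ : ¬ (p : ℤ) ∣ a₁ := fun hdvd =>
    hpZ.not_isUnit (isUnit_of_dvd_one (hd₂ ▸ dvd_sub ((hdvd.mul_right d₁).mul_right _)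
      ((Dvd.intro _ rfl : (p : ℤ) ∣ p * c').mul_left b₁ |>.mul_right _)))
  obtain ⟨l, b', hl⟩ := exists_dvd_add_mul (u := a₁ * e * h) (P := p ^ β) (pow_pos hp.pos β)
    (by
      push_cast
      exact (((cop _ ha₁).mul_left (cop _ hpe')).mul_left (cop _ hph')).pow_right) b₁
  obtain ⟨δ₁, hδ₁, e₁⟩ := exists_T_mem_Gamma0R (h * e * m * h) i
  obtain ⟨δ₂, hδ₂, e₂⟩ := exists_L_mem_Gamma0R (h * e * m * h) j
  obtain ⟨δ₃, hδ₃, e₃⟩ := exists_T_mem_Gamma0R (h * e * m * h) l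
  refine ⟨δ₁ * δ₂ * δ₃, mul_mem (mul_mem hδ₁ hδ₂) hδ₃, a₁, b', c', d₁ + l * (p * c' * h * m),
    ?_, ?_⟩
  · linear_combination hd₂ + p * c' * m * hl
  · rw [← mul_assoc, ← mul_assoc]
    simp only [Matrix.SpecialLinearGroup.coe_mul, hγ, e₁, e₂, e₃]
    push_cast
    have := wM_mul_L hh he (m := m) a b₁ c d₁ j
    push_cast at this
    rw [wM_mul_T hh he, this]
    have h4 : c + j * (h * e * d₁) = p * c' := hc'
    have h5 := wM_mul_T hh he (m := m) a₁ b₁ (c + j * (h * e * d₁)) d₁ l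
    push_cast at h5
    rw [h5, h4, hl]
    push_cast
    rfl

/-! ### Atkin–Lehner matrices -/

/-- Induction on h, moving one common prime at a time into t. With this t, the number e t² is an
exact divisor of nh whenever e is one of n/h. -/
theorem exists_coprime_part {h : ℕ} (hh : 0 < h) (e : ℕ) : ∃ t r : ℕ, h = t * r ∧
    Nat.Coprime r e ∧ ∀ q : ℕ, q.Prime → q ∣ t → q ∣ e := by
  induction h using Nat.strong_induction_on with
  | _ h ih =>
    by_cases hc : Nat.Coprime h e
    · exact ⟨1, h, by simp, hc, fun q hq h1 => absurd (Nat.dvd_one.1 h1) hq.ne_one⟩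
    · obtain ⟨q, hq, ⟨h', rfl⟩, hqe⟩ := Nat.Prime.not_coprime_iff_dvd.1 hc
      have hh' : 0 < h' := Nat.pos_of_mul_pos_left hh
      obtain ⟨t, r, rfl, hr, ht⟩ := ih h' (by nlinarith [hq.two_le]) hh'
      refine ⟨q * t, r, by ring, hr, fun q' hq' h1 => ?_⟩
      rcases hq'.dvd_mul.1 h1 with h2 | h2
      · rwa [(Nat.prime_dvd_prime_iff_eq hq' hq).1 h2]
      · exact ht q' hq' h2

/-- √(e t²) = t √e, so t moves to the diagonal entries and r = h/t to the others. Hence the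
Atkin–Lehner matrices of level nh for E = e t² lie in w_e. -/
theorem wM_sq_mul {t r e m : ℕ} (ht : 0 < t) (hr : 0 < r) (he : 0 < e) (a b c d : ℤ) :
    wM 1 (e * t ^ 2) (r ^ 2 * m) a b c d = wM (t * r) e m (a * t) (b * r) (c * r) (d * t) := by
  have h1 : (0 : ℝ) < √(e : ℝ) := Real.sqrt_pos.2 (by exact_mod_cast he)
  have h3 : (t : ℝ) ≠ 0 := by positivity
  have h4 : (r : ℝ) ≠ 0 := by positivity
  simp only [wM]
  push_cast
  rw [Real.sqrt_mul (by positivity), Real.sqrt_sq (by positivity)]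
  ext i j
  fin_cases i <;> fin_cases j <;> simp <;> field_simp

theorem atkinLehner_subset_wCoset {t r e m : ℕ} (ht : 0 < t) (hr : 0 < r) (he : 0 < e) :
    atkinLehner (t * r * e * m * (t * r)) (e * t ^ 2) ⊆ wCoset (t * r * e * m) (t * r) e := by
  intro γ hγ
  rw [atkinLehner, show t * r * e * m * (t * r) = 1 * (e * t ^ 2) * (r ^ 2 * m) by ring,
    mem_wCoset_iff one_pos (by positivity)] at hγ
  obtain ⟨a, b, c, d, hd, hγ⟩ := hγ
  rw [mem_wCoset_iff (by positivity) he]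
  exact ⟨a * t, b * r, c * r, d * t, by push_cast at hd; linear_combination hd,
    by rw [hγ, wM_sq_mul ht hr he]⟩

theorem atkinLehner_nonempty {N E : ℕ} (hN : 0 < N) (hE : ExactDvd E N) :
    (atkinLehner N E).Nonempty := by
  obtain ⟨⟨m, rfl⟩, hc⟩ := hE
  have hE0 : 0 < E := Nat.pos_of_mul_pos_right hN
  rw [Nat.mul_div_cancel_left _ hE0] at hc
  obtain ⟨x, y, hxy⟩ := Nat.isCoprime_iff_coprime.2 hc
  refine ⟨wSL (h := 1) (e := E) (m := m) one_pos hE0 (a := x) (b := -y) (c := 1) (d := 1)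
    (by linear_combination hxy), ?_⟩
  rw [atkinLehner, show E * m = 1 * E * m by ring, mem_wCoset_iff one_pos hE0]
  exact ⟨x, -y, 1, 1, by linear_combination hxy, rfl⟩

end Moonshine

end


noncomputable section

namespace Moonshine

/-! ### Conjugation by `diag(1, P)` -/

/-- The matrix `diag(1, P) / √P`. -/
def diagSL {P : ℕ} (hP : 0 < P) : SL(2, ℝ) :=
  ⟨!![1 / √(P : ℝ), 0; 0, √(P : ℝ)], by
    have : √(P : ℝ) ≠ 0 := (Real.sqrt_pos.2 (by exact_mod_cast hP)).ne'
    rw [Matrix.det_fin_two_of]; field_simp; simp⟩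

/-- Conjugation by `diag(1, P)`. -/
def conjDiag {P : ℕ} (hP : 0 < P) : SL(2, ℝ) →* SL(2, ℝ) := (MulAut.conj (diagSL hP)).toMonoidHom

theorem coe_conjDiag {P : ℕ} (hP : 0 < P) (γ : SL(2, ℝ)) :
    (conjDiag hP γ : Matrix (Fin 2) (Fin 2) ℝ) = !![γ 0 0, γ 0 1 / P; γ 1 0 * P, γ 1 1] := by
  have h1 : (0 : ℝ) < √(P : ℝ) := Real.sqrt_pos.2 (by exact_mod_cast hP)
  have h2 : (P : ℝ) = √(P : ℝ) ^ 2 := (Real.sq_sqrt (by positivity)).symm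
  change ((diagSL hP * γ * (diagSL hP)⁻¹ : SL(2, ℝ)) : Matrix (Fin 2) (Fin 2) ℝ) = _
  rw [Matrix.SpecialLinearGroup.coe_mul, Matrix.SpecialLinearGroup.coe_mul,
    Matrix.SpecialLinearGroup.coe_inv]
  simp only [diagSL, Matrix.adjugate_fin_two_of]
  generalize √(P : ℝ) = s at *
  rw [h2]
  ext i j
  fin_cases i <;> fin_cases j <;>
    simp [Matrix.mul_apply, Matrix.vecMul, dotProduct, Fin.sum_univ_two] <;> field_simp

/-- Conjugation by `diag(1, P)` sends elements of level `n|h` with off-diagonal entries divisible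
by `P` and `p` to level `p^α n|h`, if `p^α` divides `P p`. -/
theorem conjDiag_eq_wM {h e m p α β : ℕ} (hp : 0 < p) (hα : α ≤ β + 1) {γ : SL(2, ℝ)}
    {a b c d : ℤ} (hγ : (γ : Matrix (Fin 2) (Fin 2) ℝ) = wM h e m a ((p ^ β : ℕ) * b) (p * c) d) :
    (conjDiag (P := p ^ β) (pow_pos hp β) γ : Matrix (Fin 2) (Fin 2) ℝ) =
      wM h e (p ^ α * m) a b (c * p ^ (β + 1 - α)) d := by
  have h1 : (p : ℝ) ^ β ≠ 0 := by positivity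
  have h2 : (p : ℝ) ^ (β + 1 - α) * (p : ℝ) ^ α = p ^ β * p := by
    rw [← pow_add, ← pow_succ]; congr 1; omega
  rw [coe_conjDiag]
  have h00 : γ 0 0 = wM h e m a ((p ^ β : ℕ) * b) (p * c) d 0 0 := by rw [← hγ]
  have h01 : γ 0 1 = wM h e m a ((p ^ β : ℕ) * b) (p * c) d 0 1 := by rw [← hγ]
  have h10 : γ 1 0 = wM h e m a ((p ^ β : ℕ) * b) (p * c) d 1 0 := by rw [← hγ]
  have h11 : γ 1 1 = wM h e m a ((p ^ β : ℕ) * b) (p * c) d 1 1 := by rw [← hγ]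
  rw [h00, h01, h10, h11]
  simp only [wM]
  push_cast
  ext i j
  fin_cases i <;> fin_cases j <;> simp
  · field_simp
  · linear_combination (-(c : ℝ) * h * m * √(e : ℝ)) * h2

/-! ### The exact divisors in `AL(Γ)` -/

/-- The dictionary between the cosets w_e, which describe Γ, and `AL`, which refers to level nh: the
coset w_e corresponds to E = e t², where t is the part of h supported at the primes of e. -/
theorem exists_mem_AL {n h e : ℕ} {Γ : Subgroup SL(2, ℝ)} (hn : 0 < n) (hh : h ∣ n)
    (he : ExactDvd e (n / h)) (hΓ : wCoset n h e ⊆ Γ) :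
    ∃ t r m : ℕ, 0 < t ∧ 0 < r ∧ 0 < e ∧ h = t * r ∧ n = t * r * e * m ∧ e * t ^ 2 ∈ AL n h Γ := by
  obtain ⟨k, rfl⟩ := hh
  have hh0 : 0 < h := Nat.pos_of_mul_pos_right hn
  rw [Nat.mul_div_cancel_left _ hh0] at he
  have he0 := he.pos (Nat.pos_of_mul_pos_left hn)
  obtain ⟨⟨m, rfl⟩, hem⟩ := he
  rw [Nat.mul_div_cancel_left _ he0] at hem
  obtain ⟨t, r, rfl, hre, ht⟩ := exists_coprime_part hh0 e
  have ht0 : 0 < t := Nat.pos_of_mul_pos_right hh0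
  have hr0 : 0 < r := Nat.pos_of_mul_pos_left hh0
  have htc : ∀ x : ℕ, Nat.Coprime x e → Nat.Coprime x t := fun x hx =>
    Nat.coprime_of_dvd fun q hq h1 h2 => hq.not_dvd_one (hx ▸ Nat.dvd_gcd h1 (ht q hq h2))
  have hexact : ExactDvd (e * t ^ 2) (t * r * (e * m) * (t * r)) := by
    refine ⟨⟨r ^ 2 * m, by ring⟩, ?_⟩
    rw [show t * r * (e * m) * (t * r) / (e * t ^ 2) = r ^ 2 * m from
      Nat.div_eq_of_eq_mul_left (by positivity) (by ring)]
    have c1 : Nat.Coprime (r ^ 2 * m) e := Nat.Coprime.mul_left (hre.pow_left 2) hem.symm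
    exact (Nat.Coprime.mul_right c1 ((htc _ c1).pow_right 2)).symm
  refine ⟨t, r, m, ht0, hr0, he0, rfl, by ring, hexact, ?_, ?_⟩
  · refine Set.Subset.trans ?_ hΓ
    have := atkinLehner_subset_wCoset (m := m) ht0 hr0 he0
    rwa [mul_assoc (t * r)] at this
  · intro q hq hqE
    rw [Nat.mul_div_cancel_left _ hh0]
    rcases hq.dvd_mul.1 hqE with h1 | h1
    · exact h1.mul_right m
    · exact (ht q hq (hq.dvd_of_dvd_pow h1)).mul_right m

theorem exactMul_self {e : ℕ} (he : 0 < e) : exactMul e e = 1 := by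
  rw [exactMul, Nat.gcd_self, ← sq, Nat.div_self (by positivity)]

theorem inv_mul_mem_wCoset_one {n h e : ℕ} (hn : 0 < n) (hh : h ∣ n) (he : ExactDvd e (n / h))
    {γ₁ γ₂ : SL(2, ℝ)} (h₁ : γ₁ ∈ wCoset n h e) (h₂ : γ₂ ∈ wCoset n h e) :
    γ₁⁻¹ * γ₂ ∈ wCoset n h 1 := by
  have he0 : 0 < e := he.pos (Nat.div_pos (Nat.le_of_dvd hn hh) (Nat.pos_of_dvd_of_pos hh hn))
  have := mul_mem_wCoset hn hh he he (γ₁ := γ₁⁻¹) (γ₂ := γ₂) ?_ h₂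
  · rwa [exactMul_self he0] at this
  · obtain ⟨k, rfl⟩ := hh
    have hh0 : 0 < h := Nat.pos_of_mul_pos_right hn
    rw [Nat.mul_div_cancel_left _ hh0] at he
    obtain ⟨⟨m, rfl⟩, -⟩ := he
    rw [← mul_assoc] at h₁ ⊢
    exact inv_mem_wCoset hh0 he0 h₁

theorem ExactDvd.mul_pow {e k p : ℕ} (hp : p.Prime) (hk : 0 < k) (hpk : ¬ p ∣ k) (α : ℕ)
    (he : ExactDvd e k) : ExactDvd e (p ^ α * k) := by
  have he0 := he.pos hk
  obtain ⟨⟨m, rfl⟩, hc⟩ := he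
  rw [Nat.mul_div_cancel_left _ he0] at hc
  refine ⟨⟨p ^ α * m, by ring⟩, ?_⟩
  rw [show p ^ α * (e * m) / e = p ^ α * m from
    Nat.div_eq_of_eq_mul_left he0 (by ring)]
  refine Nat.Coprime.mul_right (Nat.Coprime.pow_right α ?_) hc
  exact ((hp.coprime_iff_not_dvd).2 fun h => hpk (h.mul_right m)).symm

/-- A unit modulo h ∣ 24 is its own inverse. This lets exponents p^k that arise on the wrong side of
an identity of h-th roots of unity be moved to the other side. -/
theorem pow_sq_modEq_one {h p : ℕ} (h24 : h ∣ 24) (hp : p.Prime) (hph : ¬ p ∣ h)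
    (k : ℕ) : p ^ k * p ^ k ≡ 1 [MOD h] := by
  have hc : Nat.Coprime (p ^ k) h := ((hp.coprime_iff_not_dvd).2 hph).pow_left k
  obtain ⟨x, y, hxy⟩ := Nat.isCoprime_iff_coprime.2 hc
  obtain ⟨z, hz⟩ := dvd_sub_of_dvd_24 h24 (a := (p ^ k : ℕ)) (d := x)
    ⟨-y, by linear_combination hxy⟩
  refine Nat.ModEq.symm ((Nat.modEq_iff_dvd).2 ⟨z * (p ^ k : ℕ) - y, ?_⟩)
  push_cast at *
  linear_combination (p : ℤ) ^ k * hz + hxy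

section Induced

variable {p : ℕ} {α β n h : ℕ} {Γ Γ' : Subgroup SL(2, ℝ)}

theorem not_dvd_div (hpn : ¬ p ∣ n * h) (hh : h ∣ n) : ¬ p ∣ n / h := fun h1 =>
  hpn ((h1.trans (Nat.div_dvd_of_dvd hh)).mul_right h)

theorem pow_mul_div (hh : h ∣ n) : p ^ α * n / h = p ^ α * (n / h) := Nat.mul_div_assoc _ hh

/-- If `w_e ⊆ Γ'` at level `n|h` then `w_e ⊆ Γ` at level `p^α n|h`. -/
theorem wCoset_subset_of_AL [hp : Fact p.Prime] (hpn : ¬ p ∣ n * h) (hΓ : IsTypeGroup (p ^ α * n) h Γ)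
    (hΓ' : IsTypeGroup n h Γ')
    (hAL : ∀ E : ℕ, E ∈ AL n h Γ' ↔ E ∈ AL (p ^ α * n) h Γ ∧ ¬ p ∣ E) {e : ℕ}
    (he : ExactDvd e (n / h)) (hsub : wCoset n h e ⊆ Γ') : wCoset (p ^ α * n) h e ⊆ Γ := by
  have hn := hΓ'.pos_left
  obtain ⟨t, r, m, ht, hr, he0, hh, hnm, hE⟩ := exists_mem_AL hn hΓ'.dvd he hsub
  have hE' := ((hAL _).1 hE).1
  obtain ⟨W, hW⟩ := atkinLehner_nonempty (Nat.mul_pos hΓ.pos_left hΓ.pos_right) hE'.1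
  have hWΓ : W ∈ Γ := hE'.2.1 hW
  have hWe : W ∈ wCoset (p ^ α * n) h e := by
    have := atkinLehner_subset_wCoset (m := p ^ α * m) ht hr he0
    rw [hh, hnm, show p ^ α * (t * r * e * m) = t * r * e * (p ^ α * m) by ring]
    refine this ?_
    rwa [hh, hnm, show p ^ α * (t * r * e * m) = t * r * e * (p ^ α * m) by ring] at hW
  intro γ hγ
  have h1 : W⁻¹ * γ ∈ wCoset (p ^ α * n) h 1 := by
    refine inv_mul_mem_wCoset_one hΓ.pos_left hΓ.dvd ?_ hWe hγ
    rw [pow_mul_div hΓ'.dvd]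
    exact he.mul_pow hp.out (Nat.div_pos (Nat.le_of_dvd hn hΓ'.dvd) hΓ.pos_right)
      (not_dvd_div hpn hΓ'.dvd) α
  obtain ⟨-, -, S, hS, hSΓ⟩ := hΓ
  have h2 : W⁻¹ * γ ∈ Γ := by
    rw [hSΓ]; exact Subgroup.subset_closure (Set.mem_biUnion hS.one_mem h1)
  simpa using Γ.mul_mem hWΓ h2

/-- Modulo Γ₀(nh), every element of w_e is a word in x, y' and one Atkin–Lehner matrix for E = e t²,
and both maps are prescribed on all of these. -/
theorem inducedEigenvalueMap_unique (hΓ : IsTypeGroup (p ^ α * n) h Γ)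
    (hΓ' : IsTypeGroup n h Γ')
    (hAL : ∀ E : ℕ, E ∈ AL n h Γ' ↔ E ∈ AL (p ^ α * n) h Γ ∧ ¬ p ∣ E)
    {χ : Γ →* rootsOfUnity (2 * h) ℂ} {χ₁ χ₂ : Γ' →* rootsOfUnity (2 * h) ℂ}
    (h₁ : IsInducedEigenvalueMap p α β n h hΓ hΓ' χ χ₁)
    (h₂ : IsInducedEigenvalueMap p α β n h hΓ hΓ' χ χ₂) : χ₁ = χ₂ := by
  have hn := hΓ'.pos_left
  obtain ⟨-, -, S, hS, hSΓ⟩ := id hΓ'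
  have hmem : ∀ e ∈ S, wCoset n h e ⊆ Γ' := fun e he γ hγ => by
    rw [hSΓ]; exact Subgroup.subset_closure (Set.mem_biUnion he hγ)
  ext γ : 1
  obtain ⟨γ, hγ⟩ := γ
  obtain ⟨e, he, hγe⟩ := (mem_closure_wCoset_iff hn hΓ'.dvd hS).1 (hSΓ ▸ hγ)
  obtain ⟨t, r, m, ht, hr, he0, hh, hnm, hE⟩ :=
    exists_mem_AL hn hΓ'.dvd (hS.exact e he) (hmem e he)
  have hE' := ((hAL _).1 hE).1
  obtain ⟨W, hW⟩ := atkinLehner_nonempty (Nat.mul_pos hn hΓ'.pos_right) hE.1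
  obtain ⟨W₀, hW₀⟩ := atkinLehner_nonempty (Nat.mul_pos hΓ.pos_left hΓ'.pos_right) hE'.1
  have hWe : W ∈ wCoset n h e := by
    have := atkinLehner_subset_wCoset (m := m) ht hr he0
    rw [hh, hnm]
    refine this ?_
    rwa [hh, hnm] at hW
  have hW1 : χ₁ ⟨W, hE.2.1 hW⟩ = χ₂ ⟨W, hE.2.1 hW⟩ := by
    rw [h₁.map_W _ hE ⟨W, hE.2.1 hW⟩ ⟨W₀, hE'.2.1 hW₀⟩ hW hW₀,
      h₂.map_W _ hE ⟨W, hE.2.1 hW⟩ ⟨W₀, hE'.2.1 hW₀⟩ hW hW₀]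
  obtain ⟨i, j, l, hδ⟩ := exists_mul_mem_Gamma0R hn hΓ'.dvd
    (inv_mul_mem_wCoset_one hn hΓ'.dvd (hS.exact e he) hWe hγe)
  set X : Γ' := ⟨xMat h, hΓ'.xMat_mem⟩
  set Y : Γ' := ⟨yMat n, hΓ'.yMat_mem⟩
  set W' : Γ' := ⟨W, hE.2.1 hW⟩
  have hX : χ₁ X = χ₂ X := by rw [h₁.map_x, h₂.map_x]
  have hY : χ₁ Y = χ₂ Y := by rw [h₁.map_y, h₂.map_y]
  have hδ' : (((Y ^ j * X ^ i * (W'⁻¹ * ⟨γ, hγ⟩) * X ^ l : Γ') : SL(2, ℝ))) ∈ Gamma0R (n * h) := hδ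
  have e1 := h₁.isEigenvalueMap _ hδ'
  have e2 := h₂.isEigenvalueMap _ hδ'
  rw [← e2] at e1
  simp only [map_mul, map_pow, map_inv, hX, hY, hW1] at e1
  simpa using e1

/-- The eigenvalue map on the `n|h`-type group `Γ'` induced by one on a `p^α n|h`-type group. -/
theorem exists_inducedEigenvalueMap [hp : Fact p.Prime] (hpn : ¬ p ∣ n * h) (hα : α ≤ β + 1)
    (hΓ : IsTypeGroup (p ^ α * n) h Γ) (hΓ' : IsTypeGroup n h Γ')
    (hAL : ∀ E : ℕ, E ∈ AL n h Γ' ↔ E ∈ AL (p ^ α * n) h Γ ∧ ¬ p ∣ E)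
    {S : Set ℕ} (hS : IsExactDivisorSubgroup (n / h) S)
    (hSΓ : Γ' = Subgroup.closure (⋃ e ∈ S, wCoset n h e))
    (χ : Γ →* rootsOfUnity (2 * h) ℂ) (hχ : IsEigenvalueMap (p ^ α * n) h χ) :
    ∃ χ' : Γ' →* rootsOfUnity (2 * h) ℂ, IsInducedEigenvalueMap p α β n h hΓ hΓ' χ χ' ∧
      ∀ (w : Γ') (w₁ : Γ), (w₁ : SL(2, ℝ)) = conjDiag (pow_pos hp.out.pos β) (w : SL(2, ℝ)) →
        (∃ e ∈ S, (w₁ : SL(2, ℝ)) ∈ wCoset (p ^ α * n) h e) → χ' w = χ w₁ := by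
  have hn := hΓ'.pos_left
  have hh0 := hΓ'.pos_right
  have hk0 : 0 < n / h := Nat.div_pos (Nat.le_of_dvd hn hΓ'.dvd) hh0
  have hpZ : Prime (p : ℤ) := Nat.prime_iff_prime_int.1 hp.out
  have hph : ¬ p ∣ h := fun h1 => hpn (h1.mul_left n)
  have hpn' : ¬ p ∣ n := fun h1 => hpn (h1.mul_right h)
  have hmem : ∀ e ∈ S, wCoset n h e ⊆ Γ' := fun e he γ hγ => by
    rw [hSΓ]; exact Subgroup.subset_closure (Set.mem_biUnion he hγ)
  have hmem' : ∀ e ∈ S, wCoset (p ^ α * n) h e ⊆ Γ := fun e he =>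
    wCoset_subset_of_AL hpn hΓ hΓ' hAL (hS.exact e he) (hmem e he)
  have hS' : IsExactDivisorSubgroup (p ^ α * n / h) S := by
    refine ⟨fun e he => ?_, hS.one_mem, hS.mul_mem⟩
    rw [pow_mul_div hΓ'.dvd]
    exact (hS.exact e he).mul_pow hp.out hk0 (not_dvd_div hpn hΓ'.dvd) α
  -- parametrization of elements of `w_e`
  have hparam : ∀ e ∈ S, ∃ m, 0 < e ∧ n = h * e * m ∧ ¬ p ∣ e ∧ ¬ p ∣ m := by
    intro e he
    obtain ⟨m, hm⟩ := (hS.exact e he).1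
    have hnm : n = h * e * m := by rw [mul_assoc, ← hm, Nat.mul_div_cancel' hΓ'.dvd]
    refine ⟨m, (hS.exact e he).pos hk0, hnm, fun h1 => hpn' ?_, fun h1 => hpn' ?_⟩
    · rw [hnm]; exact (h1.mul_left h).mul_right m
    · rw [hnm]; exact h1.mul_left _
  set c := conjDiag (P := p ^ β) (pow_pos hp.out.pos β) with hc
  set Γt : Subgroup SL(2, ℝ) := Subgroup.closure (⋃ e ∈ S, wCoset (p ^ α * n) h e) with hΓt
  have memt : ∀ {γ : SL(2, ℝ)}, γ ∈ Γt ↔ ∃ e ∈ S, γ ∈ wCoset (p ^ α * n) h e := fun {γ} =>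
    mem_closure_wCoset_iff hΓ.pos_left hΓ.dvd hS'
  have hΓtle : Γt ≤ Γ := by
    intro γ hγ
    obtain ⟨e, he, h1⟩ := memt.1 hγ
    exact hmem' e he h1
  have mem' : ∀ {γ : SL(2, ℝ)}, γ ∈ Γ' ↔ ∃ e ∈ S, γ ∈ wCoset n h e := fun {γ} => by
    rw [hSΓ]; exact mem_closure_wCoset_iff hn hΓ'.dvd hS
  -- H consists of the elements whose conjugate by diag(1, p^β) has level p^α n|h. On H the
  -- composite of χ with the conjugation makes sense; it descends to Γ'/K because H maps onto Γ'/K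
  -- and the composite is trivial on the kernel of that map.
  set H : Subgroup Γ' := Γt.comap (c.comp Γ'.subtype) with hH
  set K : Subgroup Γ' := (Gamma0R (n * h)).subgroupOf Γ' with hK
  have hKn : K.Normal := by
    refine ⟨fun δ hδ γ => ?_⟩
    rw [hK, Subgroup.mem_subgroupOf] at hδ ⊢
    obtain ⟨e, he, h1⟩ := mem'.1 (γ⁻¹).2
    have := conj_mem_Gamma0R hn hΓ'.dvd hΓ'.dvd_24 (hS.exact e he).1 h1 hδ
    simpa using this
  let ψ : H →* rootsOfUnity (2 * h) ℂ :=
    χ.comp (((c.comp Γ'.subtype).comp H.subtype).codRestrict Γ fun w => hΓtle w.2)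
  let φ : H →* Γ' ⧸ K := (QuotientGroup.mk' K).comp H.subtype
  have hφ : Function.Surjective φ := by
    intro q
    obtain ⟨γ, rfl⟩ := QuotientGroup.mk'_surjective K q
    obtain ⟨e, he, h1⟩ := mem'.1 γ.2
    obtain ⟨m, he0, hnm, hpe, hpm⟩ := hparam e he
    rw [hnm] at h1
    obtain ⟨δ, hδ, a, b, c', d, hd, hw⟩ :=
      exists_mul_eq_wM hh0 he0 hp.out hph hpe hpm β h1
    have hδΓ : δ ∈ Γ' := hmem 1 hS.one_mem (Gamma0R_le_wCoset hh0 (by rwa [hnm]))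
    refine ⟨⟨γ * ⟨δ, hδΓ⟩, ?_⟩, ?_⟩
    · rw [hH, Subgroup.mem_comap, memt]
      refine ⟨e, he, ?_⟩
      rw [show p ^ α * n = h * e * (p ^ α * m) by rw [hnm]; ring, mem_wCoset_iff hh0 he0]
      refine ⟨a, b, c' * p ^ (β + 1 - α), d, ?_, conjDiag_eq_wM hp.out.pos hα hw⟩
      have h2 : (p : ℤ) ^ (β + 1 - α) * (p : ℤ) ^ α = p ^ β * p := by
        rw [← pow_add, ← pow_succ]; congr 1; omega
      push_cast at hd ⊢
      linear_combination hd - b * c' * m * h2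
    · change (QuotientGroup.mk' K) (γ * ⟨δ, hδΓ⟩) = QuotientGroup.mk' K γ
      rw [map_mul]
      have : QuotientGroup.mk' K ⟨δ, hδΓ⟩ = 1 := by
        rw [QuotientGroup.mk'_apply, QuotientGroup.eq_one_iff, hK, Subgroup.mem_subgroupOf]
        rwa [hnm]
      rw [this, mul_one]
  have hker : φ.ker ≤ ψ.ker := by
    intro w hw
    have hwK : ((w : Γ') : SL(2, ℝ)) ∈ Gamma0R (n * h) := by
      have : QuotientGroup.mk' K (w : Γ') = 1 := hw
      rwa [QuotientGroup.mk'_apply, QuotientGroup.eq_one_iff, hK, Subgroup.mem_subgroupOf] at this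
    refine hχ _ ?_
    change c ((w : Γ') : SL(2, ℝ)) ∈ Gamma0R (p ^ α * n * h)
    obtain ⟨e, he, h1⟩ := memt.1 w.2
    obtain ⟨m, he0, hnm, hpe, hpm⟩ := hparam e he
    change c ((w : Γ') : SL(2, ℝ)) ∈ _ at h1
    rw [show p ^ α * n = h * e * (p ^ α * m) by rw [hnm]; ring, mem_wCoset_iff hh0 he0] at h1
    obtain ⟨a₂, b₂, c₂, d₂, hd₂, hw₂⟩ := h1
    obtain ⟨a, b, c₁, d, hd, hw₁⟩ := mem_Gamma0R_iff.1 hwK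
    have hcw := coe_conjDiag (pow_pos hp.out.pos β) ((w : Γ') : SL(2, ℝ))
    rw [← hc, hw₁] at hcw
    have hcw2 := hcw
    rw [hw₂] at hcw2
    have s0 : √(e : ℝ) ^ 2 = e := Real.sq_sqrt (by positivity)
    have s00 : (a₂ : ℝ) * √(e : ℝ) = a := by simpa [wM] using congr_fun₂ hcw2 0 0
    -- From a² = a₂² e, every prime of e divides a. It also divides n, which contradicts the
    -- determinant of an element of Γ₀(nh).
    have he1 : e = 1 := by
      by_contra hne
      obtain ⟨q, hq, hqe⟩ := Nat.exists_prime_and_dvd hne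
      have hqZ : Prime (q : ℤ) := Nat.prime_iff_prime_int.1 hq
      have h2 : (a : ℤ) ^ 2 = a₂ ^ 2 * e := by
        have : (a : ℝ) ^ 2 = a₂ ^ 2 * e := by rw [← s00, mul_pow, s0]
        exact_mod_cast this
      have h3 : (q : ℤ) ∣ a := hqZ.dvd_of_dvd_pow
        (h2 ▸ (Int.natCast_dvd_natCast.2 hqe).mul_left _)
      have h4 : (q : ℤ) ∣ (n * h : ℕ) := Int.natCast_dvd_natCast.2
        ((hqe.trans ((hS.exact e he).1.trans (Nat.div_dvd_of_dvd hΓ'.dvd))).mul_right h)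
      exact hqZ.not_isUnit (isUnit_of_dvd_one (hd ▸ dvd_sub (h3.mul_right _) (h4.mul_left _)))
    subst he1
    have s01 : (b₂ : ℝ) / h = b / (p ^ β : ℕ) := by simpa [wM] using congr_fun₂ hcw2 0 1
    have s10 : (c₂ : ℝ) * h * (p ^ α * m : ℕ) = c₁ * (n * h : ℕ) * (p ^ β : ℕ) := by
      simpa [wM] using congr_fun₂ hcw2 1 0
    have hhR : (h : ℝ) ≠ 0 := by positivity
    have hpR : ((p ^ β : ℕ) : ℝ) ≠ 0 := by
      have := hp.out.pos; positivity
    have t01 : b₂ * (p ^ β : ℕ) = b * h := by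
      rw [div_eq_div_iff hhR hpR] at s01
      exact_mod_cast s01
    have t10 : c₂ * (p ^ α : ℕ) = c₁ * h * (p ^ β : ℕ) := by
      have hn' : (n : ℝ) ≠ 0 := by positivity
      have : (n : ℝ) = h * m := by rw [hnm]; push_cast; ring
      have h5 : (c₂ : ℝ) * (p ^ α : ℕ) * n = c₁ * h * (p ^ β : ℕ) * n := by
        push_cast at s10 ⊢; rw [this] at s10 ⊢; linear_combination s10
      exact_mod_cast mul_right_cancel₀ hn' h5
    have cop : ∀ k : ℕ, IsCoprime ((p ^ k : ℕ) : ℤ) (h : ℤ) := fun k => by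
      rw [Nat.isCoprime_iff_coprime]
      exact ((hp.out.coprime_iff_not_dvd).2 hph).pow_left k
    -- The conjugate only has entries b/p^β ∈ ℤ/h and c₁ n h p^β ∈ p^α n ℤ at first; p ∤ h upgrades
    -- this to the divisibilities of an element of Γ₀(p^α nh).
    obtain ⟨b', hb'⟩ : ((p ^ β : ℕ) : ℤ) ∣ b :=
      (cop β).dvd_of_dvd_mul_right (Dvd.intro_left _ t01)
    obtain ⟨c', hc'⟩ : ((p ^ α : ℕ) : ℤ) ∣ c₁ * (p ^ β : ℕ) := by
      refine (cop α).dvd_of_dvd_mul_right (Dvd.intro_left c₂ ?_)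
      rw [t10]; ring
    rw [mem_Gamma0R_iff]
    refine ⟨a, b', c', d, ?_, ?_⟩
    · push_cast at hd hb' hc' ⊢
      linear_combination hd + b' * n * h * hc' + c₁ * n * h * hb'
    · rw [hcw]
      have hbR : (b : ℝ) = (p ^ β : ℕ) * b' := by exact_mod_cast hb'
      have hcR : (c₁ : ℝ) * (p ^ β : ℕ) = (p ^ α : ℕ) * c' := by exact_mod_cast hc'
      ext i j
      push_cast at hbR hcR hpR
      fin_cases i <;> fin_cases j <;> simp
      · rw [hbR]; field_simp
      · linear_combination n * h * hcR
  let χ₀ : Γ' ⧸ K →* rootsOfUnity (2 * h) ℂ := φ.liftOfSurjective hφ ⟨ψ, hker⟩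
  have hχ₀ : ∀ w : H, χ₀ (φ w) = ψ w := fun w =>
    MonoidHom.liftOfRightInverse_comp_apply φ _ (Function.rightInverse_surjInv hφ) ⟨ψ, hker⟩ w
  let χ' : Γ' →* rootsOfUnity (2 * h) ℂ := χ₀.comp (QuotientGroup.mk' K)
  have star : ∀ (w : Γ') (w₁ : Γ), (w₁ : SL(2, ℝ)) = c (w : SL(2, ℝ)) →
        (∃ e ∈ S, (w₁ : SL(2, ℝ)) ∈ wCoset (p ^ α * n) h e) → χ' w = χ w₁ := by
    intro w w₁ hw hex
    have hwH : w ∈ H := by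
      rw [hH, Subgroup.mem_comap, memt]
      change ∃ e ∈ S, c (w : SL(2, ℝ)) ∈ _
      rwa [← hw]
    have := hχ₀ ⟨w, hwH⟩
    change χ' w = _ at this
    rw [this]
    change χ _ = χ w₁
    congr 1
    exact Subtype.ext hw.symm
  have hKone : ∀ γ : Γ', (γ : SL(2, ℝ)) ∈ Gamma0R (n * h) → χ' γ = 1 := by
    intro γ hγ
    change χ₀ (QuotientGroup.mk' K γ) = 1
    have : QuotientGroup.mk' K γ = 1 := by
      rwa [QuotientGroup.mk'_apply, QuotientGroup.eq_one_iff, hK, Subgroup.mem_subgroupOf]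
    rw [this, map_one]
  have hsq := pow_sq_modEq_one hΓ'.dvd_24 hp.out hph
  have hhR : (h : ℝ) ≠ 0 := by positivity
  have hpβ : (p : ℝ) ^ β ≠ 0 := by
    have := hp.out.pos; positivity
  have mem1 : ∀ {γ : SL(2, ℝ)}, γ ∈ wCoset (p ^ α * n) h 1 →
      ∃ e ∈ S, γ ∈ wCoset (p ^ α * n) h e := fun h1 => ⟨1, hS.one_mem, h1⟩
  refine ⟨χ', ⟨hKone, ?_, ?_, ?_⟩, star⟩
  · set X : Γ' := ⟨xMat h, hΓ'.xMat_mem⟩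
    set X₁ : Γ := ⟨xMat h, hΓ.xMat_mem⟩
    -- The conjugation sends x^(p^β) to x. Since χ'(x) is an h-th root of unity and p^(2β) ≡ 1
    -- modulo h, raising to the power p^β recovers χ'(x).
    have h1 : χ' (X ^ p ^ β) = χ X₁ := by
      refine star _ _ ?_ (mem1 ⟨1, 1, 0, 1, by simp [X₁, xMat]⟩)
      apply Subtype.ext
      change (xMat h : Matrix (Fin 2) (Fin 2) ℝ) = _
      have h2 := xMat_pow h (p ^ β)
      have h3 := coe_conjDiag (pow_pos hp.out.pos β) (xMat h ^ p ^ β)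
      rw [h2] at h3
      change _ = (c (xMat h ^ p ^ β) : Matrix (Fin 2) (Fin 2) ℝ)
      rw [h3, xMat]
      ext i j
      fin_cases i <;> fin_cases j <;> simp
      field_simp
    have h2 : χ' X ^ h = 1 := by
      rw [← map_pow]
      refine hKone _ (mem_Gamma0R_iff.2 ⟨1, 1, 0, 1, by simp, ?_⟩)
      change ((xMat h ^ h : SL(2, ℝ)) : Matrix (Fin 2) (Fin 2) ℝ) = _
      rw [xMat_pow]
      simp [hhR]
    rw [map_pow] at h1
    calc χ' X = χ' X ^ (p ^ β * p ^ β) := by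
          rw [pow_eq_pow_of_modEq (hsq β) h2, pow_one]
      _ = χ (X₁ ^ p ^ β) := by rw [pow_mul, h1, map_pow]
  · set Y : Γ' := ⟨yMat n, hΓ'.yMat_mem⟩
    set Y₁ : Γ := ⟨yMat (p ^ α * n), hΓ.yMat_mem⟩
    -- Both sides come from the lower left entry p^(α+β) n: it is the conjugate of y'^(p^α) and
    -- equals y^(p^β).
    have h1 : χ' (Y ^ p ^ α) = χ (Y₁ ^ p ^ β) := by
      have hm : ((Y₁ ^ p ^ β : Γ) : SL(2, ℝ)) = yMat (p ^ α * n) ^ p ^ β := rfl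
      refine star _ _ ?_ (mem1 ⟨1, 0, (p ^ β : ℕ), 1, ?_⟩)
      · apply Subtype.ext
        change ((yMat (p ^ α * n) ^ p ^ β : SL(2, ℝ)) : Matrix (Fin 2) (Fin 2) ℝ) = _
        have h2 := yMat_pow n (p ^ α)
        have h3 := coe_conjDiag (pow_pos hp.out.pos β) (yMat n ^ p ^ α)
        rw [h2] at h3
        change _ = (c (yMat n ^ p ^ α) : Matrix (Fin 2) (Fin 2) ℝ)
        rw [h3, yMat_pow]
        ext i j
        fin_cases i <;> fin_cases j <;> simp
        ring
      · rw [hm, yMat_pow]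
        simp
    have h2 : χ' Y ^ h = 1 := by
      rw [← map_pow]
      refine hKone _ (mem_Gamma0R_iff.2 ⟨1, 0, 1, 1, by simp, ?_⟩)
      change ((yMat n ^ h : SL(2, ℝ)) : Matrix (Fin 2) (Fin 2) ℝ) = _
      rw [yMat_pow]
      simp [mul_comm]
    rw [map_pow] at h1
    calc χ' Y = χ' Y ^ (p ^ α * p ^ α) := by
          rw [pow_eq_pow_of_modEq (hsq α) h2, pow_one]
      _ = χ (Y₁ ^ p ^ (α + β)) := by
          rw [pow_mul, h1, ← map_pow, ← pow_mul, pow_add, mul_comm (p ^ α)]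
  · intro E hE γ' γ hγ' hγ
    have hE' := ((hAL E).1 hE).1
    have hE0 : 0 < E := hE.1.pos (Nat.mul_pos hn hh0)
    obtain ⟨m', hm'⟩ := hE.1.1
    have hpE : ¬ p ∣ E := ((hAL E).1 hE).2
    have hpm' : ¬ p ∣ m' := fun h1 => hpn (hm' ▸ h1.mul_left E)
    have hγ2 : (γ' : SL(2, ℝ)) ∈ wCoset (1 * E * m') 1 E := by
      rw [one_mul, ← hm']; exact hγ'
    -- After a change by Γ₀(nh), the conjugate of γ' is an Atkin–Lehner matrix of level p^α nh for
    -- the same E. Any two of these differ by Γ₀(p^α nh), on which χ is trivial.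
    obtain ⟨δ, hδ, a, b, c', d, hd, hw⟩ :=
      exists_mul_eq_wM one_pos hE0 hp.out hp.out.not_dvd_one hpE hpm' β hγ2
    have hδ2 : δ ∈ Gamma0R (n * h) := by simpa [← hm'] using hδ
    have hδΓ : δ ∈ Γ' := hmem 1 hS.one_mem (Gamma0R_le_wCoset hh0 hδ2)
    set w : Γ' := γ' * ⟨δ, hδΓ⟩ with hwdef
    have hw' : ((w : SL(2, ℝ)) : Matrix (Fin 2) (Fin 2) ℝ) =
      wM 1 E m' a ((p ^ β : ℕ) * b) (p * c') d := hw
    have hcw := conjDiag_eq_wM (α := α) hp.out.pos hα hw'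
    have h2 : (p : ℤ) ^ (β + 1 - α) * (p : ℤ) ^ α = p ^ β * p := by
      rw [← pow_add, ← pow_succ]; congr 1; omega
    have hcE : c (w : SL(2, ℝ)) ∈ atkinLehner (p ^ α * n * h) E := by
      rw [atkinLehner, show p ^ α * n * h = 1 * E * (p ^ α * m') by
        rw [mul_assoc, hm']; ring, mem_wCoset_iff one_pos hE0]
      refine ⟨a, b, c' * p ^ (β + 1 - α), d, ?_, hcw⟩
      push_cast at hd ⊢
      linear_combination hd - b * c' * m' * h2
    have hcΓ : c (w : SL(2, ℝ)) ∈ Γ := hE'.2.1 hcE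
    have hχw : χ' w = χ ⟨c (w : SL(2, ℝ)), hcΓ⟩ := by
      refine star w _ rfl ?_
      obtain ⟨e, he, h1⟩ := mem'.1 w.2
      obtain ⟨m, he0, hnm, hpe, hpm⟩ := hparam e he
      refine ⟨e, he, ?_⟩
      have h1' := h1
      rw [hnm, mem_wCoset_iff hh0 he0] at h1'
      obtain ⟨a₁, b₁, c₁, d₁, hd₁, hw₁⟩ := h1'
      have heq := hw₁.symm.trans hw'
      have s0 : √(e : ℝ) ^ 2 = e := Real.sq_sqrt (by positivity)
      have s1 : √(E : ℝ) ^ 2 = E := Real.sq_sqrt (by positivity)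
      have p0 : √(e : ℝ) ≠ 0 := (Real.sqrt_pos.2 (by exact_mod_cast he0)).ne'
      have p1 : √(E : ℝ) ≠ 0 := (Real.sqrt_pos.2 (by exact_mod_cast hE0)).ne'
      have s01 : (b₁ : ℝ) / (h * √(e : ℝ)) = p ^ β * b / √(E : ℝ) := by
        simpa [wM] using congr_fun₂ heq 0 1
      have s10 : (c₁ : ℝ) * h * m * √(e : ℝ) = p * c' * m' * √(E : ℝ) := by
        simpa [wM] using congr_fun₂ heq 1 0
      -- w has one shape as an element of w_e and another as an Atkin–Lehner matrix. Squaring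
      -- removes the square roots, so the divisibilities by p pass from the second shape to the
      -- first.
      have t01 : b₁ ^ 2 * E = (p ^ β) ^ 2 * (b ^ 2 * h ^ 2 * e) := by
        rw [div_eq_div_iff (by positivity) p1] at s01
        have : (b₁ : ℝ) ^ 2 * E = (p ^ β) ^ 2 * (b ^ 2 * h ^ 2 * e) := by
          rw [← s0, ← s1, ← mul_pow, s01]; ring
        exact_mod_cast this
      have t10 : c₁ ^ 2 * (h ^ 2 * m ^ 2 * e) = p ^ 2 * (c' ^ 2 * m' ^ 2 * E) := by
        have : (c₁ : ℝ) ^ 2 * (h ^ 2 * m ^ 2 * e) = p ^ 2 * (c' ^ 2 * m' ^ 2 * E) := by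
          rw [← s0, ← s1]; linear_combination (c₁ * h * m * √(e : ℝ) + p * c' * m' * √(E : ℝ)) * s10
        exact_mod_cast this
      have nd : ∀ {k : ℕ}, ¬ p ∣ k → ¬ (p : ℤ) ∣ k := fun hk => by exact_mod_cast hk
      obtain ⟨b₂, hb₂⟩ : (p : ℤ) ^ β ∣ b₁ := by
        rw [← Int.pow_dvd_pow_iff (n := 2) two_ne_zero]
        refine IsCoprime.dvd_of_dvd_mul_right (z := (E : ℤ)) ?_ ?_
        · exact ((hpZ.irreducible.coprime_iff_not_dvd).2 (nd hpE)).pow_left.pow_left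
        · rw [t01]; exact Dvd.intro _ rfl
      obtain ⟨c₂, hc₂⟩ : (p : ℤ) ∣ c₁ := by
        have : (p : ℤ) ∣ c₁ ^ 2 * (h ^ 2 * m ^ 2 * e) := by
          rw [t10, sq, mul_assoc]; exact Dvd.intro _ rfl
        rcases hpZ.dvd_or_dvd this with h3 | h3
        · exact hpZ.dvd_of_dvd_pow h3
        · rcases hpZ.dvd_or_dvd h3 with h4 | h4
          · rcases hpZ.dvd_or_dvd h4 with h5 | h5
            · exact absurd (hpZ.dvd_of_dvd_pow h5) (nd hph)
            · exact absurd (hpZ.dvd_of_dvd_pow h5) (nd hpm)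
          · exact absurd h4 (nd hpe)
      rw [hb₂, hc₂, show (p : ℤ) ^ β = (p ^ β : ℕ) by push_cast; rfl] at hw₁
      rw [show p ^ α * n = h * e * (p ^ α * m) by rw [hnm]; ring, mem_wCoset_iff hh0 he0]
      refine ⟨a₁, b₂, c₂ * p ^ (β + 1 - α), d₁, ?_, conjDiag_eq_wM hp.out.pos hα hw₁⟩
      rw [hb₂, hc₂] at hd₁
      push_cast
      linear_combination hd₁ - b₂ * c₂ * m * h2
    have e1 : χ' γ' = χ' w := by
      rw [hwdef, map_mul, hKone ⟨δ, hδΓ⟩ hδ2, mul_one]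
    have e2 : χ ⟨c (w : SL(2, ℝ)), hcΓ⟩ = χ γ := by
      have h4 := inv_mul_mem_wCoset_one (n := p ^ α * n * h) (h := 1) (e := E)
        (Nat.mul_pos hΓ.pos_left hh0) (one_dvd _) (by simpa using hE'.1) hcE hγ
      have h5 := hχ ((⟨c (w : SL(2, ℝ)), hcΓ⟩ : Γ)⁻¹ * γ) (mem_Gamma0R_iff_mem_wCoset.2 h4)
      rw [map_mul, map_inv] at h5
      exact (inv_mul_eq_one.1 h5)
    rw [e1, hχw, e2]

end Induced

end Moonshine

end


/-! ### Expansions in powers of q_M and their coefficient rings. -/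

noncomputable section

namespace Moonshine

/-! ### Evaluation of power series -/

/-- The power series `P` converges at `x` with sum `s`. -/
def HasEval (P : PowerSeries ℂ) (x s : ℂ) : Prop :=
  HasSum (fun m : ℕ => PowerSeries.coeff m P * x ^ m) s

namespace HasEval

variable {P Q : PowerSeries ℂ} {x s t : ℂ}

theorem add (hP : HasEval P x s) (hQ : HasEval Q x t) : HasEval (P + Q) x (s + t) := by
  simpa [HasEval, add_mul] using HasSum.add hP hQ

theorem neg (hP : HasEval P x s) : HasEval (-P) x (-s) := by
  simpa [HasEval, neg_mul] using HasSum.neg hP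

theorem mul (hP : HasEval P x s) (hQ : HasEval Q x t) : HasEval (P * Q) x (s * t) := by
  have h₁ := hP.summable.norm
  have h₂ := hQ.summable.norm
  have key : (fun m : ℕ => PowerSeries.coeff m (P * Q) * x ^ m) = fun m : ℕ =>
      ∑ kl ∈ Finset.HasAntidiagonal.antidiagonal m, (PowerSeries.coeff kl.1 P * x ^ kl.1) *
        (PowerSeries.coeff kl.2 Q * x ^ kl.2) := by
    funext m
    rw [PowerSeries.coeff_mul, Finset.sum_mul]
    refine Finset.sum_congr rfl fun kl hkl => ?_
    rw [← Finset.HasAntidiagonal.mem_antidiagonal.1 hkl, pow_add]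
    ring
  have hs := (summable_norm_sum_mul_antidiagonal_of_summable_norm h₁ h₂).of_norm
  rw [HasEval, key, ← hP.tsum_eq, ← hQ.tsum_eq,
    tsum_mul_tsum_eq_tsum_sum_antidiagonal_of_summable_norm h₁ h₂]
  exact hs.hasSum

theorem const (c x : ℂ) : HasEval (PowerSeries.C c) x c := by
  have := hasSum_ite_eq (0 : ℕ) c
  refine this.congr_fun ?_
  intro m
  rcases eq_or_ne m 0 with rfl | hm <;> simp [PowerSeries.coeff_C, *]

theorem X (x : ℂ) : HasEval PowerSeries.X x x := by
  have := hasSum_ite_eq (1 : ℕ) x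
  refine this.congr_fun ?_
  intro m
  rcases eq_or_ne m 1 with rfl | hm <;> simp [PowerSeries.coeff_X, *]

theorem one (x : ℂ) : HasEval 1 x 1 := by simpa using const 1 x

theorem pow (hP : HasEval P x s) (k : ℕ) : HasEval (P ^ k) x (s ^ k) := by
  induction k with
  | zero => simpa using one x
  | succ k ih => simpa only [pow_succ] using ih.mul hP

theorem rescale {ω : ℂ} (hP : HasEval P (ω * x) s) : HasEval (PowerSeries.rescale ω P) x s := by
  unfold HasEval at *
  simp only [PowerSeries.coeff_rescale]
  refine hP.congr_fun ?_
  intro m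
  rw [mul_pow]; ring

theorem expand {k : ℕ} (hk : k ≠ 0) (hP : HasEval P (x ^ k) s) :
    HasEval (PowerSeries.expand k hk P) x s := by
  unfold HasEval at *
  have hi : Function.Injective fun m : ℕ => k * m := fun a b h => Nat.eq_of_mul_eq_mul_left (Nat.pos_of_ne_zero hk) h
  refine (hi.hasSum_iff ?_).1 ?_
  · intro m hm
    rw [PowerSeries.coeff_expand, if_neg, zero_mul]
    rintro ⟨c, rfl⟩
    exact hm ⟨c, rfl⟩
  · refine hP.congr_fun ?_
    intro m
    simp [pow_mul, PowerSeries.coeff_expand_mul]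

end HasEval

/-! ### Expansions in powers of `exp (2πiτ/M)` -/

local notation "𝕢" => Function.Periodic.qParam

/-- The expansion `u = ∑ₘ P_m q_M^(m-r)`, where `q_M = exp (2πiτ/M)`. -/
def LExp (M : ℕ) (u : ℍ → ℂ) (r : ℕ) (P : PowerSeries ℂ) : Prop :=
  ∀ τ : ℍ, HasEval P (𝕢 M τ) (𝕢 M τ ^ r * u τ)

/-- The cusp function has only one Taylor series at 0. All comparisons of coefficients of expansions
rest on this uniqueness. -/
theorem HasEval.eq_zero {M : ℕ} (hM : 0 < M) {P : PowerSeries ℂ}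
    (hP : ∀ τ : ℍ, HasEval P (𝕢 M τ) 0) : P = 0 := by
  have hM' : (0 : ℝ) < M := by exact_mod_cast hM
  have hol : MDiff (0 : ℍ → ℂ) := mdifferentiable_const
  have hbd : IsBoundedAtImInfty (0 : ℍ → ℂ) := Asymptotics.isBigO_zero _ _
  have hper : Function.Periodic ((0 : ℍ → ℂ) ∘ ofComplex) (M : ℝ) := fun w => by simp
  have han := analyticAt_cuspFunction_zero (h := (M : ℝ)) (f := (0 : ℍ → ℂ)) hM' hper hol hbd
  have h1 := (hasFPowerSeriesOnBall_cuspFunction (c := fun m => PowerSeries.coeff m P) hM' han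
    hP).hasFPowerSeriesAt
  have h0 := (hasFPowerSeriesOnBall_cuspFunction (c := fun _ => 0) hM' han
    fun τ => by simp [hasSum_zero]).hasFPowerSeriesAt
  ext m
  simpa using congr_arg (FormalMultilinearSeries.coeff · m) (h1.eq_formalMultilinearSeries h0)

namespace LExp

variable {M : ℕ} {u v : ℍ → ℂ} {r s : ℕ} {P Q : PowerSeries ℂ}

theorem mul (hu : LExp M u r P) (hv : LExp M v s Q) : LExp M (u * v) (r + s) (P * Q) := by
  intro τ
  convert (hu τ).mul (hv τ) using 1
  simp only [Pi.mul_apply]; ring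

theorem shift (hu : LExp M u r P) (s : ℕ) : LExp M u (s + r) (PowerSeries.X ^ s * P) := by
  intro τ
  convert ((HasEval.X _).pow s).mul (hu τ) using 1
  ring

theorem add (hu : LExp M u r P) (hv : LExp M v r Q) : LExp M (u + v) r (P + Q) := by
  intro τ
  convert (hu τ).add (hv τ) using 1
  simp only [Pi.add_apply]; ring

theorem neg (hu : LExp M u r P) : LExp M (-u) r (-P) := by
  intro τ
  convert (hu τ).neg using 1
  simp only [Pi.neg_apply]; ring

theorem sub (hu : LExp M u r P) (hv : LExp M v r Q) : LExp M (u - v) r (P - Q) := by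
  simpa only [sub_eq_add_neg] using hu.add hv.neg

theorem const (M : ℕ) (c : ℂ) : LExp M (fun _ => c) 0 (PowerSeries.C c) := by
  intro τ
  simpa using HasEval.const c _

theorem one (M : ℕ) : LExp M 1 0 1 := by
  intro τ
  simpa using HasEval.one _

theorem smul (c : ℂ) (hu : LExp M u r P) : LExp M (c • u) r (PowerSeries.C c * P) := by
  intro τ
  convert (HasEval.const c _).mul (hu τ) using 1
  simp only [Pi.smul_apply, smul_eq_mul]; ring

theorem pow (hu : LExp M u r P) (k : ℕ) : LExp M (u ^ k) (k * r) (P ^ k) := by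
  intro τ
  convert (hu τ).pow k using 1
  simp only [Pi.pow_apply]; ring

theorem sum {ι : Type*} (t : Finset ι) {u : ι → ℍ → ℂ} {P : ι → PowerSeries ℂ}
    (hu : ∀ i ∈ t, LExp M (u i) r (P i)) : LExp M (∑ i ∈ t, u i) r (∑ i ∈ t, P i) := by
  classical
  induction t using Finset.induction_on with
  | empty => intro τ; simp [HasEval, hasSum_zero]
  | insert i t hi ih =>
    rw [Finset.sum_insert hi, Finset.sum_insert hi]
    exact (hu i (Finset.mem_insert_self i t)).add
      (ih fun j hj => hu j (Finset.mem_insert_of_mem hj))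

theorem unique_of_eq (hM : 0 < M) (hu : LExp M u r P) (hv : LExp M u r Q) : P = Q := by
  rw [← sub_eq_zero]
  refine HasEval.eq_zero hM fun τ => ?_
  simpa [sub_eq_add_neg] using (hu τ).add (hv τ).neg

theorem unique (hM : 0 < M) (hu : LExp M u r P) (hv : LExp M u s Q) :
    PowerSeries.X ^ s * P = PowerSeries.X ^ r * Q :=
  (hu.shift s).unique_of_eq hM (by simpa only [add_comm] using hv.shift r)

theorem eq_zero (hu : LExp M u r 0) : u = 0 := by
  funext τ
  have h := (hu τ).unique (a₂ := 0) (by simp [hasSum_zero])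
  simpa [Function.Periodic.qParam_ne_zero] using h

theorem ne_zero (hM : 0 < M) (hu : LExp M u r P) (hP : P ≠ 0) : u ≠ 0 := by
  rintro rfl
  exact hP (hu.unique_of_eq hM fun τ => by simp [HasEval, hasSum_zero])

end LExp

/-- The affine map `τ ↦ sτ + t` of the upper half plane, for `s > 0`. -/
def aff (s t : ℝ) (τ : ℍ) : ℍ := ofComplex (s * τ + t)

theorem coe_aff {s : ℝ} (hs : 0 < s) (t : ℝ) (τ : ℍ) : (aff s t τ : ℂ) = s * τ + t := by
  rw [aff, ofComplex_apply_of_im_pos]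
  simpa using mul_pos hs τ.im_pos

theorem im_aff {s : ℝ} (hs : 0 < s) (t : ℝ) (τ : ℍ) : (aff s t τ).im = s * τ.im := by
  rw [← coe_im, coe_aff hs]; simp

theorem aff_aff {s s' : ℝ} (hs : 0 < s) (hs' : 0 < s') (t t' : ℝ) (τ : ℍ) :
    aff s t (aff s' t' τ) = aff (s * s') (s * t' + t) τ := by
  ext
  rw [coe_aff hs, coe_aff hs', coe_aff (mul_pos hs hs')]
  push_cast; ring

theorem mdiff_comp_aff {u : ℍ → ℂ} (hu : MDiff u) {s : ℝ} (hs : 0 < s) (t : ℝ) :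
    MDiff (fun τ => u (aff s t τ)) := by
  rw [UpperHalfPlane.mdifferentiable_iff] at hu ⊢
  have h1 : DifferentiableOn ℂ (fun z : ℂ => (s : ℂ) * z + t) {z | 0 < z.im} := by fun_prop
  have h2 : Set.MapsTo (fun z : ℂ => (s : ℂ) * z + t) {z | 0 < z.im} {z | 0 < z.im} := by
    intro z hz
    simpa using mul_pos hs hz
  refine (hu.comp h1 h2).congr fun z hz => ?_
  simp only [Function.comp_apply, aff]
  rw [ofComplex_apply_of_im_pos hz]

theorem tendsto_aff {s : ℝ} (hs : 0 < s) (t : ℝ) : Tendsto (aff s t) atImInfty atImInfty := by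
  rw [atImInfty, tendsto_comap_iff]
  have : UpperHalfPlane.im ∘ aff s t = fun τ => s * τ.im := by
    funext τ; exact im_aff hs t τ
  rw [this]
  exact (tendsto_comap (f := UpperHalfPlane.im)).const_mul_atTop hs

/-- The parameter q_{M₀} at (aτ + b)/d is ω q_M^s. So the m-th coefficient is twisted by ω^m, the
exponents are multiplied by s, and the pole part contributes ω^(-r). -/
theorem LExp.comp_aff {M₀ M : ℕ} {u : ℍ → ℂ} {r : ℕ} {P : PowerSeries ℂ} (hu : LExp M₀ u r P)
    {a d s : ℕ} (ha : 0 < a) (hd : 0 < d) (hs : s ≠ 0) (hM₀ : 0 < M₀) (hM : 0 < M)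
    (h : s * d * M₀ = a * M) (b : ℤ) {ω : ℂ}
    (hω : ω = Complex.exp (2 * Real.pi * Complex.I * (b / (d * M₀)))) :
    LExp M (fun τ => u (aff (a / d) (b / d) τ)) (s * r)
      (PowerSeries.C (ω⁻¹ ^ r) * PowerSeries.expand s hs (PowerSeries.rescale ω P)) := by
  intro τ
  have hsd : (0 : ℝ) < a / d := by positivity
  have hω0 : ω ≠ 0 := hω ▸ Complex.exp_ne_zero _
  have hq : 𝕢 M₀ (aff (a / d) (b / d) τ) = ω * 𝕢 M τ ^ s := by
    rw [coe_aff hsd, hω, Function.Periodic.qParam, Function.Periodic.qParam, ← Complex.exp_nat_mul,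
      ← Complex.exp_add]
    congr 1
    have hdC : (d : ℂ) ≠ 0 := by exact_mod_cast hd.ne'
    have hMC : (M : ℂ) ≠ 0 := by exact_mod_cast hM.ne'
    have hM₀C : (M₀ : ℂ) ≠ 0 := by exact_mod_cast hM₀.ne'
    have hC : (s : ℂ) * d * M₀ = a * M := by exact_mod_cast h
    push_cast
    field_simp
    linear_combination (-(τ : ℂ)) * hC
  have := hu (aff (a / d) (b / d) τ)
  rw [hq] at this
  convert (HasEval.const (ω⁻¹ ^ r) _).mul (this.rescale.expand hs) using 1
  rw [mul_pow, ← pow_mul, inv_pow]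
  field_simp

/-- A holomorphic function of period `M` and at most exponential growth has an expansion. -/
theorem exists_lexp {M : ℕ} (hM : 0 < M) {u : ℍ → ℂ} (hu : MDiff u)
    (hper : ∀ τ, u (aff 1 M τ) = u τ) {C : ℝ}
    (hO : u =O[atImInfty] fun τ : ℍ => Real.exp (C * τ.im)) : ∃ r P, LExp M u r P := by
  have hM' : (0 : ℝ) < M := by exact_mod_cast hM
  -- |q_M^r| = exp(-2πr Im τ / M), so this r makes q_M^r u bounded at i∞.
  obtain ⟨r, hr⟩ := exists_nat_ge (C * M / (2 * Real.pi))
  have hr' : C ≤ 2 * Real.pi * r / M := by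
    rw [div_le_iff₀ (by positivity)] at hr
    rw [le_div_iff₀ hM']; linarith
  set v : ℍ → ℂ := fun τ => 𝕢 M τ ^ r * u τ with hv
  have hq : MDiff (fun τ : ℍ => 𝕢 M τ ^ r) := by
    rw [UpperHalfPlane.mdifferentiable_iff]
    have : DifferentiableOn ℂ (fun z : ℂ => 𝕢 M z ^ r) {z | 0 < z.im} := by fun_prop
    refine this.congr fun z hz => ?_
    simp only [Function.comp_apply]
    rw [ofComplex_apply_of_im_pos hz]
  have hvol : MDiff v := hq.mul hu
  have hvper : Function.Periodic (v ∘ ofComplex) (M : ℝ) := by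
    intro w
    by_cases hw : 0 < w.im
    · have hw' : 0 < (w + (M : ℝ)).im := by simpa using hw
      have h1 := hper ⟨w, hw⟩
      have h2 : aff 1 M ⟨w, hw⟩ = ofComplex (w + (M : ℝ)) := by simp [aff]
      rw [h2] at h1
      simp only [Function.comp_apply, hv, h1, ofComplex_apply_of_im_pos hw]
      rw [ofComplex_apply_of_im_pos hw']
      simp only [Function.Periodic.qParam]
      congr 2
      rw [mul_add, add_div]
      have : 2 * (Real.pi : ℂ) * Complex.I * (M : ℝ) / (M : ℝ) = 2 * Real.pi * Complex.I := by
        have : (((M : ℝ)) : ℂ) ≠ 0 := by exact_mod_cast hM.ne'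
        field_simp
      rw [this, Complex.exp_periodic]
    · have hw' : ¬ 0 < (w + (M : ℝ)).im := by simpa using hw
      simp only [Function.comp_apply]
      rw [ofComplex_apply_of_im_nonpos (not_lt.1 hw), ofComplex_apply_of_im_nonpos (not_lt.1 hw')]
  have hvbd : IsBoundedAtImInfty v := by
    have h1 : (fun τ : ℍ => 𝕢 M τ ^ r) =O[atImInfty] fun τ : ℍ => Real.exp (-C * τ.im) := by
      refine Asymptotics.IsBigO.of_bound 1 (Eventually.of_forall fun τ => ?_)
      rw [norm_pow, Function.Periodic.norm_qParam, one_mul, Real.norm_of_nonneg (Real.exp_nonneg _),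
        ← Real.exp_nat_mul, Real.exp_le_exp]
      have := mul_le_mul_of_nonneg_right hr' τ.im_pos.le
      rw [coe_im]
      have e : (r : ℝ) * (-2 * Real.pi * τ.im / M) = -(2 * Real.pi * r / M * τ.im) := by ring
      rw [e]; linarith
    refine (h1.mul hO).congr_right fun τ => ?_
    rw [← Real.exp_add]; simp
  exact ⟨r, qExpansion M v, fun τ => hasSum_qExpansion hM' hvper hvol hvbd τ⟩

end Moonshine

end


noncomputable section

namespace Moonshine

/-! ### Expansions with coefficients in a subring -/

/-- The power series with coefficients in `A`. -/
def coeffIn (A : Subring ℂ) : Subring (PowerSeries ℂ) := (PowerSeries.map A.subtype).range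

theorem mem_coeffIn {A : Subring ℂ} {P : PowerSeries ℂ} :
    P ∈ coeffIn A ↔ ∀ m, PowerSeries.coeff m P ∈ A := by
  constructor
  · rintro ⟨Q, rfl⟩ m
    simp
  · intro h
    refine ⟨PowerSeries.mk fun m => ⟨_, h m⟩, ?_⟩
    ext m
    simp

theorem map_mem_coeffIn {R : Type*} [CommRing R] (f : R →+* ℂ) {A : Subring ℂ}
    (hf : ∀ x, f x ∈ A) (P : PowerSeries R) : P.map f ∈ coeffIn A :=
  mem_coeffIn.2 fun m => by simpa using hf _

theorem C_mem_coeffIn {A : Subring ℂ} {c : ℂ} (hc : c ∈ A) : PowerSeries.C c ∈ coeffIn A :=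
  mem_coeffIn.2 fun m => by
    rw [PowerSeries.coeff_C]; split_ifs
    exacts [hc, A.zero_mem]

theorem X_mem_coeffIn {A : Subring ℂ} : (PowerSeries.X : PowerSeries ℂ) ∈ coeffIn A :=
  mem_coeffIn.2 fun m => by
    rw [PowerSeries.coeff_X]; split_ifs
    exacts [A.one_mem, A.zero_mem]

theorem X_pow_mul_mem_coeffIn {A : Subring ℂ} {s : ℕ} {P : PowerSeries ℂ} :
    PowerSeries.X ^ s * P ∈ coeffIn A ↔ P ∈ coeffIn A := by
  refine ⟨fun h => mem_coeffIn.2 fun m => ?_, fun h => mul_mem (pow_mem X_mem_coeffIn s) h⟩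
  have := mem_coeffIn.1 h (m + s)
  rwa [PowerSeries.coeff_X_pow_mul] at this

theorem rescale_mem_coeffIn {A : Subring ℂ} {ω : ℂ} (hω : ω ∈ A) {P : PowerSeries ℂ}
    (hP : P ∈ coeffIn A) : PowerSeries.rescale ω P ∈ coeffIn A :=
  mem_coeffIn.2 fun m => by
    rw [PowerSeries.coeff_rescale]
    exact mul_mem (pow_mem hω m) (mem_coeffIn.1 hP m)

theorem expand_mem_coeffIn {A : Subring ℂ} {k : ℕ} (hk : k ≠ 0) {P : PowerSeries ℂ}
    (hP : P ∈ coeffIn A) : PowerSeries.expand k hk P ∈ coeffIn A :=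
  mem_coeffIn.2 fun m => by
    rw [PowerSeries.coeff_expand]; split_ifs
    exacts [mem_coeffIn.1 hP _, A.zero_mem]

/-- Division by a power series whose constant coefficient is invertible in `A`. -/
theorem mem_coeffIn_of_mul_mem {A : Subring ℂ} {P Q : PowerSeries ℂ} (hP : P ∈ coeffIn A)
    (h0 : PowerSeries.constantCoeff P ≠ 0) (h0' : (PowerSeries.constantCoeff P)⁻¹ ∈ A)
    (h : P * Q ∈ coeffIn A) : Q ∈ coeffIn A := by
  obtain ⟨P₀, rfl⟩ := hP
  have hc : PowerSeries.constantCoeff (P₀.map A.subtype) =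
      ((PowerSeries.constantCoeff P₀ : A) : ℂ) := by
    rw [← PowerSeries.coeff_zero_eq_constantCoeff_apply,
      ← PowerSeries.coeff_zero_eq_constantCoeff_apply, PowerSeries.coeff_map]
    rfl
  rw [hc] at h0 h0'
  have hu : IsUnit (PowerSeries.constantCoeff P₀) :=
    IsUnit.of_mul_eq_one ⟨_, h0'⟩ (Subtype.ext (by simpa using mul_inv_cancel₀ h0))
  obtain ⟨V, hV⟩ := (PowerSeries.isUnit_iff_constantCoeff.2 hu).exists_left_inv
  have : V.map A.subtype * (P₀.map A.subtype * Q) = Q := by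
    rw [← mul_assoc, ← map_mul, hV, map_one, one_mul]
  rw [← this]
  exact mul_mem ⟨V, rfl⟩ h

/-- The functions with an expansion in `q_M` with coefficients in `A`. -/
def lring (M : ℕ) (A : Subring ℂ) : Subring (ℍ → ℂ) where
  carrier := {u | ∃ r, ∃ P ∈ coeffIn A, LExp M u r P}
  mul_mem' := by
    rintro u v ⟨r, P, hP, hu⟩ ⟨s, Q, hQ, hv⟩
    exact ⟨_, _, mul_mem hP hQ, hu.mul hv⟩
  one_mem' := ⟨0, 1, one_mem _, LExp.one M⟩
  add_mem' := by
    rintro u v ⟨r, P, hP, hu⟩ ⟨s, Q, hQ, hv⟩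
    exact ⟨_, _, add_mem (X_pow_mul_mem_coeffIn.2 hP) (X_pow_mul_mem_coeffIn.2 hQ),
      (hu.shift s).add (by simpa only [add_comm] using hv.shift r)⟩
  zero_mem' := ⟨0, 0, zero_mem _, fun τ => by simp [HasEval, hasSum_zero]⟩
  neg_mem' := by
    rintro u ⟨r, P, hP, hu⟩
    exact ⟨r, -P, neg_mem hP, hu.neg⟩

theorem LExp.mem_lring {M : ℕ} {A : Subring ℂ} {u : ℍ → ℂ} {r : ℕ} {P : PowerSeries ℂ}
    (hu : LExp M u r P) (hP : P ∈ coeffIn A) : u ∈ lring M A := ⟨r, P, hP, hu⟩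

theorem LExp.mem_lring_top {M : ℕ} {u : ℍ → ℂ} {r : ℕ} {P : PowerSeries ℂ}
    (hu : LExp M u r P) : u ∈ lring M ⊤ := ⟨r, P, mem_coeffIn.2 fun _ => trivial, hu⟩

theorem smul_mem_lring {M : ℕ} {A : Subring ℂ} {u : ℍ → ℂ} {c : ℂ} (hc : c ∈ A)
    (hu : u ∈ lring M A) : c • u ∈ lring M A := by
  obtain ⟨r, P, hP, hu⟩ := hu
  exact ⟨r, _, mul_mem (C_mem_coeffIn hc) hP, hu.smul c⟩

theorem LExp.mem_coeffIn {M : ℕ} (hM : 0 < M) {A : Subring ℂ} {u : ℍ → ℂ} {r : ℕ}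
    {P : PowerSeries ℂ} (hu : LExp M u r P) (h : u ∈ lring M A) : P ∈ coeffIn A := by
  obtain ⟨s, Q, hQ, hv⟩ := h
  rw [← X_pow_mul_mem_coeffIn (s := s), hu.unique hM hv]
  exact X_pow_mul_mem_coeffIn.2 hQ

theorem LExp.of_le {M : ℕ} {A : Subring ℂ} {u : ℍ → ℂ} {r s : ℕ} {P : PowerSeries ℂ}
    (hu : LExp M u r P) (hP : P ∈ coeffIn A) (h : r ≤ s) : ∃ Q ∈ coeffIn A, LExp M u s Q := by
  obtain ⟨t, rfl⟩ := Nat.exists_eq_add_of_le' h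
  exact ⟨_, X_pow_mul_mem_coeffIn.2 hP, hu.shift t⟩

theorem LExp.eq_of_eq {M : ℕ} {u v : ℍ → ℂ} {r : ℕ} {P : PowerSeries ℂ}
    (hu : LExp M u r P) (hv : LExp M v r P) : u = v := by
  rw [← sub_eq_zero]
  exact LExp.eq_zero (r := r) (M := M) (by simpa using hu.sub hv)

theorem exists_common_lexp {M : ℕ} {A : Subring ℂ} {ι : Type*} (t : Finset ι) {u : ι → ℍ → ℂ}
    (hu : ∀ i ∈ t, u i ∈ lring M A) : ∃ r, ∃ P : ι → PowerSeries ℂ,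
      ∀ i ∈ t, P i ∈ coeffIn A ∧ LExp M (u i) r (P i) := by
  have : ∀ i : ι, ∃ r, i ∈ t → ∃ P ∈ coeffIn A, LExp M (u i) r P := by
    intro i
    by_cases hi : i ∈ t
    · obtain ⟨r, P, hP, h⟩ := hu i hi
      exact ⟨r, fun _ => ⟨P, hP, h⟩⟩
    · exact ⟨0, fun h => absurd h hi⟩
  choose r hr using this
  have : ∀ i : ι, ∃ P, i ∈ t → P ∈ coeffIn A ∧ LExp M (u i) (t.sup r) P := by
    intro i
    by_cases hi : i ∈ t
    · obtain ⟨P, hP, h⟩ := hr i hi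
      obtain ⟨Q, hQ, h'⟩ := h.of_le hP (Finset.le_sup (f := r) hi)
      exact ⟨Q, fun _ => ⟨hQ, h'⟩⟩
    · exact ⟨0, fun h => absurd h hi⟩
  choose P hP using this
  exact ⟨_, P, hP⟩

/-- The rational numbers in `ℂ`. -/
def ratRing : Subring ℂ := (algebraMap ℚ ℂ).range

theorem ratCast_mem_ratRing (x : ℚ) : (x : ℂ) ∈ ratRing := ⟨x, by simp⟩

/-- ℚ is a direct summand of the ℚ-vector space ℂ. Applying π to the coefficients of a complex
linear relation makes them rational, with no information needed on the field they generate. -/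
theorem exists_rat_projection : ∃ π : ℂ →ₗ[ℚ] ℚ, ∀ x : ℚ, π x = x := by
  obtain ⟨π, hπ⟩ := LinearMap.exists_leftInverse_of_injective (Algebra.linearMap ℚ ℂ)
    (LinearMap.ker_eq_bot.2 (algebraMap ℚ ℂ).injective)
  exact ⟨π, fun x => by simpa using LinearMap.congr_fun hπ x⟩

/-- A `ℂ`-linear relation with rational result between functions with rational expansions can be
replaced by a `ℚ`-linear one. -/
theorem sum_smul_eq_of_rat {M : ℕ} (hM : 0 < M) {π : ℂ →ₗ[ℚ] ℚ} (hπ : ∀ x : ℚ, π x = x)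
    {ι : Type*} (t : Finset ι) {u : ι → ℍ → ℂ} (hu : ∀ i ∈ t, u i ∈ lring M ratRing) (c : ι → ℂ)
    (h : ∑ i ∈ t, c i • u i ∈ lring M ratRing) :
    ∑ i ∈ t, c i • u i = ∑ i ∈ t, ((π (c i) : ℚ) : ℂ) • u i := by
  obtain ⟨r, P, hP⟩ := exists_common_lexp t hu
  have h₁ := LExp.sum t fun i hi => (hP i hi).2.smul (c i)
  have h₂ := LExp.sum t fun i hi => (hP i hi).2.smul ((π (c i) : ℚ) : ℂ)
  refine h₁.eq_of_eq (r := r) (M := M) (P := _) ?_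
  convert h₂ using 1
  ext m
  -- The m-th coefficient of the sum is rational, hence fixed by π, and π commutes with
  -- multiplication by the rational coefficients of the P i.
  have hm := mem_coeffIn.1 (h₁.mem_coeffIn hM h) m
  obtain ⟨x, hx⟩ := hm
  simp only [map_sum, PowerSeries.coeff_C_mul] at hx ⊢
  have key : ∀ i ∈ t, ∃ y : ℚ, (y : ℂ) = PowerSeries.coeff m (P i) := fun i hi => by
    obtain ⟨y, hy⟩ := mem_coeffIn.1 (hP i hi).1 m
    exact ⟨y, by simpa using hy⟩
  choose! y hy using key
  have e : ∀ z : ℂ, ∀ q : ℚ, π (z * q) = π z * q := fun z q => by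
    have : z * (q : ℂ) = q • z := by rw [Rat.smul_def, mul_comm]
    rw [this, map_smul, smul_eq_mul, mul_comm]
  have hx' := congrArg π hx
  rw [map_sum, show algebraMap ℚ ℂ x = (x : ℂ) by simp, hπ] at hx'
  rw [← hx, hx', show ∀ z : ℚ, algebraMap ℚ ℂ z = (z : ℂ) by simp, Rat.cast_sum]
  refine Finset.sum_congr rfl fun i hi => ?_
  rw [← hy i hi, e, Rat.cast_mul]

/-- After removal of its leading power of q, the expansion of u starts with a nonzero rational
number and is therefore a unit over ℚ. -/
theorem mem_lring_rat_of_mul_mem {M : ℕ} (hM : 0 < M) {u v : ℍ → ℂ} (hu0 : u ≠ 0)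
    (hu : u ∈ lring M ratRing) (hv : v ∈ lring M ⊤) (h : u * v ∈ lring M ratRing) :
    v ∈ lring M ratRing := by
  obtain ⟨r, P, hP, hu⟩ := hu
  obtain ⟨s, Q, -, hv⟩ := hv
  have hP0 : P ≠ 0 := by
    rintro rfl
    exact hu0 hu.eq_zero
  refine hv.mem_lring ?_
  have hPQ := (hu.mul hv).mem_coeffIn hM h
  have hX := PowerSeries.X_pow_order_mul_divXPowOrder (f := P)
  rw [← hX, mul_assoc, X_pow_mul_mem_coeffIn] at hPQ
  rw [← hX, X_pow_mul_mem_coeffIn] at hP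
  have hc : PowerSeries.constantCoeff P.divXPowOrder ≠ 0 := by
    rwa [Ne, PowerSeries.constantCoeff_divXPowOrder_eq_zero_iff]
  refine mem_coeffIn_of_mul_mem hP hc ?_ hPQ
  have := mem_coeffIn.1 hP 0
  rw [PowerSeries.coeff_zero_eq_constantCoeff_apply] at this
  obtain ⟨x, hx⟩ := this
  exact ⟨x⁻¹, by rw [map_inv₀, hx]⟩

/-! ### `p`-integral algebraic numbers -/

/-- The complex numbers that become algebraic integers after multiplication by an integer prime
to `p`. -/
def pint (p : ℕ) [hp : Fact p.Prime] : Subring ℂ where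
  carrier := {z | ∃ m : ℕ, ¬ p ∣ m ∧ IsIntegral ℤ ((m : ℂ) * z)}
  mul_mem' := by
    rintro x y ⟨m, hm, hx⟩ ⟨k, hk, hy⟩
    refine ⟨m * k, hp.out.not_dvd_mul hm hk, ?_⟩
    have := hx.mul hy
    rw [show ((m * k : ℕ) : ℂ) * (x * y) = m * x * (k * y) by push_cast; ring]
    exact this
  one_mem' := ⟨1, hp.out.not_dvd_one, by simpa using isIntegral_one⟩
  add_mem' := by
    rintro x y ⟨m, hm, hx⟩ ⟨k, hk, hy⟩
    refine ⟨m * k, hp.out.not_dvd_mul hm hk, ?_⟩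
    have hmZ : IsIntegral ℤ ((m : ℂ)) := isIntegral_natCast _
    have hkZ : IsIntegral ℤ ((k : ℂ)) := isIntegral_natCast _
    have := (hkZ.mul hx).add (hmZ.mul hy)
    rw [show ((m * k : ℕ) : ℂ) * (x + y) = k * (m * x) + m * (k * y) by push_cast; ring]
    exact this
  zero_mem' := ⟨1, hp.out.not_dvd_one, by simpa using isIntegral_zero⟩
  neg_mem' := by
    rintro x ⟨m, hm, hx⟩
    exact ⟨m, hm, by simpa using hx.neg⟩

variable {p : ℕ} [hp : Fact p.Prime]

theorem mem_pint_of_isIntegral {z : ℂ} (hz : IsIntegral ℤ z) : z ∈ pint p :=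
  ⟨1, hp.out.not_dvd_one, by simpa using hz⟩

theorem inv_natCast_mem_pint {m : ℕ} (hm : ¬ p ∣ m) : ((m : ℂ))⁻¹ ∈ pint p := by
  have : (m : ℂ) ≠ 0 := by
    rintro h
    exact hm (by simp [Nat.cast_eq_zero.1 h])
  exact ⟨m, hm, by simpa [this] using isIntegral_one⟩

theorem exists_pow_mul_ratCast_mem_pint (x : ℚ) : ∃ s : ℕ, (p : ℂ) ^ s * x ∈ pint p := by
  obtain ⟨s, m, hm, h⟩ := Nat.exists_eq_pow_mul_and_not_dvd x.den_nz p hp.out.ne_one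
  refine ⟨s, ?_⟩
  have h0 : (p : ℂ) ≠ 0 := by exact_mod_cast hp.out.ne_zero
  have hm0 : (m : ℂ) ≠ 0 := by
    rintro h
    exact hm (by simp [Nat.cast_eq_zero.1 h])
  have : (p : ℂ) ^ s * x = (x.num : ℂ) * (m : ℂ)⁻¹ := by
    conv_lhs => rw [← Rat.num_div_den x, h]
    push_cast
    field_simp
  rw [this]
  exact mul_mem (mem_pint_of_isIntegral (isIntegral_intCast _)) (inv_natCast_mem_pint hm)

/-- For a suitable m prime to p, the rational number mx is an algebraic integer, hence an integer,
and m is a p-adic unit. -/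
theorem norm_ratCast_le_one_of_mem_pint {x : ℚ} (hx : (x : ℂ) ∈ pint p) :
    ‖(x : ℚ_[p])‖ ≤ 1 := by
  obtain ⟨m, hm, h⟩ := hx
  have h' : IsIntegral ℤ (algebraMap ℚ ℂ ((m : ℚ) * x)) := by simpa using h
  rw [isIntegral_algebraMap_iff (algebraMap ℚ ℂ).injective] at h'
  obtain ⟨k, hk⟩ := IsIntegrallyClosed.isIntegral_iff.1 h'
  have h1 : ‖(m : ℚ_[p])‖ = 1 := by
    have := Padic.norm_int_le_one (p := p) (m : ℤ)
    have h2 := (Padic.norm_intCast_lt_one_iff (p := p) (k := (m : ℤ))).not.2 (by exact_mod_cast hm)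
    push_cast at this h2
    exact le_antisymm this (not_lt.1 h2)
  have h2 : (m : ℚ_[p]) * x = (k : ℚ_[p]) := by
    have : (m : ℚ) * x = (k : ℚ) := by simpa using hk.symm
    exact_mod_cast congrArg (Rat.cast : ℚ → ℚ_[p]) this
  have h3 : ‖(x : ℚ_[p])‖ = ‖(k : ℚ_[p])‖ := by
    rw [← h2, norm_mul, h1, one_mul]
  rw [h3]
  exact Padic.norm_int_le_one k

/-- If `ζ ≠ 1` is a `d`-th root of unity then `1 - ζ` divides `d` in the algebraic integers. -/
theorem exists_mul_one_sub_eq {ζ : ℂ} {d : ℕ} (hζ : ζ ^ d = 1) (h1 : ζ ≠ 1) :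
    ∃ y : ℂ, IsIntegral ℤ y ∧ (1 - ζ) * y = d := by
  rcases Nat.eq_zero_or_pos d with rfl | hd
  · exact ⟨0, isIntegral_zero, by simp⟩
  have hint : IsIntegral ℤ ζ := IsIntegral.of_pow hd (by rw [hζ]; exact isIntegral_one)
  have hgeom : ∑ i ∈ Finset.range d, ζ ^ i = 0 := by
    have := mul_neg_geom_sum ζ d
    rw [hζ, sub_self, mul_eq_zero, sub_eq_zero] at this
    exact this.resolve_left h1.symm
  -- As the d powers of ζ sum to 0, the numbers 1 - ζ^i sum to d, and each is 1 - ζ times a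
  -- geometric sum.
  refine ⟨∑ i ∈ Finset.range d, ∑ k ∈ Finset.range i, ζ ^ k,
    IsIntegral.sum _ fun i _ => IsIntegral.sum _ fun k _ => hint.pow k, ?_⟩
  rw [Finset.mul_sum]
  simp only [mul_neg_geom_sum, Finset.sum_sub_distrib, hgeom]
  simp

/-- Multiplication by `u` can be cancelled in the functions whose expansions have bounded
denominators at `p`. -/
structure Good (p : ℕ) [Fact p.Prime] (M : ℕ) (u : ℍ → ℂ) : Prop where
  mem : u ∈ lring M ⊤
  cancel : ∀ v ∈ lring M ⊤, (∃ s : ℕ, (p : ℂ) ^ s • (u * v) ∈ lring M (pint p)) →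
    ∃ s : ℕ, (p : ℂ) ^ s • v ∈ lring M (pint p)

theorem Good.one (M : ℕ) : Good p M 1 :=
  ⟨one_mem _, fun v _ h => by simpa using h⟩

theorem Good.mul {M : ℕ} {u v : ℍ → ℂ} (hu : Good p M u) (hv : Good p M v) : Good p M (u * v) :=
  ⟨mul_mem hu.mem hv.mem, fun w hw h =>
    hv.cancel w hw (hu.cancel _ (mul_mem hv.mem hw) (by simpa only [mul_assoc] using h))⟩

theorem Good.prod {M : ℕ} {ι : Type*} (t : Finset ι) {u : ι → ℍ → ℂ}
    (hu : ∀ i ∈ t, Good p M (u i)) : Good p M (∏ i ∈ t, u i) :=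
  Finset.prod_induction _ (Good p M) (fun _ _ => Good.mul) (Good.one M) hu

/-- P is a unit over the p-integral numbers and z divides p^k there, so dividing by u costs at most
a factor p^k. -/
theorem LExp.good {M : ℕ} (hM : 0 < M) {u : ℍ → ℂ} {r : ℕ} {z y : ℂ} {P : PowerSeries ℂ}
    (hu : LExp M u r (PowerSeries.C z * P)) (hP : P ∈ coeffIn (pint p))
    (h0 : PowerSeries.constantCoeff P ≠ 0) (h0' : (PowerSeries.constantCoeff P)⁻¹ ∈ pint p)
    {k : ℕ} (hy : y ∈ pint p) (hyz : y * z = (p : ℂ) ^ k) : Good p M u := by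
  refine ⟨hu.mem_lring_top, ?_⟩
  rintro v ⟨r', Q, -, hv⟩ ⟨s, h⟩
  refine ⟨s + k, (hv.smul _).mem_lring ?_⟩
  have h1 := ((hu.mul hv).smul ((p : ℂ) ^ s)).mem_coeffIn hM h
  refine mem_coeffIn_of_mul_mem hP h0 h0' ?_
  have h2 := mul_mem (C_mem_coeffIn hy) h1
  convert h2 using 1
  rw [pow_add, ← hyz]
  simp only [map_mul]
  ring

end Moonshine

end


/-! ### Level one: integrality of Δ and j, Hermite forms, functions meromorphic at all cusps. -/

noncomputable section

namespace Moonshine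

/-! ### Level one -/

local notation "𝕢" => Function.Periodic.qParam

local notation "Δ" => ModularForm.discriminant

local notation "ℤtoℂ" => PowerSeries.map (Int.castRingHom ℂ)

theorem lexp_levelOne {k : ℤ} (f : ModularForm 𝒮ℒ k) : LExp 1 f 0 (qExpansion 1 f) := by
  intro τ
  have := ModularForm.hasSum_qExpansion f one_pos one_mem_strictPeriods_SL τ
  simpa [HasEval] using this

theorem LExp.of_X_mul {M : ℕ} {u : ℍ → ℂ} {r : ℕ} {P : PowerSeries ℂ}
    (h : LExp M u (r + 1) (PowerSeries.X * P)) : LExp M u r P := by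
  intro τ
  have h1 := h τ
  unfold HasEval at h1 ⊢
  rw [← hasSum_nat_add_iff' 1] at h1
  have hq := Function.Periodic.qParam_ne_zero (h := (M : ℝ)) τ
  have h2 := h1.mul_left (𝕢 M τ)⁻¹
  refine (HasSum.congr_fun (f := fun i => (𝕢 M τ)⁻¹ * (PowerSeries.coeff (i + 1)
    (PowerSeries.X * P) * 𝕢 M τ ^ (i + 1))) ?_ fun m => ?_)
  rotate_left
  · rw [mul_comm PowerSeries.X, PowerSeries.coeff_succ_mul_X]
    field_simp
    ring
  · have e : 𝕢 M τ ^ r * u τ = (𝕢 M τ)⁻¹ * (𝕢 M τ ^ (r + 1) * u τ - ∑ i ∈ Finset.range 1,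
        PowerSeries.coeff i (PowerSeries.X * P) * 𝕢 M τ ^ i) := by
      rw [Finset.range_one, Finset.sum_singleton, PowerSeries.coeff_zero_X_mul, zero_mul, sub_zero]
      field_simp
      ring
    rw [e]
    exact h2

theorem LExp.of_X_pow_mul {M : ℕ} {u : ℍ → ℂ} {r s : ℕ} {P : PowerSeries ℂ}
    (h : LExp M u (r + s) (PowerSeries.X ^ s * P)) : LExp M u r P := by
  induction s with
  | zero => simpa using h
  | succ s ih =>
    refine ih (LExp.of_X_mul ?_)
    rwa [pow_succ', mul_assoc, ← add_assoc] at h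

theorem LExp.isBigO {M : ℕ} (hM : 0 < M) {u : ℍ → ℂ} {r : ℕ} {P : PowerSeries ℂ}
    (h : LExp M u r P) :
    u =O[atImInfty] fun τ : ℍ => Real.exp (2 * Real.pi * r / M * τ.im) := by
  have hM' : (0 : ℝ) < M := by exact_mod_cast hM
  have hb : (fun τ : ℍ => 𝕢 M τ ^ r * u τ) =O[atImInfty] (1 : ℍ → ℝ) :=
    isBoundedAtImInfty_of_hasSum_qExpansion (c := fun m => PowerSeries.coeff m P) hM' h
  have hq : (fun τ : ℍ => (𝕢 M τ ^ r)⁻¹) =O[atImInfty]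
      fun τ : ℍ => Real.exp (2 * Real.pi * r / M * τ.im) := by
    refine Asymptotics.IsBigO.of_bound 1 (Eventually.of_forall fun τ => ?_)
    rw [norm_inv, norm_pow, Function.Periodic.norm_qParam, one_mul,
      Real.norm_of_nonneg (Real.exp_nonneg _), ← Real.exp_nat_mul, ← Real.exp_neg, Real.exp_le_exp,
      coe_im]
    exact le_of_eq (by ring)
  refine (hq.mul hb).congr (fun τ => ?_) fun τ => by simp
  have := Function.Periodic.qParam_ne_zero (h := (M : ℝ)) τ
  field_simp

open EisensteinSeries ArithmeticFunction in
theorem exists_qExpansion_E₄ : ∃ A : PowerSeries ℤ,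
    (∀ m, PowerSeries.coeff m A = if m = 0 then 0 else (sigma 3 m : ℤ)) ∧
    qExpansion 1 ModularForm.E₄ = ℤtoℂ (1 + 240 * A) := by
  refine ⟨PowerSeries.mk fun m => if m = 0 then 0 else (sigma 3 m : ℤ),
    fun m => PowerSeries.coeff_mk _ _, ?_⟩
  ext m
  rw [E_qExpansion_coeff _ ⟨2, rfl⟩, show bernoulli 4 = -1 / 30 by decide +kernel]
  rw [PowerSeries.coeff_map, map_add, show (240 : PowerSeries ℤ) = PowerSeries.C 240 by simp,
    PowerSeries.coeff_C_mul, PowerSeries.coeff_mk, PowerSeries.coeff_one]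
  split_ifs <;> norm_num

open EisensteinSeries ArithmeticFunction in
theorem exists_qExpansion_E₆ : ∃ B : PowerSeries ℤ,
    (∀ m, PowerSeries.coeff m B = if m = 0 then 0 else (sigma 5 m : ℤ)) ∧
    qExpansion 1 ModularForm.E₆ = ℤtoℂ (1 - 504 * B) := by
  refine ⟨PowerSeries.mk fun m => if m = 0 then 0 else (sigma 5 m : ℤ),
    fun m => PowerSeries.coeff_mk _ _, ?_⟩
  ext m
  rw [E_qExpansion_coeff _ ⟨3, rfl⟩, show bernoulli 6 = 1 / 42 by decide +kernel]
  rw [PowerSeries.coeff_map, map_sub, show (504 : PowerSeries ℤ) = PowerSeries.C 504 by simp,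
    PowerSeries.coeff_C_mul, PowerSeries.coeff_mk, PowerSeries.coeff_one]
  split_ifs <;> norm_num

/-- d³ ≡ d⁵ modulo 12, so 5d³ + 7d⁵ ≡ 12d³. In E₄³ - E₆² the linear terms are 144(5A + 7B); this
supplies the factor 12 that is missing for divisibility by 1728. -/
theorem twelve_dvd_sigma (m : ℕ) :
    (12 : ℤ) ∣ 5 * (ArithmeticFunction.sigma 3 m : ℤ) + 7 * (ArithmeticFunction.sigma 5 m : ℤ) := by
  rw [ArithmeticFunction.sigma_apply, ArithmeticFunction.sigma_apply]
  push_cast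
  rw [Finset.mul_sum, Finset.mul_sum, ← Finset.sum_add_distrib]
  refine Finset.dvd_sum fun d _ => ?_
  refine (ZMod.intCast_zmod_eq_zero_iff_dvd _ 12).1 ?_
  push_cast
  generalize ((d : ZMod 12)) = x
  revert x
  decide

/-- `Δ = q D(q)` with `D ∈ 1 + qℤ⟦q⟧`. -/
theorem exists_lexp_discriminant : ∃ D : PowerSeries ℤ, PowerSeries.constantCoeff D = 1 ∧
    LExp 1 Δ 0 (PowerSeries.X * ℤtoℂ D) := by
  obtain ⟨A, hA, hE4⟩ := exists_qExpansion_E₄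
  obtain ⟨B, hB, hE6⟩ := exists_qExpansion_E₆
  have h12 : ∃ C : PowerSeries ℤ, 5 * A + 7 * B = 12 * C := by
    choose c hc using twelve_dvd_sigma
    refine ⟨PowerSeries.mk fun m => if m = 0 then 0 else c m, ?_⟩
    ext m
    rw [map_add, show (5 : PowerSeries ℤ) = PowerSeries.C 5 by simp,
      show (7 : PowerSeries ℤ) = PowerSeries.C 7 by simp,
      show (12 : PowerSeries ℤ) = PowerSeries.C 12 by simp, PowerSeries.coeff_C_mul,
      PowerSeries.coeff_C_mul, PowerSeries.coeff_C_mul, PowerSeries.coeff_mk, hA, hB]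
    split_ifs
    · simp
    · exact hc m
  obtain ⟨C, hC⟩ := h12
  have hΔ : LExp 1 Δ 0 (ℤtoℂ (C + 100 * A ^ 2 + 8000 * A ^ 3 - 147 * B ^ 2)) := by
    have h4 := lexp_levelOne ModularForm.E₄
    have h6 := lexp_levelOne ModularForm.E₆
    have h := ((h4.pow 3).sub (h6.pow 2)).smul (1728 : ℂ)⁻¹
    rw [hE4, hE6] at h
    convert h using 1
    · funext τ
      rw [ModularForm.discriminant_eq_E₄_cube_sub_E₆_sq]
      simp [div_eq_inv_mul]
    · have e : (1 + 240 * A) ^ 3 - (1 - 504 * B) ^ 2 =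
          1728 * (C + 100 * A ^ 2 + 8000 * A ^ 3 - 147 * B ^ 2) := by
        linear_combination 144 * hC
      have e2 : (ℤtoℂ (1728 : PowerSeries ℤ)) = PowerSeries.C (1728 : ℂ) := by
        rw [show (1728 : PowerSeries ℤ) = PowerSeries.C 1728 by simp, PowerSeries.map_C]
        simp
      rw [← map_pow, ← map_pow, ← map_sub, e, map_mul (ℤtoℂ), e2, ← mul_assoc, ← map_mul,
        inv_mul_cancel₀ (by norm_num), map_one, one_mul]
  generalize C + 100 * A ^ 2 + 8000 * A ^ 3 - 147 * B ^ 2 = D' at hΔ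
  have hq : ℤtoℂ D' = qExpansion 1 Δ :=
    hΔ.unique_of_eq one_pos (lexp_levelOne (CuspForm.discriminant : ModularForm 𝒮ℒ 12))
  have h0 : PowerSeries.constantCoeff D' = 0 := by
    have := CuspFormClass.qExpansion_coeff_zero CuspForm.discriminant one_pos
      one_mem_strictPeriods_SL
    rw [CuspForm.coe_discriminant, ← hq, PowerSeries.coeff_map] at this
    simpa using this
  obtain ⟨D, rfl⟩ := PowerSeries.X_dvd_iff.2 h0
  have h1 : PowerSeries.constantCoeff D = 1 := by
    have := ModularForm.discriminant_qExpansion_coeff_one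
    rw [← hq, PowerSeries.coeff_map, mul_comm, PowerSeries.coeff_succ_mul_X] at this
    simpa using this
  exact ⟨D, h1, by simpa using hΔ⟩

/-- The `j`-invariant. -/
def jfun (τ : ℍ) : ℂ := ModularForm.E₄ τ ^ 3 / Δ τ

theorem mdiff_discriminant : MDiff Δ := CuspForm.discriminant.holo'

theorem mdiff_jfun : MDiff jfun :=
  (ModularForm.E₄.holo'.pow 3).div mdiff_discriminant ModularForm.discriminant_ne_zero

theorem discriminant_slash (γ : SL(2, ℤ)) : Δ ∣[(12 : ℤ)] γ = Δ :=
  SlashInvariantForm.slash_action_generators_SL2Z ModularForm.discriminant_S_invariant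
    ModularForm.discriminant_T_invariant γ

theorem discriminant_smul (γ : SL(2, ℤ)) (τ : ℍ) :
    Δ (γ • τ) = denom γ τ ^ 12 * Δ τ := by
  have := congrFun (discriminant_slash γ) τ
  rw [ModularForm.SL_slash_apply] at this
  have h0 := denom_ne_zero γ τ
  rw [← this]
  field_simp

theorem jfun_smul (γ : SL(2, ℤ)) (τ : ℍ) : jfun (γ • τ) = jfun τ := by
  have h4 : ModularForm.E₄ (γ • τ) = denom γ τ ^ 4 * ModularForm.E₄ τ := by
    have hγ : (γ : GL (Fin 2) ℝ) ∈ 𝒮ℒ := ⟨γ, rfl⟩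
    have := congrFun (SlashInvariantFormClass.slash_action_eq ModularForm.E₄ _ hγ) τ
    rw [← ModularForm.SL_slash, ModularForm.SL_slash_apply] at this
    have h0 := denom_ne_zero γ τ
    rw [← this]
    field_simp
  have h0 := denom_ne_zero γ τ
  have hD := ModularForm.discriminant_ne_zero τ
  rw [jfun, jfun, h4, discriminant_smul]
  field_simp

/-- Division of expansions. -/
theorem LExp.of_mul {M : ℕ} (hM : 0 < M) {u w : ℍ → ℂ} (hu : ∃ r P, LExp M u r P) {a b c : ℕ}
    {W V Q : PowerSeries ℂ} (hw : LExp M w a (PowerSeries.X ^ b * W)) (hWV : W * V = 1)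
    (h : LExp M (w * u) c Q) : LExp M u (b + c) (PowerSeries.X ^ a * V * Q) := by
  obtain ⟨r, P, hu⟩ := hu
  have h1 := (hw.mul hu).unique hM h
  have h2 : PowerSeries.X ^ (b + c) * P = PowerSeries.X ^ r * (PowerSeries.X ^ a * V * Q) := by
    linear_combination V * h1 - PowerSeries.X ^ (b + c) * P * hWV
  have h3 := hu.shift (b + c)
  rw [h2] at h3
  exact h3.of_X_pow_mul

theorem T_smul_eq_aff (k : ℤ) (τ : ℍ) : (ModularGroup.T ^ k : SL(2, ℤ)) • τ = aff 1 k τ := by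
  ext
  rw [modular_T_zpow_smul, coe_aff one_pos]
  simp [add_comm]

theorem inv_discriminant_isBigO : (fun τ => (Δ τ)⁻¹) =O[atImInfty]
    fun τ : ℍ => Real.exp (2 * Real.pi * τ.im) := by
  have := ModularForm.exp_isBigO_discriminant.inv_rev
    (Eventually.of_forall fun τ h => absurd h (Real.exp_ne_zero _))
  refine this.congr_right fun τ => ?_
  rw [← Real.exp_neg]; congr 1; ring

/-- jΔ = E₄³, and Δ is q times a unit of ℤ⟦q⟧. -/
theorem exists_lexp_jfun : ∃ J : PowerSeries ℤ, PowerSeries.constantCoeff J = 1 ∧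
    LExp 1 jfun 1 (ℤtoℂ J) := by
  obtain ⟨D, hD, hΔ⟩ := exists_lexp_discriminant
  obtain ⟨A, hA, hE4⟩ := exists_qExpansion_E₄
  have h4 := lexp_levelOne ModularForm.E₄
  have h4' := h4.pow 3
  rw [hE4] at h4'
  obtain ⟨V, hV⟩ := (PowerSeries.isUnit_iff_constantCoeff.2
    (show IsUnit (PowerSeries.constantCoeff D) by simp [hD])).exists_right_inv
  have hV0 : PowerSeries.constantCoeff V = 1 := by
    have := congrArg PowerSeries.constantCoeff hV
    simpa [hD] using this
  have hA0 : PowerSeries.constantCoeff A = 0 := by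
    rw [← PowerSeries.coeff_zero_eq_constantCoeff_apply, hA]; simp
  refine ⟨V * (1 + 240 * A) ^ 3, by simp [hV0, hA0], ?_⟩
  have hE : ∃ r P, LExp 1 jfun r P := by
    refine exists_lexp one_pos mdiff_jfun (fun τ => ?_) (C := 2 * Real.pi) ?_
    · have := jfun_smul (ModularGroup.T ^ (1 : ℤ)) τ
      rw [T_smul_eq_aff] at this
      simpa using this
    · have hb : (ModularForm.E₄ : ℍ → ℂ) =O[atImInfty] (fun _ => (1 : ℝ)) := by
        simpa using h4.isBigO one_pos
      refine ((hb.pow 3).mul inv_discriminant_isBigO).congr (fun τ => ?_) fun τ => by simp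
      rw [jfun, div_eq_mul_inv]
  have := LExp.of_mul one_pos hE (w := Δ) (a := 0) (b := 1) (c := 0) (W := ℤtoℂ D) (V := ℤtoℂ V)
    (Q := (ℤtoℂ (1 + 240 * A)) ^ 3) (by simpa using hΔ) (by rw [← map_mul, hV, map_one]) ?_
  · simpa using this
  · convert h4' using 1
    funext τ
    simp only [Pi.mul_apply, Pi.pow_apply, jfun]
    rw [mul_div_cancel₀ _ (ModularForm.discriminant_ne_zero τ)]

/-- A holomorphic `SL(2, ℤ)`-invariant function that is meromorphic at `∞` is a polynomial in
`j`. -/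
theorem exists_eq_eval_jfun {u : ℍ → ℂ} (hu : MDiff u) (hinv : ∀ (γ : SL(2, ℤ)) τ, u (γ • τ) = u τ)
    {C : ℝ} (hO : u =O[atImInfty] fun τ : ℍ => Real.exp (C * τ.im)) :
    ∃ Q : Polynomial ℂ, ∀ τ, u τ = Q.eval (jfun τ) := by
  obtain ⟨r, P, h⟩ := exists_lexp one_pos hu (fun τ => by
    have := hinv (ModularGroup.T ^ (1 : ℤ)) τ
    rw [T_smul_eq_aff] at this
    simpa using this) hO
  clear hO
  obtain ⟨J, hJ, hj⟩ := exists_lexp_jfun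
  induction r generalizing u P with
  | zero =>
    have hb : IsBoundedAtImInfty u := by
      have := h.isBigO one_pos
      simp only [Nat.cast_zero, mul_zero, zero_div, zero_mul, Real.exp_zero] at this
      exact this
    have hs : ∀ γ : SL(2, ℤ), u ∣[(0 : ℤ)] γ = u := fun γ => by
      funext τ
      rw [ModularForm.SL_slash_apply, hinv]; simp
    let f : ModularForm 𝒮ℒ 0 :=
      { toFun := u
        slash_action_eq' := fun _ ⟨γ, hγ⟩ ↦ hγ ▸ hs γ
        holo' := hu
        bdd_at_cusps' := fun {c} hc => by
          rw [Subgroup.IsArithmetic.isCusp_iff_isCusp_SL2Z] at hc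
          rw [OnePoint.isBoundedAt_iff_forall_SL2Z hc]
          intro γ _
          rw [hs γ]
          exact hb }
    obtain ⟨c, hc⟩ := ModularFormClass.levelOne_weight_zero_const f
    refine ⟨Polynomial.C c, fun τ => ?_⟩
    rw [Polynomial.eval_C]
    exact congrFun hc τ
  | succ r ih =>
    -- Subtracting c j^(r+1) removes the leading pole. The induction on the pole order ends with a
    -- holomorphic form of weight 0 and level one, which is constant.
    set c := PowerSeries.constantCoeff P
    have h2 := (hj.pow (r + 1)).smul c
    rw [mul_one] at h2
    have h1 := h.sub h2
    have h0 : PowerSeries.constantCoeff (P - PowerSeries.C c * (ℤtoℂ J) ^ (r + 1)) = 0 := by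
      have : PowerSeries.constantCoeff (ℤtoℂ J) = 1 := by
        rw [← PowerSeries.coeff_zero_eq_constantCoeff_apply, PowerSeries.coeff_map]
        simp [hJ]
      simp [this, c]
    obtain ⟨P', hP'⟩ := PowerSeries.X_dvd_iff.2 h0
    rw [hP'] at h1
    obtain ⟨Q, hQ⟩ := ih (hu.sub ((mdiff_jfun.pow (r + 1)).const_smul c)) (fun γ τ => by
      simp only [Pi.sub_apply, Pi.smul_apply, Pi.pow_apply, hinv, jfun_smul]) P' h1.of_X_mul
    refine ⟨Q + Polynomial.C c * Polynomial.X ^ (r + 1), fun τ => ?_⟩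
    have := hQ τ
    simp only [Pi.sub_apply, Pi.smul_apply, Pi.pow_apply, smul_eq_mul] at this
    simp only [Polynomial.eval_add, ← this, Polynomial.eval_mul, Polynomial.eval_C,
      Polynomial.eval_pow, Polynomial.eval_X]
    ring

end Moonshine

end


noncomputable section

namespace Moonshine

/-! ### The action of `SL(2, ℝ)` and scaling -/

local notation "Δ" => ModularForm.discriminant

/-- The factor `cτ + d`. -/
def dn (γ : SL(2, ℝ)) (τ : ℍ) : ℂ := γ 1 0 * τ + γ 1 1

theorem dn_eq_denom (γ : SL(2, ℝ)) (τ : ℍ) :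
    dn γ τ = denom (SpecialLinearGroup.toGL γ : GL (Fin 2) ℝ) τ := rfl

theorem dn_ne_zero (γ : SL(2, ℝ)) (τ : ℍ) : dn γ τ ≠ 0 := by
  rw [dn_eq_denom]; exact denom_ne_zero _ _

theorem coe_smul (γ : SL(2, ℝ)) (τ : ℍ) :
    ((γ • τ : ℍ) : ℂ) = (γ 0 0 * τ + γ 0 1) / dn γ τ := by
  rw [coe_specialLinearGroup_apply]; rfl

theorem intCast_smul (γ : SL(2, ℤ)) (τ : ℍ) : (γ : SL(2, ℝ)) • τ = γ • τ := rfl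

theorem slash_toGL_apply (f : ℍ → ℂ) (k : ℤ) (γ : SL(2, ℝ)) (τ : ℍ) :
    (f ∣[k] (SpecialLinearGroup.toGL γ : GL (Fin 2) ℝ)) τ = f (γ • τ) * dn γ τ ^ (-k) := by
  rw [ModularForm.slash_apply, dn_eq_denom]
  have : (SpecialLinearGroup.toGL γ : GL (Fin 2) ℝ) • τ = γ • τ := rfl
  rw [this]
  simp [σ]

theorem slash_SL_apply (f : ℍ → ℂ) (k : ℤ) (γ : SL(2, ℤ)) (τ : ℍ) :
    (f ∣[k] γ) τ = f (γ • τ) * dn γ τ ^ (-k) := slash_toGL_apply f k γ τ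

/-- If `diag(s, 1) γ = l γ₀ [s', t; 0, 1]` then `s(γτ) = γ₀(s'τ + t)`. -/
theorem aff_smul {s s' t l : ℝ} (hs : 0 < s) (hs' : 0 < s') {γ : SL(2, ℝ)} {γ₀ : SL(2, ℤ)}
    (h00 : s * γ 0 0 = l * (γ₀ 0 0 * s')) (h01 : s * γ 0 1 = l * (γ₀ 0 0 * t + γ₀ 0 1))
    (h10 : γ 1 0 = l * (γ₀ 1 0 * s')) (h11 : γ 1 1 = l * (γ₀ 1 0 * t + γ₀ 1 1)) (τ : ℍ) :
    aff s 0 (γ • τ) = γ₀ • aff s' t τ ∧ dn γ τ = l * dn γ₀ (aff s' t τ) := by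
  have e : dn γ τ = l * dn γ₀ (aff s' t τ) := by
    rw [dn, dn, coe_aff hs', h10, h11]
    simp only [SpecialLinearGroup.map_apply_coe, RingHom.mapMatrix_apply, Matrix.map_apply,
      Int.coe_castRingHom]
    push_cast
    ring
  refine ⟨?_, e⟩
  ext
  have h1 := dn_ne_zero γ τ
  have h2 := dn_ne_zero γ₀ (aff s' t τ)
  rw [coe_aff hs, coe_smul, ← intCast_smul, coe_smul, coe_aff hs', Complex.ofReal_zero, add_zero,
    mul_div_assoc', div_eq_div_iff h1 h2, e]
  simp only [SpecialLinearGroup.map_apply_coe, RingHom.mapMatrix_apply, Matrix.map_apply,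
    Int.coe_castRingHom]
  have h00' : (s : ℂ) * γ 0 0 = l * (γ₀ 0 0 * s') := by exact_mod_cast congrArg (fun x : ℝ => (x : ℂ)) h00
  have h01' : (s : ℂ) * γ 0 1 = l * (γ₀ 0 0 * t + γ₀ 0 1) := by
    exact_mod_cast congrArg (fun x : ℝ => (x : ℂ)) h01
  push_cast
  linear_combination dn γ₀ (aff s' t τ) * (τ * h00' + h01')

/-- Hermite normal form of `diag(s, 1) γ`. -/
theorem exists_hermite {s : ℕ} (hs : 0 < s) (γ : SL(2, ℤ)) : ∃ (γ₀ : SL(2, ℤ)) (a d : ℕ) (b : ℤ),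
    0 < a ∧ 0 < d ∧ a * d = s ∧ a = Int.gcd (s * γ 0 0) (γ 1 0) ∧
    s * γ 0 0 = γ₀ 0 0 * a ∧ s * γ 0 1 = γ₀ 0 0 * b + γ₀ 0 1 * d ∧
    γ 1 0 = γ₀ 1 0 * a ∧ γ 1 1 = γ₀ 1 0 * b + γ₀ 1 1 * d := by
  have hdet := γ.det_coe
  rw [Matrix.det_fin_two] at hdet
  set a := Int.gcd (s * γ 0 0) (γ 1 0) with ha
  have ha0 : 0 < a := by
    refine Nat.pos_of_ne_zero fun h => ?_
    rw [ha, Int.gcd_eq_zero_iff] at h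
    have h0 : γ 0 0 = 0 := by
      rcases mul_eq_zero.1 h.1 with h' | h'
      · exact absurd h' (by exact_mod_cast hs.ne')
      · exact h'
    simp [h0, h.2] at hdet
  obtain ⟨x, hx⟩ : (a : ℤ) ∣ s * γ 0 0 := Int.gcd_dvd_left ..
  obtain ⟨y, hy⟩ : (a : ℤ) ∣ γ 1 0 := Int.gcd_dvd_right ..
  have haZ : (a : ℤ) ≠ 0 := by exact_mod_cast ha0.ne'
  have hxy : x * Int.gcdA (s * γ 0 0) (γ 1 0) + y * Int.gcdB (s * γ 0 0) (γ 1 0) = 1 := by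
    have := Int.gcd_eq_gcd_ab (s * γ 0 0) (γ 1 0)
    rw [← ha] at this
    refine mul_left_cancel₀ haZ ?_
    linear_combination (-Int.gcdA (s * γ 0 0) (γ 1 0)) * hx - Int.gcdB (s * γ 0 0) (γ 1 0) * hy -
      this
  generalize Int.gcdA (s * γ 0 0) (γ 1 0) = u at hxy
  generalize Int.gcdB (s * γ 0 0) (γ 1 0) = v at hxy
  have hD : (a : ℤ) * (x * γ 1 1 - y * (s * γ 0 1)) = s := by
    linear_combination (s : ℤ) * hdet - γ 1 1 * hx + s * γ 0 1 * hy
  have hDpos : 0 < x * γ 1 1 - y * (s * γ 0 1) := by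
    refine pos_of_mul_pos_right (a := (a : ℤ)) ?_ (by positivity)
    rw [hD]; exact_mod_cast hs
  obtain ⟨d, hd⟩ := Int.eq_ofNat_of_zero_le hDpos.le
  rw [hd] at hD hDpos
  -- γ₀ has as first column that of diag(s, 1)γ divided by its gcd a, completed by Bézout
  -- coefficients; b and d are then read off from the second column of γ₀⁻¹ diag(s, 1)γ.
  refine ⟨mkSL x (-v) y u (by linear_combination hxy), a, d, u * (s * γ 0 1) + v * γ 1 1, ha0,
    by exact_mod_cast hDpos, by exact_mod_cast hD, rfl, ?_, ?_, ?_, ?_⟩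
  · simp [hx, mul_comm]
  · simp
    linear_combination (-(s * γ 0 1)) * hxy - v * hd
  · simp [hy, mul_comm]
  · simp
    linear_combination (-(γ 1 1)) * hxy + u * hd

theorem aff_smul_of_hermite {s : ℕ} (hs : 0 < s) {γ γ₀ : SL(2, ℤ)} {a d : ℕ} {b : ℤ} (ha : 0 < a)
    (hd : 0 < d) (h00 : s * γ 0 0 = γ₀ 0 0 * a) (h01 : s * γ 0 1 = γ₀ 0 0 * b + γ₀ 0 1 * d)
    (h10 : γ 1 0 = γ₀ 1 0 * a) (h11 : γ 1 1 = γ₀ 1 0 * b + γ₀ 1 1 * d) (τ : ℍ) :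
    aff s 0 (γ • τ) = γ₀ • aff (a / d) (b / d) τ ∧
      dn γ τ = d * dn γ₀ (aff (a / d) (b / d) τ) := by
  have hdR : (d : ℝ) ≠ 0 := by positivity
  have h00' : (s : ℝ) * γ 0 0 = γ₀ 0 0 * a := by exact_mod_cast h00
  have h01' : (s : ℝ) * γ 0 1 = γ₀ 0 0 * b + γ₀ 0 1 * d := by exact_mod_cast h01
  have h10' : (γ 1 0 : ℝ) = γ₀ 1 0 * a := by exact_mod_cast h10
  have h11' : (γ 1 1 : ℝ) = γ₀ 1 0 * b + γ₀ 1 1 * d := by exact_mod_cast h11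
  have := aff_smul (s := s) (s' := a / d) (t := b / d) (l := d) (γ := γ) (γ₀ := γ₀)
    (by positivity) (by positivity) (by
      simp only [SpecialLinearGroup.map_apply_coe, RingHom.mapMatrix_apply, Matrix.map_apply,
        Int.coe_castRingHom]
      rw [h00']; field_simp) (by
      simp only [SpecialLinearGroup.map_apply_coe, RingHom.mapMatrix_apply, Matrix.map_apply,
        Int.coe_castRingHom]
      rw [h01']; field_simp) (by
      simp only [SpecialLinearGroup.map_apply_coe, RingHom.mapMatrix_apply, Matrix.map_apply,
        Int.coe_castRingHom]
      rw [h10']; field_simp) (by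
      simp only [SpecialLinearGroup.map_apply_coe, RingHom.mapMatrix_apply, Matrix.map_apply,
        Int.coe_castRingHom]
      rw [h11']; field_simp) τ
  exact_mod_cast this

/-- `j(sγτ) = j((aτ + b)/d)`. -/
theorem jfun_aff_smul {s : ℕ} (hs : 0 < s) {γ γ₀ : SL(2, ℤ)} {a d : ℕ} {b : ℤ} (ha : 0 < a)
    (hd : 0 < d) (h00 : s * γ 0 0 = γ₀ 0 0 * a) (h01 : s * γ 0 1 = γ₀ 0 0 * b + γ₀ 0 1 * d)
    (h10 : γ 1 0 = γ₀ 1 0 * a) (h11 : γ 1 1 = γ₀ 1 0 * b + γ₀ 1 1 * d) (τ : ℍ) :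
    jfun (aff s 0 (γ • τ)) = jfun (aff (a / d) (b / d) τ) := by
  rw [(aff_smul_of_hermite hs ha hd h00 h01 h10 h11 τ).1, jfun_smul]

theorem discriminant_aff_smul {s s' t l : ℝ} {γ : SL(2, ℝ)} {γ₀ : SL(2, ℤ)} {τ : ℍ} (hl : l ≠ 0)
    (h : aff s 0 (γ • τ) = γ₀ • aff s' t τ ∧ dn γ τ = l * dn γ₀ (aff s' t τ)) :
    Δ (aff s 0 (γ • τ)) = (dn γ τ / l) ^ 12 * Δ (aff s' t τ) := by
  have hl' : (l : ℂ) ≠ 0 := by exact_mod_cast hl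
  rw [h.1, discriminant_smul, h.2, mul_div_cancel_left₀ _ hl']
  rfl

/-! ### Functions of at most exponential growth at all cusps -/

theorem isBigO_exp_mono {u : ℍ → ℂ} {C C' : ℝ} (h : C ≤ C')
    (hu : u =O[atImInfty] fun τ : ℍ => Real.exp (C * τ.im)) :
    u =O[atImInfty] fun τ : ℍ => Real.exp (C' * τ.im) := by
  refine hu.trans (Asymptotics.IsBigO.of_bound 1 (Eventually.of_forall fun τ => ?_))
  rw [one_mul, Real.norm_of_nonneg (Real.exp_nonneg _), Real.norm_of_nonneg (Real.exp_nonneg _),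
    Real.exp_le_exp]
  exact mul_le_mul_of_nonneg_right h τ.im_pos.le

theorem isBigO_exp_comp_aff {u : ℍ → ℂ} {C : ℝ}
    (hu : u =O[atImInfty] fun τ : ℍ => Real.exp (C * τ.im)) {s : ℝ} (hs : 0 < s) (t : ℝ) :
    (fun τ => u (aff s t τ)) =O[atImInfty] fun τ : ℍ => Real.exp (C * s * τ.im) := by
  refine (hu.comp_tendsto (tendsto_aff hs t)).congr_right fun τ => ?_
  simp only [Function.comp_apply, im_aff hs]
  rw [mul_assoc]

/-- The holomorphic functions that are meromorphic at all cusps. -/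
def wring : Subring (ℍ → ℂ) where
  carrier := {u | MDiff u ∧ ∀ γ : SL(2, ℤ), ∃ C : ℝ,
    (fun τ => u (γ • τ)) =O[atImInfty] fun τ : ℍ => Real.exp (C * τ.im)}
  mul_mem' := by
    rintro u v ⟨hu, hu'⟩ ⟨hv, hv'⟩
    refine ⟨hu.mul hv, fun γ => ?_⟩
    obtain ⟨C, hC⟩ := hu' γ
    obtain ⟨C', hC'⟩ := hv' γ
    refine ⟨C + C', (hC.mul hC').congr_right fun τ => ?_⟩
    rw [← Real.exp_add, add_mul]
  one_mem' := ⟨mdifferentiable_const, fun γ => ⟨0, by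
    simpa using Asymptotics.isBigO_const_const (1 : ℂ) (one_ne_zero (α := ℝ)) atImInfty⟩⟩
  add_mem' := by
    rintro u v ⟨hu, hu'⟩ ⟨hv, hv'⟩
    refine ⟨hu.add hv, fun γ => ?_⟩
    obtain ⟨C, hC⟩ := hu' γ
    obtain ⟨C', hC'⟩ := hv' γ
    exact ⟨max C C', (isBigO_exp_mono (le_max_left _ _) hC).add
      (isBigO_exp_mono (le_max_right _ _) hC')⟩
  zero_mem' := ⟨mdifferentiable_const, fun γ => ⟨0, Asymptotics.isBigO_zero _ _⟩⟩
  neg_mem' := by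
    rintro u ⟨hu, hu'⟩
    refine ⟨hu.neg, fun γ => ?_⟩
    obtain ⟨C, hC⟩ := hu' γ
    exact ⟨C, hC.neg_left⟩

theorem comp_smul_mem_wring {u : ℍ → ℂ} (hu : u ∈ wring) (γ : SL(2, ℤ)) :
    (fun τ => u (γ • τ)) ∈ wring := by
  refine ⟨?_, fun δ => ?_⟩
  · exact hu.1.comp (mdifferentiable_smul (g := (γ : GL (Fin 2) ℝ)) (by simp))
  · obtain ⟨C, hC⟩ := hu.2 (γ * δ)
    exact ⟨C, by simpa only [mul_smul] using hC⟩

theorem jfun_mem_wring : jfun ∈ wring := by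
  obtain ⟨J, -, hJ⟩ := exists_lexp_jfun
  refine ⟨mdiff_jfun, fun γ => ?_⟩
  simp only [jfun_smul]
  exact ⟨_, hJ.isBigO one_pos⟩

theorem jfun_aff_mem_wring {s : ℕ} (hs : 0 < s) : (fun τ => jfun (aff s 0 τ)) ∈ wring := by
  refine ⟨mdiff_comp_aff mdiff_jfun (by positivity) 0, fun γ => ?_⟩
  obtain ⟨γ₀, a, d, b, ha, hd, -, -, h00, h01, h10, h11⟩ := exists_hermite hs γ
  simp only [jfun_aff_smul hs ha hd h00 h01 h10 h11]
  obtain ⟨J, -, hJ⟩ := exists_lexp_jfun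
  exact ⟨_, isBigO_exp_comp_aff (hJ.isBigO one_pos) (by positivity) _⟩

theorem const_mem_wring (c : ℂ) : (fun _ => c) ∈ wring := by
  refine ⟨mdifferentiable_const, fun γ => ⟨0, ?_⟩⟩
  simpa using Asymptotics.isBigO_const_const c (one_ne_zero (α := ℝ)) _

theorem exists_lexp_of_mem_wring {M : ℕ} (hM : 0 < M) {u : ℍ → ℂ} (hu : u ∈ wring)
    (hper : ∀ τ, u (aff 1 M τ) = u τ) : u ∈ lring M ⊤ := by
  obtain ⟨C, hC⟩ := hu.2 1
  simp only [one_smul] at hC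
  obtain ⟨r, P, h⟩ := exists_lexp hM hu.1 hper hC
  exact h.mem_lring_top

end Moonshine

end


/-! ### Rational expansions and bounded denominators of conjugates, by interpolation at the
conjugates of j(Mτ). -/

noncomputable section

namespace Moonshine

/-! ### Conjugates of `Γ₀(M)`-invariant functions -/

/-- A product of holomorphic functions on ℍ vanishes only if a factor does. It allows polynomials
over `wring` to be identified by their values at distinct conjugates. -/
instance : IsDomain wring := by
  have : NoZeroDivisors wring := ⟨fun {u v} h => by
    have h' : (u : ℍ → ℂ) * v = 0 := congrArg Subtype.val h
    rw [UpperHalfPlane.mul_eq_zero_iff u.2.1 v.2.1] at h'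
    exact h'.imp (fun h => Subtype.ext h) fun h => Subtype.ext h⟩
  have : Nontrivial wring := ⟨0, 1, fun h => by
    have := congrFun (congrArg Subtype.val h) I
    simp at this⟩
  exact NoZeroDivisors.to_isDomain _

/-- The action of `SL(2, ℤ)` on functions. -/
def actW (δ : SL(2, ℤ)) : wring →+* wring where
  toFun u := ⟨fun τ => (u : ℍ → ℂ) (δ⁻¹ • τ), comp_smul_mem_wring u.2 δ⁻¹⟩
  map_one' := rfl
  map_mul' _ _ := rfl
  map_zero' := rfl
  map_add' _ _ := rfl

theorem actW_apply (δ : SL(2, ℤ)) (u : wring) (τ : ℍ) :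
    (actW δ u : ℍ → ℂ) τ = (u : ℍ → ℂ) (δ⁻¹ • τ) := rfl

theorem actW_mul (δ ε : SL(2, ℤ)) (u : wring) : actW (δ * ε) u = actW δ (actW ε u) := by
  apply Subtype.ext
  funext τ
  rw [actW_apply, actW_apply, actW_apply, _root_.mul_inv_rev, mul_smul]

/-- Invariance under `Γ₀(M)`. -/
def InvW (M : ℕ) (u : wring) : Prop :=
  ∀ γ ∈ CongruenceSubgroup.Gamma0 M, ∀ τ : ℍ, (u : ℍ → ℂ) (γ • τ) = (u : ℍ → ℂ) τ

/-- The conjugates of a function on `Γ₀(M)`. -/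
def conjW {M : ℕ} (u : wring) (x : SL(2, ℤ) ⧸ CongruenceSubgroup.Gamma0 M) : wring :=
  actW x.out u

theorem actW_eq_of_mem {M : ℕ} {u : wring} (hu : InvW M u) {γ : SL(2, ℤ)}
    (hγ : γ ∈ CongruenceSubgroup.Gamma0 M) : actW γ u = u := by
  apply Subtype.ext
  funext τ
  exact hu _ (inv_mem hγ) τ

theorem conjW_mk {M : ℕ} {u : wring} (hu : InvW M u) (γ : SL(2, ℤ)) :
    conjW u (γ : SL(2, ℤ) ⧸ CongruenceSubgroup.Gamma0 M) = actW γ u := by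
  obtain ⟨⟨δ, hδ⟩, h⟩ := QuotientGroup.mk_out_eq_mul (CongruenceSubgroup.Gamma0 M) γ
  rw [conjW, h, actW_mul, actW_eq_of_mem hu hδ]

theorem actW_conjW {M : ℕ} {u : wring} (hu : InvW M u) (δ : SL(2, ℤ))
    (x : SL(2, ℤ) ⧸ CongruenceSubgroup.Gamma0 M) : actW δ (conjW u x) = conjW u (δ • x) := by
  induction x using QuotientGroup.induction_on with
  | H γ =>
    rw [conjW_mk hu, ← actW_mul, ← conjW_mk hu]
    rfl

/-- The `j`-invariant. -/
def jW : wring := ⟨jfun, jfun_mem_wring⟩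

theorem actW_jW (δ : SL(2, ℤ)) : actW δ jW = jW := by
  apply Subtype.ext
  funext τ
  exact jfun_smul _ τ

/-- Constant functions. -/
def constW : ℂ →+* wring where
  toFun c := ⟨fun _ => c, const_mem_wring c⟩
  map_one' := rfl
  map_mul' _ _ := rfl
  map_zero' := rfl
  map_add' _ _ := rfl

theorem actW_constW (δ : SL(2, ℤ)) (c : ℂ) : actW δ (constW c) = constW c := rfl

/-- Evaluation of rational polynomials at `j`. -/
def evalJ : Polynomial ℚ →+* wring := Polynomial.eval₂RingHom (constW.comp (algebraMap ℚ ℂ)) jW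

theorem actW_comp_evalJ (δ : SL(2, ℤ)) : (actW δ).comp evalJ = evalJ := by
  refine Polynomial.ringHom_ext (fun a => ?_) ?_
  · simp [evalJ, actW_constW]
  · simp [evalJ, actW_jW]

theorem exists_eq_eval_jW {u : wring} (hu : ∀ δ, actW δ u = u) :
    ∃ Q : Polynomial ℂ, u = Q.eval₂ constW jW := by
  obtain ⟨C, hC⟩ := u.2.2 1
  simp only [one_smul] at hC
  obtain ⟨Q, hQ⟩ := exists_eq_eval_jfun u.2.1 (fun γ τ => by
    have := congrFun (congrArg Subtype.val (hu γ⁻¹)) τ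
    rwa [actW_apply, inv_inv] at this) hC
  refine ⟨Q, Subtype.ext (funext fun τ => ?_)⟩
  rw [hQ]
  have : ∀ Q : Polynomial ℂ, ((Q.eval₂ constW jW : wring) : ℍ → ℂ) τ = Q.eval (jfun τ) := by
    intro Q
    let ev : wring →+* ℂ := (Pi.evalRingHom (fun _ : ℍ => ℂ) τ).comp wring.subtype
    have h1 : ev (Q.eval₂ constW jW) = Q.eval (jfun τ) := by
      rw [Polynomial.hom_eval₂]
      have : ev.comp constW = RingHom.id ℂ := rfl
      rw [this]
      rfl
    exact h1
  exact (this Q).symm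

theorem jfun_mem_lring {M : ℕ} (hM : 0 < M) (A : Subring ℂ) : jfun ∈ lring M A := by
  obtain ⟨J, -, hJ⟩ := exists_lexp_jfun
  have h := hJ.comp_aff (a := 1) (d := 1) (s := M) one_pos one_pos hM.ne' one_pos hM (by ring) 0 rfl
  have e : (fun τ => jfun (aff ((1 : ℕ) / (1 : ℕ)) ((0 : ℤ) / (1 : ℕ)) τ)) = jfun := by
    funext τ
    congr 1
    ext
    rw [coe_aff (by simp)]
    simp
  rw [e] at h
  refine h.mem_lring (mul_mem (C_mem_coeffIn ?_) (expand_mem_coeffIn _ (rescale_mem_coeffIn ?_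
    (map_mem_coeffIn _ (fun x => ?_) J)))) <;> simp

/-- The subring of `wring` of functions with expansions in `A`. -/
def lringW (M : ℕ) (A : Subring ℂ) : Subring wring := (lring M A).comap wring.subtype

theorem evalJ_mem {M : ℕ} (hM : 0 < M) (Q : Polynomial ℚ) : evalJ Q ∈ lringW M ratRing := by
  have h : ∀ c : ℚ, constW (algebraMap ℚ ℂ c) ∈ lringW M ratRing := fun c =>
    (LExp.const M _).mem_lring (C_mem_coeffIn ⟨c, rfl⟩)
  have hj : jW ∈ lringW M ratRing := jfun_mem_lring hM _
  rw [evalJ, Polynomial.coe_eval₂RingHom, Polynomial.eval₂_eq_sum, Polynomial.sum]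
  exact sum_mem fun i _ => mul_mem (h _) (pow_mem hj i)

/-- A polynomial with `SL(2, ℤ)`-invariant coefficients and rational value at `θ` may be replaced
by one with coefficients in `ℚ[j]`. -/
theorem exists_rat_polynomial {M : ℕ} (hM : 0 < M) {θ : wring} (hθ : θ ∈ lringW M ratRing)
    {T : Polynomial wring} (hT : ∀ δ, T.map (actW δ) = T) (h : T.eval θ ∈ lringW M ratRing) :
    ∃ B : Polynomial (Polynomial ℚ), B.degree ≤ T.degree ∧
      ∀ δ, T.eval (actW δ θ) = (B.map evalJ).eval (actW δ θ) := by
  obtain ⟨π, hπ⟩ := exists_rat_projection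
  -- The invariant coefficients of T are polynomials in j. So T(θ) is a complex linear combination
  -- of the rational functions j^k θ^i, whose coefficients π makes rational.
  have hc : ∀ i, ∃ Q : Polynomial ℂ, T.coeff i = Q.eval₂ constW jW := fun i =>
    exists_eq_eval_jW fun δ => by
      conv_rhs => rw [← hT δ]
      rw [Polynomial.coeff_map]
  choose Q hQ using hc
  have hTe : T.eval θ = ∑ x ∈ T.support.sigma fun i => (Q i).support,
      constW ((Q x.1).coeff x.2) * (jW ^ x.2 * θ ^ x.1) := by
    rw [Polynomial.eval_eq_sum, Polynomial.sum, Finset.sum_sigma]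
    refine Finset.sum_congr rfl fun i _ => ?_
    rw [hQ, Polynomial.eval₂_eq_sum, Polynomial.sum, Finset.sum_mul]
    exact Finset.sum_congr rfl fun k _ => by ring
  set B : Polynomial (Polynomial ℚ) := ∑ i ∈ T.support,
    Polynomial.monomial i (∑ k ∈ (Q i).support, Polynomial.monomial k (π ((Q i).coeff k))) with hB
  have hBe : (B.map evalJ).eval θ = ∑ x ∈ T.support.sigma fun i => (Q i).support,
      constW ((π ((Q x.1).coeff x.2) : ℚ) : ℂ) * (jW ^ x.2 * θ ^ x.1) := by
    rw [hB, Polynomial.map_sum, Polynomial.eval_finsetSum, Finset.sum_sigma]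
    refine Finset.sum_congr rfl fun i _ => ?_
    rw [Polynomial.map_monomial, Polynomial.eval_monomial, map_sum, Finset.sum_mul]
    refine Finset.sum_congr rfl fun k _ => ?_
    simp [evalJ, Polynomial.eval₂_monomial]
    ring
  have key : T.eval θ = (B.map evalJ).eval θ := by
    have hsmul : ∀ (c : ℂ) (u : wring), ((constW c * u : wring) : ℍ → ℂ) = c • (u : ℍ → ℂ) :=
      fun c u => rfl
    have h' : ((T.eval θ : wring) : ℍ → ℂ) ∈ lring M ratRing := h
    apply Subtype.ext
    rw [hTe] at h' ⊢
    rw [hBe]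
    have e : ∀ (t : Finset (Σ _ : ℕ, ℕ)) (f : (Σ _ : ℕ, ℕ) → wring),
        ((∑ x ∈ t, f x : wring) : ℍ → ℂ) = ∑ x ∈ t, (f x : ℍ → ℂ) := fun t f =>
      map_sum wring.subtype f t
    rw [e] at h' ⊢
    rw [e]
    simp only [hsmul] at h' ⊢
    refine sum_smul_eq_of_rat hM hπ _ (fun x _ => ?_) _ h'
    exact mul_mem (pow_mem (jfun_mem_lring hM _) _) (pow_mem (show (θ : ℍ → ℂ) ∈ _ from hθ) _)
  refine ⟨B, ?_, fun δ => ?_⟩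
  · refine (Polynomial.degree_sum_le _ _).trans (Finset.sup_le fun i hi => ?_)
    exact (Polynomial.degree_monomial_le _ _).trans (Polynomial.le_degree_of_mem_supp i hi)
  -- Both polynomials have SL(2, ℤ)-invariant coefficients, so their equality at θ passes to every
  -- conjugate of θ.
  · have h1 := congrArg (actW δ) key
    rw [← Polynomial.eval₂_at_apply, ← Polynomial.eval_map, hT, ← Polynomial.eval₂_at_apply,
      ← Polynomial.eval_map, Polynomial.map_map, actW_comp_evalJ] at h1
    exact h1

end Moonshine

end


noncomputable section

namespace Moonshine

/-! ### Differences of conjugates of `j(Mτ)` -/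

local notation "ℤtoℂ" => PowerSeries.map (Int.castRingHom ℂ)

theorem constantCoeff_map_int {J : PowerSeries ℤ} (hJ : PowerSeries.constantCoeff J = 1) :
    PowerSeries.constantCoeff (ℤtoℂ J) = 1 := by
  rw [← PowerSeries.coeff_zero_eq_constantCoeff_apply, PowerSeries.coeff_map]
  simp [hJ]

theorem constantCoeff_rescale' (ω : ℂ) (P : PowerSeries ℂ) :
    PowerSeries.constantCoeff (PowerSeries.rescale ω P) = PowerSeries.constantCoeff P := by
  rw [← PowerSeries.coeff_zero_eq_constantCoeff_apply, PowerSeries.coeff_rescale]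
  simp

theorem lexp_jfun_aff {J : PowerSeries ℤ} (hJ : LExp 1 jfun 1 (ℤtoℂ J)) {a d : ℕ} (ha : 0 < a)
    (hd : 0 < d) (b : ℤ) {ω : ℂ}
    (hω : ω = Complex.exp (2 * Real.pi * Complex.I * (b / d))) :
    LExp (a * d) (fun τ => jfun (aff (a / d) (b / d) τ)) (a ^ 2)
      (PowerSeries.C ω⁻¹ * PowerSeries.expand (a ^ 2) (by positivity)
        (PowerSeries.rescale ω (ℤtoℂ J))) := by
  have := hJ.comp_aff (a := a) (d := d) (s := a ^ 2) (M := a * d) ha hd (by positivity) one_pos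
    (by positivity) (by ring) b (ω := ω) (by rw [hω]; simp)
  simpa using this

theorem exp_pow_eq_one {d : ℕ} (hd : 0 < d) (b : ℤ) :
    Complex.exp (2 * Real.pi * Complex.I * (b / d)) ^ d = 1 := by
  rw [← Complex.exp_nat_mul, Complex.exp_eq_one_iff]
  refine ⟨b, ?_⟩
  have : (d : ℂ) ≠ 0 := by exact_mod_cast hd.ne'
  field_simp

theorem exp_eq_one_iff' {d : ℕ} (hd : 0 < d) (b : ℤ) :
    Complex.exp (2 * Real.pi * Complex.I * (b / d)) = 1 ↔ (d : ℤ) ∣ b := by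
  have hdC : (d : ℂ) ≠ 0 := by exact_mod_cast hd.ne'
  have hpi : (2 * Real.pi * Complex.I : ℂ) ≠ 0 := Complex.two_pi_I_ne_zero
  rw [Complex.exp_eq_one_iff]
  constructor
  · rintro ⟨k, hk⟩
    refine ⟨k, ?_⟩
    rw [mul_comm ((k : ℂ)), mul_right_inj' hpi, div_eq_iff hdC] at hk
    have : b = k * d := by exact_mod_cast hk
    rw [this, mul_comm]
  · rintro ⟨k, rfl⟩
    refine ⟨k, ?_⟩
    push_cast
    field_simp

/-- With q = q_{pN}, the function j((aτ + b)/d) starts with ω⁻¹ q^(-a²), where ω = exp(2πib/d). If a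
≠ a₀ the poles have different orders, and the leading coefficient of the difference is up to sign a
root of unity. If a = a₀ the coefficients of the difference are those of j times 1 - ω^(m-1), all
divisible by 1 - ω⁻¹. As ω ≠ 1, that number divides d, a divisor of pN, and so divides p up to
p-units. -/
theorem good_jfun_sub {p : ℕ} [hp : Fact p.Prime] {N a₀ d₀ a d : ℕ} (hpN : ¬ p ∣ N) (ha₀ : 0 < a₀)
    (hd₀ : 0 < d₀) (ha : 0 < a) (hd : 0 < d) (h₀ : a₀ * d₀ = p * N) (h : a * d = p * N) (b : ℤ)
    (hne : a = a₀ → ¬ (d : ℤ) ∣ b) :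
    Good p (p * N) (fun τ => jfun (aff (a₀ / d₀) 0 τ) - jfun (aff (a / d) (b / d) τ)) ∧
      (fun τ => jfun (aff (a₀ / d₀) 0 τ) - jfun (aff (a / d) (b / d) τ)) ≠ 0 := by
  have hM : 0 < p * N := h ▸ Nat.mul_pos ha hd
  have hN : (N : ℂ) ≠ 0 := by
    have : N ≠ 0 := by rintro rfl; simp at hM
    exact_mod_cast this
  have hpC : (p : ℂ) ≠ 0 := by exact_mod_cast hp.out.ne_zero
  suffices ∃ (r k : ℕ) (z y : ℂ) (P : PowerSeries ℂ),
      LExp (p * N) (fun τ => jfun (aff (a₀ / d₀) 0 τ) - jfun (aff (a / d) (b / d) τ)) r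
        (PowerSeries.C z * P) ∧ P ∈ coeffIn (pint p) ∧ PowerSeries.constantCoeff P ≠ 0 ∧
      (PowerSeries.constantCoeff P)⁻¹ ∈ pint p ∧ y ∈ pint p ∧ y * z = (p : ℂ) ^ k by
    obtain ⟨r, k, z, y, P, h1, h2, h3, h4, h5, h6⟩ := this
    refine ⟨h1.good hM h2 h3 h4 h5 h6, h1.ne_zero hM ?_⟩
    intro h0
    have := congrArg PowerSeries.constantCoeff h0
    simp only [map_mul, PowerSeries.constantCoeff_C, map_zero, mul_eq_zero, h3, or_false] at this
    rw [this, mul_zero] at h6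
    exact pow_ne_zero k hpC h6.symm
  obtain ⟨J, hJ, hj⟩ := exists_lexp_jfun
  have hL₀ := lexp_jfun_aff hj ha₀ hd₀ 0 (ω := 1) (by simp)
  set ω : ℂ := Complex.exp (2 * Real.pi * Complex.I * (b / d)) with hω
  have hL := lexp_jfun_aff hj ha hd b hω
  rw [h] at hL
  rw [h₀] at hL₀
  simp only [inv_one, map_one, one_mul, PowerSeries.rescale_one, RingHom.id_apply, Int.cast_zero,
    zero_div] at hL₀
  have hωd : ω ^ d = 1 := exp_pow_eq_one hd b
  have hω0 : ω ≠ 0 := Complex.exp_ne_zero _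
  have hωi : IsIntegral ℤ ω := IsIntegral.of_pow hd (by rw [hωd]; exact isIntegral_one)
  have hωi' : IsIntegral ℤ ω⁻¹ :=
    IsIntegral.of_pow hd (by rw [inv_pow, hωd, inv_one]; exact isIntegral_one)
  have hJp : ℤtoℂ J ∈ coeffIn (pint p) := map_mem_coeffIn _ (fun x => by simp) J
  have hP : PowerSeries.C ω⁻¹ * PowerSeries.expand (a ^ 2) (by positivity)
      (PowerSeries.rescale ω (ℤtoℂ J)) ∈ coeffIn (pint p) :=
    mul_mem (C_mem_coeffIn (mem_pint_of_isIntegral hωi')) (expand_mem_coeffIn _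
      (rescale_mem_coeffIn (mem_pint_of_isIntegral hωi) hJp))
  have hP₀ : PowerSeries.expand (a₀ ^ 2) (by positivity) (ℤtoℂ J) ∈ coeffIn (pint p) :=
    expand_mem_coeffIn _ hJp
  have hJ1 := constantCoeff_map_int hJ
  rcases lt_trichotomy a a₀ with hlt | rfl | hlt
  · obtain ⟨s, hs⟩ := Nat.exists_eq_add_of_le' (Nat.pow_le_pow_left hlt.le 2)
    have hs0 : s ≠ 0 := by
      rintro rfl
      rw [zero_add] at hs
      exact hlt.ne' (Nat.pow_left_injective two_ne_zero hs)
    have h2 := hL.shift s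
    rw [← hs] at h2
    refine ⟨a₀ ^ 2, 0, 1, 1, _, by simpa using! hL₀.sub h2, sub_mem hP₀ (X_pow_mul_mem_coeffIn.2 hP),
      ?_, ?_, one_mem _, by simp⟩ <;>
    simp [hJ1, hs0]
  · obtain rfl : d = d₀ := Nat.eq_of_mul_eq_mul_left ha (h.trans h₀.symm)
    have hω1 : ω⁻¹ ≠ 1 := by
      rw [Ne, inv_eq_one]
      exact fun h => hne rfl ((exp_eq_one_iff' hd b).1 h)
    obtain ⟨y, hy, hyz⟩ := exists_mul_one_sub_eq (ζ := ω⁻¹) (d := d)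
      (by rw [inv_pow, hωd, inv_one]) hω1
    have ht : ∀ m : ℕ, ∃ t : ℂ, IsIntegral ℤ t ∧ (m = 0 → t = 1) ∧
        1 - ω⁻¹ * ω ^ m = (1 - ω⁻¹) * t := by
      intro m
      rcases m with - | m
      · exact ⟨1, isIntegral_one, fun _ => rfl, by simp⟩
      -- ω^d = 1 gives ω^m = (ω⁻¹)^((d-1)m), so 1 - ω^m is 1 - ω⁻¹ times a geometric sum in ω⁻¹.
      · refine ⟨∑ k ∈ Finset.range ((d - 1) * m), ω⁻¹ ^ k,
          IsIntegral.sum _ fun k _ => hωi'.pow k, by simp, ?_⟩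
        rw [mul_neg_geom_sum, pow_succ, mul_comm (ω ^ m), inv_mul_cancel_left₀ hω0, pow_mul]
        congr 2
        rw [inv_pow, ← mul_eq_one_iff_eq_inv₀ (pow_ne_zero _ hω0), ← pow_succ',
          Nat.sub_add_cancel hd, hωd]
    choose t hti ht0 ht using ht
    -- y(1 - ω⁻¹) = d and ad = pN, so the p-integral factor a/N turns d into p.
    refine ⟨a ^ 2, 1, 1 - ω⁻¹, y * (a * (N : ℂ)⁻¹), PowerSeries.expand (a ^ 2) (by positivity)
      (PowerSeries.mk fun m => t m * PowerSeries.coeff m (ℤtoℂ J)), ?_,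
      expand_mem_coeffIn _ (mem_coeffIn.2 fun m => ?_), ?_, ?_, ?_, ?_⟩
    · convert (show LExp (p * N) (fun τ => jfun (aff (a / d) 0 τ) - jfun (aff (a / d) (b / d) τ)) _ _
        from hL₀.sub hL) using 1
      have e : PowerSeries.C ω⁻¹ = PowerSeries.expand (a ^ 2) (by positivity)
        (PowerSeries.C ω⁻¹) := (PowerSeries.expand_C _ _ _).symm
      have e' : PowerSeries.C (1 - ω⁻¹) = PowerSeries.expand (a ^ 2) (by positivity)
        (PowerSeries.C (1 - ω⁻¹)) := (PowerSeries.expand_C _ _ _).symm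
      rw [e, e', ← map_mul, ← map_mul, ← map_sub]
      congr 1
      ext m
      rw [PowerSeries.coeff_C_mul, PowerSeries.coeff_mk, map_sub, PowerSeries.coeff_C_mul,
        PowerSeries.coeff_rescale, ← mul_assoc, ← ht]
      ring
    · rw [PowerSeries.coeff_mk]
      exact mul_mem (mem_pint_of_isIntegral (hti m)) (mem_coeffIn.1 hJp m)
    · rw [PowerSeries.constantCoeff_expand, ← PowerSeries.coeff_zero_eq_constantCoeff_apply,
        PowerSeries.coeff_mk, ht0 0 rfl, PowerSeries.coeff_zero_eq_constantCoeff_apply, hJ1]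
      simp
    · rw [PowerSeries.constantCoeff_expand, ← PowerSeries.coeff_zero_eq_constantCoeff_apply,
        PowerSeries.coeff_mk, ht0 0 rfl, PowerSeries.coeff_zero_eq_constantCoeff_apply, hJ1]
      simp
    · exact mul_mem (mem_pint_of_isIntegral hy) (mul_mem (by simp) (inv_natCast_mem_pint hpN))
    · have hC : (a : ℂ) * d = p * N := by exact_mod_cast h
      rw [pow_one, show y * (a * (N : ℂ)⁻¹) * (1 - ω⁻¹) = (1 - ω⁻¹) * y * (a * (N : ℂ)⁻¹) by ring,
        hyz, ← mul_assoc, mul_comm (d : ℂ), hC, mul_assoc, mul_inv_cancel₀ hN, mul_one]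
  · obtain ⟨s, hs⟩ := Nat.exists_eq_add_of_le' (Nat.pow_le_pow_left hlt.le 2)
    have hs0 : s ≠ 0 := by
      rintro rfl
      rw [zero_add] at hs
      exact hlt.ne' (Nat.pow_left_injective two_ne_zero hs)
    have h2 := hL₀.shift s
    rw [← hs] at h2
    refine ⟨a ^ 2, 0, 1, 1, _, by simpa using! h2.sub hL, sub_mem (X_pow_mul_mem_coeffIn.2 hP₀) hP,
      ?_, ?_, one_mem _, by simp⟩
    · simp [hJ1, hs0, hω0, constantCoeff_rescale']
    · simp [hJ1, hs0, constantCoeff_rescale', inv_neg, mem_pint_of_isIntegral hωi]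

end Moonshine

end


noncomputable section

namespace Moonshine

/-! ### Rationality and bounded denominators of conjugates -/

theorem SL2_mul_apply {R : Type*} [CommRing R] (γ δ : SL(2, R)) (i j : Fin 2) :
    (γ * δ) i j = γ i 0 * δ 0 j + γ i 1 * δ 1 j := by
  have h : ((γ * δ : SL(2, R)) : Matrix (Fin 2) (Fin 2) R) = γ * δ := rfl
  exact (congrFun (congrFun h i) j).trans (by rw [Matrix.mul_apply, Fin.sum_univ_two])

theorem SL2_inv_apply {R : Type*} [CommRing R] (γ : SL(2, R)) :
    γ⁻¹ 0 0 = γ 1 1 ∧ γ⁻¹ 0 1 = -γ 0 1 ∧ γ⁻¹ 1 0 = -γ 1 0 ∧ γ⁻¹ 1 1 = γ 0 0 := by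
  have h := Matrix.SpecialLinearGroup.coe_inv γ
  rw [Matrix.adjugate_fin_two] at h
  exact ⟨congrFun (congrFun h 0) 0, congrFun (congrFun h 0) 1, congrFun (congrFun h 1) 0,
    congrFun (congrFun h 1) 1⟩

/-- The function `j(Mτ)`. -/
def θW {M : ℕ} (hM : 0 < M) : wring := ⟨fun τ => jfun (aff M 0 τ), jfun_aff_mem_wring hM⟩

theorem invW_θW {M : ℕ} (hM : 0 < M) : InvW M (θW hM) := by
  intro γ hγ τ
  rw [CongruenceSubgroup.Gamma0_mem, ZMod.intCast_zmod_eq_zero_iff_dvd] at hγ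
  obtain ⟨c, hc⟩ := hγ
  have hdet := γ.det_coe
  rw [Matrix.det_fin_two] at hdet
  have := jfun_aff_smul hM (γ := γ) (γ₀ := mkSL (γ 0 0) (M * γ 0 1) c (γ 1 1)
    (by rw [hc] at hdet; linear_combination hdet)) (a := M) (d := 1) (b := 0) hM one_pos
    (by simp [mul_comm]) (by simp) (by simp [hc, mul_comm]) (by simp) τ
  simpa [θW] using this

theorem conjW_injective {M : ℕ} {θ : wring} (hθ : InvW M θ)
    (hne : ∀ x : SL(2, ℤ) ⧸ CongruenceSubgroup.Gamma0 M, x ≠ (1 : SL(2, ℤ)) → conjW θ x ≠ θ) :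
    Function.Injective (conjW (M := M) θ) := by
  intro x y hxy
  induction y using QuotientGroup.induction_on with
  | H γ =>
    by_contra h
    refine hne (γ⁻¹ • x) (fun h' => h ?_) ?_
    · rw [inv_smul_eq_iff] at h'
      rw [h']
      simp
    · rw [← actW_conjW hθ, hxy, conjW_mk hθ, ← actW_mul, inv_mul_cancel]
      exact actW_eq_of_mem hθ (one_mem _)

section Interpolation

variable {M : ℕ} [NeZero M]

instance : Fintype (SL(2, ℤ) ⧸ CongruenceSubgroup.Gamma0 M) :=
  (CongruenceSubgroup.Gamma0 M).fintypeQuotientOfFiniteIndex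

open Classical in
/-- `∏ (Y - θ')` over the conjugates `θ'` of `θ` with index different from `x`. -/
def nodalErase (θ : wring) (x : SL(2, ℤ) ⧸ CongruenceSubgroup.Gamma0 M) : Polynomial wring :=
  Lagrange.nodal (Finset.univ.erase x) (conjW θ)

/-- The interpolation polynomial `∑ v_x ∏_{x' ≠ x} (Y - θ_x')`. -/
def interp (θ v : wring) : Polynomial wring :=
  ∑ x : SL(2, ℤ) ⧸ CongruenceSubgroup.Gamma0 M, Polynomial.C (conjW v x) * nodalErase θ x

/-- `∏_{x' ≠ x} (θ_x - θ_x')`. -/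
def diffW (θ : wring) (x : SL(2, ℤ) ⧸ CongruenceSubgroup.Gamma0 M) : wring :=
  (nodalErase θ x).eval (conjW θ x)

theorem eval_interp (θ v : wring) (x : SL(2, ℤ) ⧸ CongruenceSubgroup.Gamma0 M) :
    (interp (M := M) θ v).eval (conjW θ x) = conjW v x * diffW θ x := by
  classical
  rw [interp, Polynomial.eval_finsetSum, Finset.sum_eq_single x]
  · rw [Polynomial.eval_mul, Polynomial.eval_C, diffW]
  · intro y _ hy
    rw [Polynomial.eval_mul, nodalErase, Lagrange.eval_nodal_at_node, mul_zero]
    exact Finset.mem_erase.2 ⟨hy.symm, Finset.mem_univ x⟩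
  · simp

theorem map_actW_nodalErase {θ : wring} (hθ : InvW M θ) (δ : SL(2, ℤ))
    (x : SL(2, ℤ) ⧸ CongruenceSubgroup.Gamma0 M) :
    (nodalErase θ x).map (actW δ) = nodalErase θ (δ • x) := by
  classical
  rw [nodalErase, nodalErase, Lagrange.nodal, Lagrange.nodal, Polynomial.map_prod]
  refine Finset.prod_equiv (MulAction.toPerm δ) (fun y => ?_) fun y _ => ?_
  · simp [Finset.mem_erase]
  · rw [Polynomial.map_sub, Polynomial.map_X, Polynomial.map_C, actW_conjW hθ]
    rfl

/-- δ permutes the cosets and with them the summands. The coefficients are therefore SL(2,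
ℤ)-invariant, as `exists_rat_polynomial` requires. -/
theorem map_actW_interp {θ v : wring} (hθ : InvW M θ) (hv : InvW M v) (δ : SL(2, ℤ)) :
    (interp (M := M) θ v).map (actW δ) = interp (M := M) θ v := by
  rw [interp, Polynomial.map_sum]
  refine Fintype.sum_equiv (MulAction.toPerm δ) _ _ fun x => ?_
  rw [Polynomial.map_mul, Polynomial.map_C, actW_conjW hv, map_actW_nodalErase hθ]
  rfl

theorem map_actW_nodal {θ : wring} (hθ : InvW M θ) (δ : SL(2, ℤ)) :
    (Lagrange.nodal Finset.univ (conjW (M := M) θ)).map (actW δ) =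
      Lagrange.nodal Finset.univ (conjW (M := M) θ) := by
  rw [Lagrange.nodal, Polynomial.map_prod]
  refine Fintype.prod_equiv (MulAction.toPerm δ) _ _ fun x => ?_
  rw [Polynomial.map_sub, Polynomial.map_X, Polynomial.map_C, actW_conjW hθ]
  rfl

/-- The conjugates of a rational function on `Γ₀(M)` are quotients of polynomials in `j` and the
corresponding conjugates of `θ` with rational coefficients. -/
theorem exists_rat_interp (hM : 0 < M) {θ v : wring} (hθ : InvW M θ) (hv : InvW M v)
    (hθr : θ ∈ lringW M ratRing) (hvr : v ∈ lringW M ratRing)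
    (hne : ∀ x : SL(2, ℤ) ⧸ CongruenceSubgroup.Gamma0 M, x ≠ (1 : SL(2, ℤ)) → conjW θ x ≠ θ) :
    ∃ B F : Polynomial (Polynomial ℚ), ∀ x : SL(2, ℤ) ⧸ CongruenceSubgroup.Gamma0 M,
      conjW v x * diffW θ x = (B.map evalJ).eval (conjW θ x) ∧
      diffW θ x = (F.map evalJ).eval (conjW θ x) := by
  classical
  set Φ := Lagrange.nodal Finset.univ (conjW (M := M) θ) with hΦ
  set d := Fintype.card (SL(2, ℤ) ⧸ CongruenceSubgroup.Gamma0 M)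
  have hconj1 : conjW θ ((1 : SL(2, ℤ)) : SL(2, ℤ) ⧸ CongruenceSubgroup.Gamma0 M) = θ := by
    rw [conjW_mk hθ]
    exact actW_eq_of_mem hθ (one_mem _)
  have hdeg : Φ.degree = d := by
    rw [hΦ, Lagrange.degree_nodal]; rfl
  have hmonic : Φ.Monic := Lagrange.nodal_monic
  -- Removing X^d brings the degree below d. The polynomial with coefficients in ℚ[j] that agrees
  -- with it at the d distinct conjugates of θ must then equal it, so Φ itself has coefficients in
  -- ℚ[j].
  have hT : ∀ δ, (Φ - Polynomial.X ^ d).map (actW δ) = Φ - Polynomial.X ^ d := fun δ => by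
    rw [Polynomial.map_sub, map_actW_nodal hθ, Polynomial.map_pow, Polynomial.map_X]
  have hΦ0 : ∀ x, Φ.eval (conjW θ x) = 0 := fun x =>
    Lagrange.eval_nodal_at_node (Finset.mem_univ x)
  have hlt : (Φ - Polynomial.X ^ d).degree < (d : WithBot ℕ) := by
    rw [← hdeg]
    refine Polynomial.degree_sub_lt_left ?_ hmonic.ne_zero ?_
    · rw [hdeg, Polynomial.degree_X_pow]
    · rw [hmonic.leadingCoeff, (Polynomial.monic_X_pow d).leadingCoeff]
  have hact : ∀ x : SL(2, ℤ) ⧸ CongruenceSubgroup.Gamma0 M, ∃ δ, ∀ u, conjW u x = actW δ u :=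
    fun x => ⟨x.out, fun u => rfl⟩
  obtain ⟨B₁, hB₁, hB₁'⟩ := exists_rat_polynomial hM hθr hT (by
    have := hΦ0 ((1 : SL(2, ℤ)) : SL(2, ℤ) ⧸ CongruenceSubgroup.Gamma0 M)
    rw [hconj1] at this
    rw [Polynomial.eval_sub, this, Polynomial.eval_pow, Polynomial.eval_X, zero_sub]
    exact neg_mem (pow_mem hθr d))
  have hΦB : Φ = (B₁ + Polynomial.X ^ d).map evalJ := by
    rw [Polynomial.map_add, Polynomial.map_pow, Polynomial.map_X, ← sub_eq_iff_eq_add, ← sub_eq_zero]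
    refine Polynomial.eq_zero_of_degree_lt_of_eval_index_eq_zero (s := Finset.univ)
      (v := conjW (M := M) θ) (conjW_injective hθ hne).injOn ?_ fun x _ => ?_
    · refine (Polynomial.degree_sub_le _ _).trans_lt (max_lt hlt ?_)
      exact (Polynomial.degree_map_le.trans hB₁).trans_lt hlt
    · obtain ⟨δ, hδ⟩ := hact x
      rw [Polynomial.eval_sub, hδ, hB₁' δ, sub_self]
  -- The value at θ is v Φ'(θ), which is rational because Φ has coefficients in ℚ[j].
  obtain ⟨B, -, hB⟩ := exists_rat_polynomial hM hθr (map_actW_interp hθ hv) (by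
    have := eval_interp θ v ((1 : SL(2, ℤ)) : SL(2, ℤ) ⧸ CongruenceSubgroup.Gamma0 M)
    rw [hconj1] at this
    rw [this, conjW_mk hv, actW_eq_of_mem hv (one_mem _), diffW, nodalErase,
      ← Lagrange.eval_nodal_derivative_eval_node_eq (Finset.mem_univ _), ← hΦ, hΦB, hconj1,
      Polynomial.derivative_map, Polynomial.eval_map, Polynomial.eval₂_eq_sum, Polynomial.sum]
    exact mul_mem hvr (sum_mem fun i _ => mul_mem (evalJ_mem hM _) (pow_mem hθr i)))
  refine ⟨B, Polynomial.derivative (B₁ + Polynomial.X ^ d), fun x => ⟨?_, ?_⟩⟩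
  · obtain ⟨δ, hδ⟩ := hact x
    rw [← eval_interp, hδ θ, hB]
  · rw [diffW, nodalErase, ← Lagrange.eval_nodal_derivative_eval_node_eq (Finset.mem_univ _),
      ← hΦ, ← Polynomial.derivative_map, ← hΦB]

end Interpolation

/-- Hermite forms turn both conjugates of j(pNτ) into functions j((aτ + b)/d), with b = 0 for the
first. If a = a₀ and d ∣ b, comparing the forms would put both elements in the same coset of Γ₀(pN),
which `hx` excludes; so `good_jfun_sub` applies. -/
theorem good_conj_sub {p : ℕ} [hp : Fact p.Prime] {N : ℕ} (hpN : ¬ p ∣ N) (hM : 0 < p * N)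
    {γ γ₀ : SL(2, ℤ)} {a₀ d₀ : ℕ} (ha₀ : 0 < a₀) (hd₀ : 0 < d₀) (h₀ : a₀ * d₀ = p * N)
    (h00 : (p * N : ℕ) * γ 0 0 = γ₀ 0 0 * a₀) (h01 : (p * N : ℕ) * γ 0 1 = γ₀ 0 1 * d₀)
    (h10 : γ 1 0 = γ₀ 1 0 * a₀) (h11 : γ 1 1 = γ₀ 1 1 * d₀)
    {x : SL(2, ℤ) ⧸ CongruenceSubgroup.Gamma0 (p * N)} (hx : x ≠ (γ⁻¹ : SL(2, ℤ))) :
    Good p (p * N) (actW γ⁻¹ (θW hM) - conjW (θW hM) x : wring) ∧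
      actW γ⁻¹ (θW hM) - conjW (θW hM) x ≠ 0 := by
  induction x using QuotientGroup.induction_on with
  | H ε =>
    obtain ⟨δ, rfl⟩ : ∃ δ : SL(2, ℤ), ε = δ⁻¹ := ⟨ε⁻¹, (inv_inv ε).symm⟩
    obtain ⟨δ₀, a, d, b, ha, hd, had, -, k00, k01, k10, k11⟩ := exists_hermite hM δ
    have hne : a = a₀ → ¬ (d : ℤ) ∣ b := by
      rintro rfl ⟨k, rfl⟩
      obtain rfl : d = d₀ := Nat.eq_of_mul_eq_mul_left ha (had.trans h₀.symm)
      refine hx (QuotientGroup.eq.2 ?_)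
      rw [inv_inv, CongruenceSubgroup.Gamma0_mem, ZMod.intCast_zmod_eq_zero_iff_dvd, ← had]
      refine ⟨γ₀ 1 1 * δ₀ 1 0 - δ₀ 1 1 * γ₀ 1 0 - k * δ₀ 1 0 * γ₀ 1 0, ?_⟩
      rw [SL2_mul_apply, (SL2_inv_apply γ).1, (SL2_inv_apply γ).2.2.1, h10, h11, k10, k11]
      push_cast
      ring
    have key := good_jfun_sub hpN ha₀ hd₀ ha hd h₀ had b hne
    have e : (actW γ⁻¹ (θW hM) - conjW (θW hM) ((δ⁻¹ : SL(2, ℤ)) :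
        SL(2, ℤ) ⧸ CongruenceSubgroup.Gamma0 (p * N)) : wring) =
        (fun τ => jfun (aff (a₀ / d₀) 0 τ) - jfun (aff (a / d) (b / d) τ) : ℍ → ℂ) := by
      rw [conjW_mk (invW_θW hM)]
      funext τ
      have e1 := jfun_aff_smul hM ha₀ hd₀ h00 (b := 0) (by rw [h01]; ring) h10
        (by rw [h11]; ring) τ
      have e2 := jfun_aff_smul hM ha hd k00 k01 k10 k11 τ
      have e3 : ∀ γ : SL(2, ℤ), (actW γ⁻¹ (θW hM) : ℍ → ℂ) τ =
          jfun (aff (p * N : ℕ) 0 (γ • τ)) := fun γ => by rw [actW_apply, inv_inv]; rfl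
      simp only [Int.cast_zero, zero_div] at e1
      change (actW γ⁻¹ (θW hM) : ℍ → ℂ) τ - (actW δ⁻¹ (θW hM) : ℍ → ℂ) τ = _
      rw [e3, e3, e1, e2]
    refine ⟨e ▸ key.1, fun h => key.2 ?_⟩
    rw [← e, h]
    rfl

/-- Cusp widths of Γ₀(M) divide M: the lower left entry of γ T^M γ⁻¹ is -M γ₁₀². -/
theorem actW_mem_lringW_top {M : ℕ} (hM : 0 < M) {u : wring} (hu : InvW M u) (γ : SL(2, ℤ)) :
    actW γ⁻¹ u ∈ lringW M ⊤ := by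
  refine exists_lexp_of_mem_wring hM (actW γ⁻¹ u).2 fun τ => ?_
  have h := hu (γ * ModularGroup.T ^ (M : ℤ) * γ⁻¹) (by
    rw [CongruenceSubgroup.Gamma0_mem, ZMod.intCast_zmod_eq_zero_iff_dvd]
    refine ⟨-(γ 1 0) ^ 2, ?_⟩
    rw [SL2_mul_apply, SL2_mul_apply, SL2_mul_apply, (SL2_inv_apply γ).1, (SL2_inv_apply γ).2.2.1,
      ModularGroup.coe_T_zpow]
    simp only [Matrix.of_apply, Matrix.cons_val', Matrix.cons_val_zero, Matrix.cons_val_one,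
      Matrix.cons_val_fin_one]
    ring) (γ • τ)
  have e : (ModularGroup.T ^ (M : ℤ) : SL(2, ℤ)) • τ = aff 1 M τ := by
    rw [T_smul_eq_aff]; simp
  rw [mul_smul, inv_smul_smul, mul_smul, e] at h
  rw [← inv_inv γ] at h
  exact h

/-- The functions whose expansions have bounded denominators at `p`. -/
def bddRing (p : ℕ) [Fact p.Prime] (M : ℕ) : Subring (ℍ → ℂ) where
  carrier := {u | ∃ s : ℕ, (p : ℂ) ^ s • u ∈ lring M (pint p)}
  mul_mem' := by
    rintro u v ⟨s, hs⟩ ⟨t, ht⟩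
    refine ⟨s + t, ?_⟩
    have := mul_mem hs ht
    rwa [smul_mul_smul_comm, ← pow_add] at this
  one_mem' := ⟨0, by simp⟩
  add_mem' := by
    rintro u v ⟨s, hs⟩ ⟨t, ht⟩
    refine ⟨s + t, ?_⟩
    have h1 := smul_mem_lring (c := (p : ℂ) ^ t) (pow_mem (natCast_mem _ p) t) hs
    have h2 := smul_mem_lring (c := (p : ℂ) ^ s) (pow_mem (natCast_mem _ p) s) ht
    rw [smul_smul, ← pow_add] at h1 h2
    rw [smul_add, add_comm s t]
    exact add_mem h1 (by rwa [add_comm] at h2)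
  zero_mem' := ⟨0, by simp⟩
  neg_mem' := by
    rintro u ⟨s, hs⟩
    exact ⟨s, by simpa using neg_mem hs⟩

theorem evalJ_mem_bddRing {p : ℕ} [Fact p.Prime] {M : ℕ} (hM : 0 < M) (Q : Polynomial ℚ) :
    (evalJ Q : ℍ → ℂ) ∈ bddRing p M := by
  have h : ∀ c : ℚ, constW (algebraMap ℚ ℂ c) ∈ (bddRing p M).comap wring.subtype := fun c => by
    obtain ⟨s, hs⟩ := exists_pow_mul_ratCast_mem_pint (p := p) c
    refine ⟨s, ((LExp.const M _).smul _).mem_lring ?_⟩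
    rw [← map_mul]
    exact C_mem_coeffIn hs
  have hj : jW ∈ (bddRing p M).comap wring.subtype :=
    ⟨0, by rw [pow_zero, one_smul]; exact jfun_mem_lring hM _⟩
  have : evalJ Q ∈ (bddRing p M).comap wring.subtype := by
    rw [evalJ, Polynomial.coe_eval₂RingHom, Polynomial.eval₂_eq_sum, Polynomial.sum]
    exact sum_mem fun i _ => mul_mem (h _) (pow_mem hj i)
  exact this

/-- For a Hermite form with b = 0 no root of unity enters, and the coefficients of j(a₀τ/d₀) are
integers. -/
theorem θW_conj_mem {M : ℕ} (hM : 0 < M) (A : Subring ℂ) {γ γ₀ : SL(2, ℤ)} {a₀ d₀ : ℕ}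
    (ha₀ : 0 < a₀) (hd₀ : 0 < d₀) (h₀ : a₀ * d₀ = M)
    (h00 : M * γ 0 0 = γ₀ 0 0 * a₀) (h01 : M * γ 0 1 = γ₀ 0 1 * d₀)
    (h10 : γ 1 0 = γ₀ 1 0 * a₀) (h11 : γ 1 1 = γ₀ 1 1 * d₀) :
    (actW γ⁻¹ (θW hM) : ℍ → ℂ) ∈ lring M A := by
  have e : (actW γ⁻¹ (θW hM) : ℍ → ℂ) = fun τ => jfun (aff (a₀ / d₀) ((0 : ℤ) / d₀) τ) := by
    funext τ
    have e1 := jfun_aff_smul hM ha₀ hd₀ h00 (b := 0) (by rw [h01]; ring) h10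
      (by rw [h11]; ring) τ
    rw [← e1, actW_apply, inv_inv]
    rfl
  obtain ⟨J, -, hJ⟩ := exists_lexp_jfun
  have h := lexp_jfun_aff hJ ha₀ hd₀ 0 (ω := 1) (by simp)
  rw [e]
  rw [h₀] at h
  refine h.mem_lring (mul_mem (C_mem_coeffIn ?_) (expand_mem_coeffIn _ (rescale_mem_coeffIn ?_
    (map_mem_coeffIn _ (fun x => ?_) J)))) <;> simp

/-- Conjugates of rational functions on `Γ₀(pN)` at which `j(pNτ)` becomes `j(aτ/d)` have
rational expansions with bounded denominators at `p`. -/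
theorem conj_rat_and_bdd {p : ℕ} [hp : Fact p.Prime] {N : ℕ} (hpN : ¬ p ∣ N) (hM : 0 < p * N)
    {g : wring} (hg : InvW (p * N) g) (hgr : g ∈ lringW (p * N) ratRing)
    {γ γ₀ : SL(2, ℤ)} {a₀ d₀ : ℕ} (ha₀ : 0 < a₀) (hd₀ : 0 < d₀) (h₀ : a₀ * d₀ = p * N)
    (h00 : (p * N : ℕ) * γ 0 0 = γ₀ 0 0 * a₀) (h01 : (p * N : ℕ) * γ 0 1 = γ₀ 0 1 * d₀)
    (h10 : γ 1 0 = γ₀ 1 0 * a₀) (h11 : γ 1 1 = γ₀ 1 1 * d₀) :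
    (actW γ⁻¹ g : ℍ → ℂ) ∈ lring (p * N) ratRing ∧ (actW γ⁻¹ g : ℍ → ℂ) ∈ bddRing p (p * N) := by
  classical
  have : NeZero (p * N) := ⟨hM.ne'⟩
  have hθ := invW_θW hM
  have hθ1 : actW (1 : SL(2, ℤ))⁻¹ (θW hM) = θW hM := actW_eq_of_mem hθ (inv_mem (one_mem _))
  have hne : ∀ x : SL(2, ℤ) ⧸ CongruenceSubgroup.Gamma0 (p * N), x ≠ (1 : SL(2, ℤ)) →
      conjW (θW hM) x ≠ θW hM := by
    intro x hx h
    refine (good_conj_sub hpN hM (γ := 1) (γ₀ := 1) (a₀ := p * N) (d₀ := 1) hM one_pos (by simp)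
      (by simp) (by simp) (by simp) (by simp) (x := x) (by simpa using hx)).2 ?_
    rw [hθ1, h, sub_self]
  have hθr : θW hM ∈ lringW (p * N) ratRing := by
    have := θW_conj_mem hM ratRing (γ := 1) (γ₀ := 1) (a₀ := p * N) (d₀ := 1) hM one_pos (by simp)
      (by simp) (by simp) (by simp) (by simp)
    rwa [hθ1] at this
  obtain ⟨B, F, hBF⟩ := exists_rat_interp hM hθ hg hθr hgr hne
  obtain ⟨h1, h2⟩ := hBF (γ⁻¹ : SL(2, ℤ))
  rw [conjW_mk hθ] at h1 h2
  rw [conjW_mk hg] at h1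
  have hval : ∀ (B : Polynomial (Polynomial ℚ)) (S : Subring (ℍ → ℂ)),
      (∀ Q, (evalJ Q : ℍ → ℂ) ∈ S) → (actW γ⁻¹ (θW hM) : ℍ → ℂ) ∈ S →
      (((B.map evalJ).eval (actW γ⁻¹ (θW hM)) : wring) : ℍ → ℂ) ∈ S := by
    intro B S hQ hS
    have : (B.map evalJ).eval (actW γ⁻¹ (θW hM)) ∈ S.comap wring.subtype := by
      rw [Polynomial.eval_map, Polynomial.eval₂_eq_sum, Polynomial.sum]
      exact sum_mem fun i _ => mul_mem (hQ _) (pow_mem (show _ ∈ S.comap wring.subtype from hS) i)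
    exact this
  have hprod : ((diffW (θW hM) ((γ⁻¹ : SL(2, ℤ)) :
      SL(2, ℤ) ⧸ CongruenceSubgroup.Gamma0 (p * N)) : wring) : ℍ → ℂ) =
      ∏ x ∈ Finset.univ.erase ((γ⁻¹ : SL(2, ℤ)) :
        SL(2, ℤ) ⧸ CongruenceSubgroup.Gamma0 (p * N)),
        ((actW γ⁻¹ (θW hM) - conjW (θW hM) x : wring) : ℍ → ℂ) := by
    rw [diffW, nodalErase, Lagrange.eval_nodal, conjW_mk hθ]
    exact map_prod wring.subtype _ _
  have hfac := fun x (hx : x ∈ Finset.univ.erase ((γ⁻¹ : SL(2, ℤ)) :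
      SL(2, ℤ) ⧸ CongruenceSubgroup.Gamma0 (p * N))) =>
    good_conj_sub hpN hM ha₀ hd₀ h₀ h00 h01 h10 h11 (Finset.ne_of_mem_erase hx)
  have hgood : Good p (p * N) (diffW (θW hM) ((γ⁻¹ : SL(2, ℤ)) :
      SL(2, ℤ) ⧸ CongruenceSubgroup.Gamma0 (p * N)) : wring) := by
    rw [hprod]
    exact Good.prod _ fun x hx => (hfac x hx).1
  have hdiff0 : ((diffW (θW hM) ((γ⁻¹ : SL(2, ℤ)) :
      SL(2, ℤ) ⧸ CongruenceSubgroup.Gamma0 (p * N)) : wring) : ℍ → ℂ) ≠ 0 := by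
    intro h
    have h' : diffW (θW hM) ((γ⁻¹ : SL(2, ℤ)) :
      SL(2, ℤ) ⧸ CongruenceSubgroup.Gamma0 (p * N)) = 0 := Subtype.ext h
    rw [diffW, nodalErase, Lagrange.eval_nodal, conjW_mk hθ, Finset.prod_eq_zero_iff] at h'
    obtain ⟨x, hx, h0⟩ := h'
    exact (hfac x hx).2 h0
  have htop : (actW γ⁻¹ g : ℍ → ℂ) ∈ lring (p * N) ⊤ := actW_mem_lringW_top hM hg γ
  have h1' : ((diffW (θW hM) ((γ⁻¹ : SL(2, ℤ)) :
      SL(2, ℤ) ⧸ CongruenceSubgroup.Gamma0 (p * N)) : wring) : ℍ → ℂ) * (actW γ⁻¹ g : ℍ → ℂ) =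
      ((B.map evalJ).eval (actW γ⁻¹ (θW hM)) : wring) := by
    rw [← h1, mul_comm]
    rfl
  constructor
  · refine mem_lring_rat_of_mul_mem hM hdiff0 ?_ htop ?_
    · rw [h2]
      exact hval F _ (evalJ_mem hM) (θW_conj_mem hM _ ha₀ hd₀ h₀ h00 h01 h10 h11)
    · rw [h1']
      exact hval B _ (evalJ_mem hM) (θW_conj_mem hM _ ha₀ hd₀ h₀ h00 h01 h10 h11)
  · refine hgood.cancel _ htop ?_
    rw [h1']
    exact hval B (bddRing p (p * N)) (evalJ_mem_bddRing hM)
      ⟨0, by simpa using θW_conj_mem hM _ ha₀ hd₀ h₀ h00 h01 h10 h11⟩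

end Moonshine

end


/-! ### The function f|U_p^β: eigenvalues, growth at the cusps, invariance under Γ₀(pnh). -/

noncomputable section

namespace Moonshine

/-! ### Iterates of `U_p` and their eigenvalues -/

theorem sum_range_mul_eq (F : ℕ → ℂ) (P p : ℕ) :
    ∑ k ∈ Finset.range (P * p), F k =
      ∑ k ∈ Finset.range P, ∑ ν ∈ Finset.range p, F (ν + p * k) := by
  induction P with
  | zero => simp
  | succ P ih =>
    rw [Finset.sum_range_succ, ← ih, add_mul, one_mul, Finset.sum_range_add]
    congr 1
    exact Finset.sum_congr rfl fun ν _ => by congr 1; ring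

theorem Up_apply (p : ℕ) [hp : Fact p.Prime] (f : ℍ → ℂ) (τ : ℍ) :
    Up p f τ = (1 / (p : ℂ)) * ∑ ν ∈ Finset.range p, f (aff (1 / p) (ν / p) τ) := by
  have h0 : (0 : ℝ) < p := by exact_mod_cast hp.out.pos
  rw [Up]
  congr 1
  refine Finset.sum_congr rfl fun ν _ => congrArg f ?_
  ext
  rw [coe_aff (by positivity)]
  simp only [Complex.ofReal_div, Complex.ofReal_one, Complex.ofReal_natCast]
  ring

theorem Up_iterate (p : ℕ) [hp : Fact p.Prime] (f : ℍ → ℂ) (β : ℕ) (τ : ℍ) :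
    (Up p)^[β] f τ = (1 / ((p ^ β : ℕ) : ℂ)) *
      ∑ k ∈ Finset.range (p ^ β), f (aff (1 / (p ^ β : ℕ)) (k / (p ^ β : ℕ)) τ) := by
  have h0 : (0 : ℝ) < p := by exact_mod_cast hp.out.pos
  induction β generalizing τ with
  | zero =>
    have : aff 1 0 τ = τ := by ext; rw [coe_aff one_pos]; simp
    simp [this]
  | succ β ih =>
    rw [Function.iterate_succ_apply', Up_apply, pow_succ, sum_range_mul_eq, Finset.sum_comm]
    simp only [ih]
    rw [← Finset.mul_sum, ← mul_assoc]
    congr 1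
    · push_cast; field_simp
    refine Finset.sum_congr rfl fun ν _ => Finset.sum_congr rfl fun k _ => congrArg f ?_
    have hP : (0 : ℝ) < (p ^ β : ℕ) := by exact_mod_cast pow_pos hp.out.pos β
    rw [aff_aff (by positivity) (by positivity)]
    congr 1
    · push_cast; field_simp
    · push_cast; field_simp

/-- The translation `[1, t; 0, 1]`. -/
def trSL (t : ℝ) : SL(2, ℝ) := ⟨!![1, t; 0, 1], by simp [Matrix.det_fin_two]⟩

theorem trSL_smul (t : ℝ) (τ : ℍ) : trSL t • τ = aff 1 t τ := by
  ext
  rw [coe_smul, coe_aff one_pos, dn]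
  simp [trSL]

theorem diagSL_smul {P : ℕ} (hP : 0 < P) (τ : ℍ) : diagSL hP • τ = aff (1 / P) 0 τ := by
  have h1 : (0 : ℝ) < √(P : ℝ) := Real.sqrt_pos.2 (by exact_mod_cast hP)
  have h2 : ((√(P : ℝ) : ℝ) : ℂ) ^ 2 = P := by
    exact_mod_cast Real.sq_sqrt (by positivity : (0 : ℝ) ≤ P)
  have h3 : ((√(P : ℝ) : ℝ) : ℂ) ≠ 0 := by exact_mod_cast h1.ne'
  ext
  rw [coe_smul, coe_aff (by positivity), dn]
  simp [diagSL]
  rw [← h2]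
  field_simp

theorem diagSL_trSL_smul {P : ℕ} (hP : 0 < P) (k : ℝ) (τ : ℍ) :
    diagSL hP • trSL k • τ = aff (1 / P) (k / P) τ := by
  rw [trSL_smul, diagSL_smul, aff_aff (by positivity) one_pos]
  congr 1 <;> ring

theorem conjDiag_smul_diagSL {P : ℕ} (hP : 0 < P) (γ : SL(2, ℝ)) (τ : ℍ) :
    conjDiag hP γ • diagSL hP • τ = diagSL hP • γ • τ := by
  change (diagSL hP * γ * (diagSL hP)⁻¹) • diagSL hP • τ = _
  rw [mul_smul, inv_smul_smul, mul_smul]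

/-- Multiples of p are nilpotent modulo p^β. -/
theorem isUnit_add_of_dvd {p β : ℕ} {x y z : ZMod (p ^ β)} (hx : IsUnit x) :
    IsUnit (x + y * ((p : ZMod (p ^ β)) * z)) := by
  have h : IsNilpotent (y * ((p : ZMod (p ^ β)) * z)) := by
    refine ⟨β, ?_⟩
    rw [mul_pow, mul_pow]
    have : (p : ZMod (p ^ β)) ^ β = 0 := by exact_mod_cast ZMod.natCast_self (p ^ β)
    rw [this]; ring
  exact h.isUnit_add_left_of_commute hx (Commute.all _ _)

theorem sum_range_eq_sum_zmod {P : ℕ} [NeZero P] (F : ℕ → ℂ) :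
    ∑ k ∈ Finset.range P, F k = ∑ k : ZMod P, F k.val := by
  cases P with
  | zero => exact absurd rfl (NeZero.ne 0)
  | succ P => exact Finset.sum_range F

/-- The permutation of the summands of `U_p^β` induced by a matrix `[a, *; pc, d]`. -/
theorem exists_perm_residues {p β : ℕ} [NeZero (p ^ β)] {a c d r : ℤ}
    (h : ((p ^ β : ℕ) : ℤ) ∣ a * d * r - 1) :
    ∃ σ : Equiv.Perm (ZMod (p ^ β)), ∀ k, ((p ^ β : ℕ) : ℤ) ∣
      (k.val : ℤ) * d - ((σ k).val : ℤ) * (a + k.val * (p * c)) := by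
  have h' : (a : ZMod (p ^ β)) * d * r = 1 := by
    rw [← ZMod.intCast_zmod_eq_zero_iff_dvd] at h
    push_cast at h
    exact sub_eq_zero.1 h
  have ha : IsUnit (a : ZMod (p ^ β)) := IsUnit.of_mul_eq_one (d * r) (by rw [← h']; ring)
  have hd : IsUnit (d : ZMod (p ^ β)) := IsUnit.of_mul_eq_one (a * r) (by rw [← h']; ring)
  have hu : ∀ k : ZMod (p ^ β), IsUnit (a + k * (p * c) : ZMod (p ^ β)) := fun k =>
    isUnit_add_of_dvd ha
  -- k ↦ kd/(a + kpc) is a Möbius map on residues. Solved for k, its equation reads k(d - σ₀(k)pc) =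
  -- σ₀(k)a with a unit as coefficient, hence injectivity.
  let σ₀ : ZMod (p ^ β) → ZMod (p ^ β) := fun k => k * d * ((hu k).unit⁻¹ : (ZMod (p ^ β))ˣ)
  have hσ₀ : ∀ k, k * d = σ₀ k * (a + k * (p * c)) := fun k => by
    have := (hu k).val_inv_mul
    simp only [σ₀]
    rw [mul_assoc, this, mul_one]
  have hinj : Function.Injective σ₀ := fun k l hkl => by
    have h1 := hσ₀ k
    have h2 := hσ₀ l
    rw [hkl] at h1
    have h3 : IsUnit (d + (-σ₀ l) * (p * c) : ZMod (p ^ β)) := isUnit_add_of_dvd hd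
    refine h3.mul_right_cancel ?_
    linear_combination h1 - h2
  refine ⟨Equiv.ofBijective σ₀ (Finite.injective_iff_bijective.1 hinj), fun k => ?_⟩
  rw [← ZMod.intCast_zmod_eq_zero_iff_dvd]
  push_cast
  rw [ZMod.natCast_zmod_val, ZMod.natCast_zmod_val]
  exact sub_eq_zero.2 (hσ₀ k)

/-- The commutator of an element of level `n|h` with a translation, conjugated to level
`p^α n|h`. -/
theorem conjDiag_commutator_mem {h e m p α β : ℕ} (hh : 0 < h) (he : 0 < e) (hp : 0 < p)
    (hα : α ≤ β + 1) {w : SL(2, ℝ)} {a b c d : ℤ}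
    (hdet : a * d * e - (p ^ β : ℕ) * b * (p * c) * m = 1)
    (hw : (w : Matrix (Fin 2) (Fin 2) ℝ) = wM h e m a ((p ^ β : ℕ) * b) (p * c) d) {k k' t : ℤ}
    (hk : k * d - k' * (a + k * (p * (c * h * m))) = (p ^ β : ℕ) * t) :
    conjDiag (pow_pos hp β) (w⁻¹ * (trSL k * w * trSL (-k'))) ∈
      Gamma0R (p ^ α * (h * e * m) * h) := by
  have h1 : (0 : ℝ) < √(e : ℝ) := Real.sqrt_pos.2 (by exact_mod_cast he)
  have h2 : √(e : ℝ) ^ 2 = e := Real.sq_sqrt (by positivity)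
  have h3 : (h : ℝ) ≠ 0 := by positivity
  have hp0 : (p : ℝ) ≠ 0 := by positivity
  have hpow : (p : ℝ) ^ (β + 1 - α) * (p : ℝ) ^ α = p ^ β * p := by
    rw [← pow_add, ← pow_succ]; congr 1; omega
  have hpowZ : (p : ℤ) ^ (β + 1 - α) * (p : ℤ) ^ α = p ^ β * p := by
    rw [← pow_add, ← pow_succ]; congr 1; omega
  have hdetR : (a : ℝ) * d * e - p ^ β * b * (p * c) * m = 1 := by exact_mod_cast hdet
  have hkR : (k : ℝ) * d - k' * (a + k * (p * (c * h * m))) = p ^ β * t := by exact_mod_cast hk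
  have hm : ((w⁻¹ * (trSL k * w * trSL (-k')) : SL(2, ℝ)) : Matrix (Fin 2) (Fin 2) ℝ) =
      !![1 + (k : ℝ) * c * p * h * m * d * e, p ^ β * (d * e * t + k' * b * (p * c) * m);
        -(k * c ^ 2 * p ^ 2 * h ^ 2 * m ^ 2 * e),
        1 - k * c * p * h * m * d * e + k' * k * c ^ 2 * p ^ 2 * h ^ 2 * m ^ 2 * e] := by
    rw [Matrix.SpecialLinearGroup.coe_mul, Matrix.SpecialLinearGroup.coe_mul,
      Matrix.SpecialLinearGroup.coe_mul, Matrix.SpecialLinearGroup.coe_inv, hw]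
    simp only [wM, trSL, Matrix.adjugate_fin_two_of]
    generalize √(e : ℝ) = s at *
    rw [← h2] at hdetR ⊢
    push_cast
    ext i j
    fin_cases i <;> fin_cases j <;>
      simp [Matrix.mul_apply, Fin.sum_univ_two] <;> field_simp
    · linear_combination hdetR
    · linear_combination (d * s ^ 2 * h) * hkR
    · ring
    · linear_combination hdetR
  refine mem_Gamma0R_iff.2 ⟨1 + k * c * p * h * m * d * e, d * e * t + k' * b * (p * c) * m,
    -(k * c ^ 2 * p ^ (β + 1 - α) * p * m), 1 - k * c * p * h * m * d * e +
      k' * k * c ^ 2 * p ^ 2 * h ^ 2 * m ^ 2 * e, ?_, ?_⟩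
  · push_cast at hdet hk ⊢
    linear_combination (k * c ^ 2 * p * m ^ 2 * h ^ 2 * e * (d * e * t + k' * b * (p * c) * m)) *
      hpowZ - (k * c ^ 2 * p ^ 2 * m ^ 2 * h ^ 2 * e * d * e) * hk -
      (k' * k * c ^ 2 * p ^ 2 * m ^ 2 * h ^ 2 * e) * hdet
  · rw [coe_conjDiag, hm]
    push_cast
    ext i j
    fin_cases i <;> fin_cases j <;> simp
    · field_simp
    · linear_combination (-(k * c ^ 2 * p * m ^ 2 * h ^ 2 * e) : ℝ) * hpow

/-- If `f` is an eigenfunction of the conjugate of `w` by `diag(1, p^β)` then `f|U_p^β` is an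
eigenfunction of `w` with the same eigenvalue. -/
theorem Up_iterate_smul {h e m p α β : ℕ} [hp : Fact p.Prime] (hh : 0 < h) (he : 0 < e)
    (hα : α ≤ β + 1) {f : ℍ → ℂ}
    (hf : ∀ δ ∈ Gamma0R (p ^ α * (h * e * m) * h), ∀ τ, f (δ • τ) = f τ) {w : SL(2, ℝ)}
    {a b c d : ℤ} (hdet : a * d * e - (p ^ β : ℕ) * b * (p * c) * m = 1)
    (hw : (w : Matrix (Fin 2) (Fin 2) ℝ) = wM h e m a ((p ^ β : ℕ) * b) (p * c) d) {x : ℂ}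
    (hx : ∀ τ, f (conjDiag (pow_pos hp.out.pos β) w • τ) = x * f τ) (τ : ℍ) :
    (Up p)^[β] f (w • τ) = x * (Up p)^[β] f τ := by
  have hP := pow_pos hp.out.pos β
  have : NeZero (p ^ β) := ⟨hP.ne'⟩
  obtain ⟨σ, hσ⟩ := exists_perm_residues (p := p) (β := β) (a := a) (d := d) (r := e)
    (c := c * h * m) ⟨b * (p * c) * m, by linear_combination hdet⟩
  rw [Up_iterate, Up_iterate, mul_left_comm]
  congr 1
  rw [Finset.mul_sum, sum_range_eq_sum_zmod, sum_range_eq_sum_zmod]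
  -- T^k w equals w times an element whose conjugate lies in Γ₀(p^α nh), times T^(σ(k)). So the k-th
  -- summand at wτ is x times the σ(k)-th summand at τ.
  refine Fintype.sum_equiv σ _ _ fun k => ?_
  obtain ⟨t, ht⟩ := hσ k
  have := conjDiag_commutator_mem hh he hp.out.pos hα hdet hw ht
  rw [← hf _ this (aff _ _ τ), ← hx, ← diagSL_trSL_smul hP, ← diagSL_trSL_smul hP, conjDiag_smul_diagSL,
    conjDiag_smul_diagSL]
  simp only [smul_smul]
  congr 3
  have e1 : trSL (-((σ k).val : ℝ)) * trSL ((σ k).val : ℝ) = 1 := by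
    ext i j
    rw [Matrix.SpecialLinearGroup.coe_mul]
    fin_cases i <;> fin_cases j <;> simp [trSL]
  simp only [mul_assoc, mul_inv_cancel_left, e1, mul_one, Int.cast_natCast]

end Moonshine

end


noncomputable section

namespace Moonshine

/-! ### Behaviour of `f|U_p^β` at the cusps -/

/-- τ/P = -1/(P·(-1/τ)). Division by P is thus multiplication by P between two inversions, to which
Hermite forms apply. -/
theorem aff_inv_eq {P : ℕ} (hP : 0 < P) (τ : ℍ) : aff (1 / P) 0 τ =
    mkSL 0 1 (-1) 0 (by norm_num) • aff P 0 (mkSL 0 (-1) 1 0 (by norm_num) • τ) := by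
  have h0 : (P : ℂ) ≠ 0 := by exact_mod_cast hP.ne'
  have h1 : (τ : ℂ) ≠ 0 := τ.ne_zero
  ext
  rw [← intCast_smul, ← intCast_smul, coe_smul, coe_aff (by positivity), dn,
    coe_aff (by positivity), coe_smul, dn]
  simp
  field_simp

theorem comp_aff_mem_wring {u : ℍ → ℂ} (hu : u ∈ wring) {P : ℕ} (hP : 0 < P) (k : ℤ) :
    (fun τ => u (aff (1 / P) (k / P) τ)) ∈ wring := by
  refine ⟨mdiff_comp_aff hu.1 (by positivity) _, fun γ => ?_⟩
  have key : ∀ τ, aff (1 / P) (k / P) (γ • τ) = mkSL 0 1 (-1) 0 (by norm_num) • aff P 0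
      ((mkSL 0 (-1) 1 0 (by norm_num) * (ModularGroup.T ^ k * γ) : SL(2, ℤ)) • τ) := fun τ => by
    rw [mul_smul, ← aff_inv_eq hP, mul_smul, T_smul_eq_aff, aff_aff (by positivity) one_pos]
    congr 1 <;> ring
  obtain ⟨γ₀, a, d, b, ha, hd, -, -, h00, h01, h10, h11⟩ := exists_hermite hP
    (mkSL 0 (-1) 1 0 (by norm_num) * (ModularGroup.T ^ k * γ))
  simp only [key, (aff_smul_of_hermite hP ha hd h00 h01 h10 h11 _).1, ← mul_smul]
  obtain ⟨C, hC⟩ := hu.2 (mkSL 0 1 (-1) 0 (by norm_num) * γ₀)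
  exact ⟨_, isBigO_exp_comp_aff hC (by positivity) _⟩

theorem Up_iterate_mem_wring {p : ℕ} [hp : Fact p.Prime] {f : ℍ → ℂ} (hf : f ∈ wring) (β : ℕ) :
    (Up p)^[β] f ∈ wring := by
  have : (Up p)^[β] f = (fun _ => (1 / ((p ^ β : ℕ) : ℂ))) * ∑ k ∈ Finset.range (p ^ β),
      fun τ => f (aff (1 / (p ^ β : ℕ)) ((k : ℤ) / (p ^ β : ℕ)) τ) := by
    funext τ
    rw [Up_iterate, Pi.mul_apply, Finset.sum_apply]
    simp only [Int.cast_natCast]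
  rw [this]
  exact mul_mem (const_mem_wring _) (sum_mem fun k _ => comp_aff_mem_wring hf (pow_pos hp.out.pos β) _)

theorem HasRatQExpansion.lexp {g : ℍ → ℂ} {F : PowerSeries ℚ} (h : HasRatQExpansion g F) :
    LExp 1 g 0 (F.map (algebraMap ℚ ℂ)) := by
  intro τ
  have := h τ
  rw [pow_zero, one_mul, HasEval]
  refine this.congr_fun fun m => ?_
  simp [Function.Periodic.qParam]

theorem LExp.periodic {u : ℍ → ℂ} {r : ℕ} {P : PowerSeries ℂ} (h : LExp 1 u r P) (k : ℤ) (τ : ℍ) :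
    u (aff 1 k τ) = u τ := by
  have e : Function.Periodic.qParam ((1 : ℕ) : ℝ) (aff 1 k τ) =
      Function.Periodic.qParam ((1 : ℕ) : ℝ) τ := by
    rw [coe_aff one_pos]
    simp only [Function.Periodic.qParam]
    rw [Complex.exp_eq_exp_iff_exists_int]
    exact ⟨k, by push_cast; ring⟩
  have h1 := h (aff 1 k τ)
  rw [e] at h1
  have h2 := h1.unique (h τ)
  exact mul_left_cancel₀ (pow_ne_zero _ (Complex.exp_ne_zero _)) h2

theorem exists_dvd_sub_mul {p β : ℕ} (hp : p.Prime) {x : ℤ} (hx : ¬ (p : ℤ) ∣ x) (y : ℤ) :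
    ∃ b z : ℤ, y = x * b + (p ^ β : ℕ) * z := by
  have : IsCoprime x (p ^ β : ℕ) := by
    push_cast
    exact ((Nat.prime_iff_prime_int.1 hp).coprime_iff_not_dvd.2 hx).symm.pow_right
  obtain ⟨u, v, huv⟩ := this
  exact ⟨u * y, v * y, by linear_combination (-y) * huv⟩

/-- The terms of `f|U_p^β` at the cusps `γ∞` whose denominator is divisible by `p`. -/
theorem exists_aff_smul {p β : ℕ} (hp : p.Prime) {γ : SL(2, ℤ)} (hγ : (p : ℤ) ∣ γ 1 0) (k : ℤ) :
    ∃ (δ : SL(2, ℤ)) (b : ℤ), δ 0 0 = γ 0 0 + k * γ 1 0 ∧ δ 1 0 = (p ^ β : ℕ) * γ 1 0 ∧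
      ∀ τ, aff (1 / (p ^ β : ℕ)) (k / (p ^ β : ℕ)) (γ • τ) =
        δ • aff (1 / (p ^ β : ℕ)) (b / (p ^ β : ℕ)) τ := by
  have hdet := γ.det_coe
  rw [Matrix.det_fin_two] at hdet
  have hP : (0 : ℝ) < (p ^ β : ℕ) := by exact_mod_cast pow_pos hp.pos β
  have hx : ¬ (p : ℤ) ∣ γ 0 0 + k * γ 1 0 := fun h => by
    have h1 : (p : ℤ) ∣ γ 0 0 := (dvd_add_left (hγ.mul_left k)).1 h
    have h2 : (p : ℤ) ∣ 1 := hdet ▸ dvd_sub (h1.mul_right _) (hγ.mul_left _)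
    exact hp.one_lt.ne' (by exact_mod_cast Int.eq_one_of_dvd_one (by positivity) h2)
  -- b is the translation that makes the upper right entry of T^k γ T^(-b) divisible by p^β; it
  -- exists as the upper left entry is prime to p.
  obtain ⟨b, y, hy⟩ := exists_dvd_sub_mul (β := β) hp hx (γ 0 1 + k * γ 1 1)
  have hyR : (γ 0 1 : ℝ) + k * γ 1 1 = (γ 0 0 + k * γ 1 0) * b + (p ^ β : ℕ) * y := by
    exact_mod_cast hy
  refine ⟨mkSL (γ 0 0 + k * γ 1 0) y ((p ^ β : ℕ) * γ 1 0) (γ 1 1 - γ 1 0 * b) ?_, b, rfl, rfl,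
    fun τ => ?_⟩
  · linear_combination hdet + γ 1 0 * hy
  · have e : aff (1 / (p ^ β : ℕ)) (k / (p ^ β : ℕ)) (γ • τ) =
        aff (1 / (p ^ β : ℕ)) 0 ((ModularGroup.T ^ k * γ : SL(2, ℤ)) • τ) := by
      rw [mul_smul, T_smul_eq_aff, aff_aff (by positivity) one_pos]
      congr 1 <;> ring
    have hp0 : (p : ℝ) ≠ 0 := by exact_mod_cast hp.ne_zero
    rw [e]
    refine (aff_smul (l := 1) (γ := ((ModularGroup.T ^ k * γ : SL(2, ℤ)) : SL(2, ℝ)))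
      (by positivity) (by positivity) ?_ ?_ ?_ ?_ τ).1 <;>
    simp only [SpecialLinearGroup.map_apply_coe, RingHom.mapMatrix_apply, Matrix.map_apply,
        Int.coe_castRingHom, SL2_mul_apply, mkSL_zero_zero, mkSL_zero_one, mkSL_one_zero,
        mkSL_one_one, ModularGroup.coe_T_zpow] <;> simp
    · field_simp
    · field_simp
      push_cast at hyR ⊢
      linear_combination hyR
    · field_simp
    · field_simp; ring

theorem cross_mul_of_smul_infty_eq {g g' : GL (Fin 2) ℝ}
    (h : g • (OnePoint.infty : OnePoint ℝ) = g' • (OnePoint.infty : OnePoint ℝ)) :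
    g 0 0 * g' 1 0 = g' 0 0 * g 1 0 := by
  rw [OnePoint.smul_infty_eq_ite, OnePoint.smul_infty_eq_ite] at h
  split_ifs at h with h1 h2 h2
  · rw [h1, h2]; ring
  · exact absurd h (OnePoint.infty_ne_coe _)
  · exact absurd h (OnePoint.coe_ne_infty _)
  · have := OnePoint.coe_injective h
    rw [div_eq_div_iff h1 h2] at this
    linarith

theorem smul_eq_aff_of_one_zero {u : SL(2, ℝ)} (hu : u 1 0 = 0) (τ : ℍ) :
    0 < u 0 0 ^ 2 ∧ u • τ = aff (u 0 0 ^ 2) (u 0 0 * u 0 1) τ := by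
  have hdet := u.det_coe
  rw [Matrix.det_fin_two, hu, mul_zero, sub_zero] at hdet
  have h0 : u 0 0 ≠ 0 := fun h => by simp [h] at hdet
  have h1 : u 1 1 ≠ 0 := fun h => by simp [h] at hdet
  have h1' : (u 1 1 : ℂ) ≠ 0 := by exact_mod_cast h1
  have hdet' : (u 0 0 : ℂ) * u 1 1 = 1 := by exact_mod_cast hdet
  refine ⟨by positivity, ?_⟩
  ext
  rw [coe_smul, coe_aff (by positivity), dn, hu, Complex.ofReal_zero, zero_mul, zero_add,
    div_eq_iff h1']
  push_cast
  linear_combination (-(u 0 0 : ℂ) * τ - u 0 1) * hdet'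

/-- A form that is holomorphic away from `∞` is bounded at a cusp `γ∞` not equivalent to `∞`. -/
theorem HolomorphicAwayFromInfty.isBigO {Γ : Subgroup SL(2, ℝ)} {f : ℍ → ℂ}
    (hf : HolomorphicAwayFromInfty Γ 0 f) (γ : SL(2, ℤ))
    (h : ∀ w ∈ Γ, w 0 0 * γ 1 0 ≠ γ 0 0 * w 1 0) :
    (fun τ => f (γ • τ)) =O[atImInfty] (1 : ℍ → ℝ) := by
  have := hf (SpecialLinearGroup.mapGL ℝ γ • OnePoint.infty) (isCusp_SL2Z_iff'.2 ⟨γ, rfl⟩) (fun w hw hc => h w hw ?_)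
    (SpecialLinearGroup.mapGL ℝ γ) rfl
  · have e : (f ∣[(0 : ℤ)] (SpecialLinearGroup.mapGL ℝ γ)) = fun τ => f (γ • τ) := by
      funext τ
      have h0 := slash_SL_apply f 0 γ τ
      rw [neg_zero, zpow_zero, mul_one] at h0
      exact h0
    rw [e] at this
    exact this
  · exact cross_mul_of_smul_infty_eq hc

theorem dvd_of_pow_mul_dvd {p β : ℕ} (hp : p.Prime) {x y : ℤ} (hx : ¬ (p : ℤ) ∣ x)
    (h : ((p ^ β : ℕ) : ℤ) ∣ x * y) : ((p ^ β : ℕ) : ℤ) ∣ y := by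
  refine IsCoprime.dvd_of_dvd_mul_left ?_ h
  push_cast
  exact ((Nat.prime_iff_prime_int.1 hp).coprime_iff_not_dvd.2 hx).pow_left

/-- `f|U_p^β` is bounded at the cusps `γ∞` whose denominator is divisible by `p`. -/
theorem Up_iterate_isBigO {p α β n h : ℕ} [hp : Fact p.Prime] (hpn : ¬ p ∣ n * h)
    (hα : α ≤ β + 1) {Γ : Subgroup SL(2, ℝ)} (hΓ : IsTypeGroup (p ^ α * n) h Γ) {f : ℍ → ℂ}
    (hf : ∀ δ ∈ Gamma0R (p ^ α * n * h), ∀ τ, f (δ • τ) = f τ)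
    (heig : ∀ w ∈ Γ, ∃ x : ℂ, ∀ τ, f (w • τ) = x * f τ)
    (hf_infty : HolomorphicAwayFromInfty Γ 0 f) {F : PowerSeries ℚ}
    (hF : HasRatQExpansion ((Up p)^[β] f) F) {γ : SL(2, ℤ)} (hγ : (p : ℤ) ∣ γ 1 0) :
    (fun τ => (Up p)^[β] f (γ • τ)) =O[atImInfty] (1 : ℍ → ℝ) := by
  have hP := pow_pos hp.out.pos β
  have hPR : (0 : ℝ) < (p ^ β : ℕ) := by exact_mod_cast hP
  have hpZ := Nat.prime_iff_prime_int.1 hp.out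
  choose δ b hδ0 hδ1 hδ using fun k : ℤ => exists_aff_smul (β := β) hp.out hγ k
  -- The summands of f|U_p^β see f at the cusps δ_k∞. If none of them is Γ-equivalent to ∞, every
  -- summand is bounded.
  by_cases hc : ∀ k : ℤ, ∀ w ∈ Γ, w 0 0 * δ k 1 0 ≠ δ k 0 0 * w 1 0
  · have e : (fun τ => (Up p)^[β] f (γ • τ)) = fun τ => (1 / ((p ^ β : ℕ) : ℂ)) *
        ∑ k ∈ Finset.range (p ^ β), f (δ k • aff (1 / (p ^ β : ℕ)) (b k / (p ^ β : ℕ)) τ) := by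
      funext τ
      rw [Up_iterate]
      congr 1
      refine Finset.sum_congr rfl fun k _ => ?_
      rw [← hδ, Int.cast_natCast]
    rw [e]
    refine Asymptotics.IsBigO.const_mul_left (Asymptotics.IsBigO.fun_sum fun k _ => ?_) _
    exact (hf_infty.isBigO (δ k) (hc k)).comp_tendsto (tendsto_aff (by positivity) _)
  -- Otherwise some w ∈ Γ has w∞ = δ_k∞. Such a w is the conjugate by diag(1, p^β) of a matrix w' of
  -- level n|h, of which f|U_p^β is an eigenfunction. Since w'⁻¹ T^k γ fixes ∞, the function at γτ
  -- is a constant times its value at an affine image of τ, and the expansion at ∞ bounds it.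
  · push Not at hc
    obtain ⟨k, w, hw, hcross⟩ := hc
    rw [hδ0, hδ1] at hcross
    have hdet := γ.det_coe
    rw [Matrix.det_fin_two] at hdet
    have hx : ¬ (p : ℤ) ∣ γ 0 0 + k * γ 1 0 := fun h => by
      have h1 : (p : ℤ) ∣ γ 0 0 := (dvd_add_left (hγ.mul_left k)).1 h
      have h2 : (p : ℤ) ∣ 1 := hdet ▸ dvd_sub (h1.mul_right _) (hγ.mul_left _)
      exact hpZ.not_dvd_one h2
    have hh := hΓ.pos_right
    have hn := hΓ.pos_left
    obtain ⟨m₁, hm₁⟩ := hΓ.dvd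
    obtain ⟨-, -, S, hS, rfl⟩ := hΓ
    obtain ⟨e, heS, hwe⟩ := (mem_closure_wCoset_iff hn ⟨m₁, hm₁⟩ hS).1 hw
    have he := hS.exact e heS
    rw [hm₁, Nat.mul_div_cancel_left _ hh] at he
    have he0 : 0 < e := he.pos (Nat.pos_of_ne_zero fun h0 => hn.ne' (by rw [hm₁, h0, mul_zero]))
    obtain ⟨⟨m₀, rfl⟩, hcop⟩ := he
    rw [Nat.mul_div_cancel_left _ he0] at hcop
    rw [hm₁, ← mul_assoc] at hwe
    obtain ⟨a, b', c, d, hd, hwM⟩ := (mem_wCoset_iff hh he0).1 hwe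
    have hs : (0 : ℝ) < √(e : ℝ) := Real.sqrt_pos.2 (by exact_mod_cast he0)
    have h00 : w 0 0 = a * √(e : ℝ) := by rw [hwM]; simp [wM]
    have h10 : w 1 0 = c * h * m₀ * √(e : ℝ) := by rw [hwM]; simp [wM]
    have hcross' : a * ((p ^ β : ℕ) * γ 1 0) = (γ 0 0 + k * γ 1 0) * (c * h * m₀) := by
      rw [h00, h10] at hcross
      have : (a : ℝ) * ((p ^ β : ℕ) * γ 1 0) = (γ 0 0 + k * γ 1 0) * (c * h * m₀) := by
        refine mul_right_cancel₀ hs.ne' ?_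
        push_cast at hcross ⊢
        linear_combination hcross
      exact_mod_cast this
    have hph : ¬ (p : ℤ) ∣ h := fun h' => hpn ((Int.natCast_dvd_natCast.1 h').mul_left n)
    -- The lower left entry of δ_k is p^β γ₁₀ with p ∣ γ₁₀, while its upper left entry is prime to
    -- p. Proportionality of first columns transfers the divisibility to w; the determinant then
    -- excludes p ∣ e.
    have hdvd : ((p ^ (β + 1) : ℕ) : ℤ) ∣ c * m₀ := by
      obtain ⟨z, hz⟩ := hγ
      refine dvd_of_pow_mul_dvd (x := (γ 0 0 + k * γ 1 0) * h) hp.out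
        (fun h' => (hpZ.dvd_or_dvd h').elim hx hph) ⟨a * z, ?_⟩
      rw [hz] at hcross' ⊢
      push_cast at hcross' ⊢
      linear_combination -hcross'
    have hpcm : (p : ℤ) ∣ c * m₀ := dvd_trans ⟨(p ^ β : ℕ), by push_cast; ring⟩ hdvd
    have hpe : ¬ p ∣ e := fun h' => hpZ.not_dvd_one (hd ▸ dvd_sub
      ((Int.natCast_dvd_natCast.2 h').mul_left _) (by
        rw [mul_assoc]; exact hpcm.mul_left _))
    have hpα : p ^ α ∣ m₀ := by
      have h1 : p ^ α ∣ h * e * m₀ := ⟨n, by rw [hm₁]; ring⟩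
      refine Nat.Coprime.dvd_of_dvd_mul_left ?_ h1
      refine Nat.Coprime.pow_left α (Nat.Coprime.mul_right ?_ ?_)
      · exact (hp.out.coprime_iff_not_dvd).2 fun h' => hph (Int.natCast_dvd_natCast.2 h')
      · exact (hp.out.coprime_iff_not_dvd).2 hpe
    obtain ⟨m, rfl⟩ := hpα
    have hnm : n = h * e * m := by
      refine Nat.eq_of_mul_eq_mul_left (pow_pos hp.out.pos α) ?_
      rw [hm₁]; ring
    have hpm : ¬ (p : ℤ) ∣ m := fun h' => hpn (by
      rw [hnm]; exact ((Int.natCast_dvd_natCast.1 h').mul_left _).mul_right _)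
    obtain ⟨c', hc'⟩ : ((p ^ (β + 1) : ℕ) : ℤ) ∣ c * (p ^ α : ℕ) := by
      refine dvd_of_pow_mul_dvd (x := m) hp.out hpm ?_
      convert hdvd using 1
      push_cast; ring
    have hd' : a * d * e - ((p ^ β : ℕ) * b') * (p * c') * m = 1 := by
      push_cast at hd hc' ⊢
      rw [pow_succ] at hc'
      linear_combination hd + b' * m * hc'
    have hc'R : (c : ℝ) * p ^ α = p ^ β * p * c' := by
      rw [← pow_succ]; exact_mod_cast hc'
    obtain ⟨x, hx'⟩ := heig w hw
    have hconj : conjDiag hP (wSL hh he0 hd') = w := by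
      ext i j
      rw [coe_conjDiag, hwM]
      simp only [wSL, wM]
      push_cast
      have hp0 : (p : ℝ) ≠ 0 := by exact_mod_cast hp.out.ne_zero
      fin_cases i <;> fin_cases j <;> simp
      · field_simp
      · linear_combination (-(h : ℝ) * m * √(e : ℝ)) * hc'R
    have hg := Up_iterate_smul (p := p) (α := α) (β := β) hh he0 hα (f := f)
      (by rw [← hnm]; exact hf) (w := wSL hh he0 hd') (b := b') (c := c') (by exact_mod_cast hd')
      rfl (x := x) (by rw [hconj]; exact hx')
    set u : SL(2, ℝ) := (wSL hh he0 hd')⁻¹ * ((ModularGroup.T ^ k * γ : SL(2, ℤ)) : SL(2, ℝ))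
      with hu
    have hu10 : u 1 0 = 0 := by
      have hcR : (a : ℝ) * ((p : ℝ) ^ β * γ 1 0) = (γ 0 0 + k * γ 1 0) * (c * h * (p ^ α * m)) := by
        exact_mod_cast hcross'
      have hp0 : (p : ℝ) ^ β ≠ 0 := by have := hp.out.ne_zero; positivity
      have : (a : ℝ) * γ 1 0 = (γ 0 0 + k * γ 1 0) * (p * c' * h * m) := by
        refine mul_left_cancel₀ hp0 ?_
        linear_combination hcR + (γ 0 0 + k * γ 1 0) * h * m * hc'R
      rw [hu, Matrix.SpecialLinearGroup.coe_mul, Matrix.SpecialLinearGroup.coe_inv]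
      simp only [wSL, wM, Matrix.adjugate_fin_two_of, Matrix.mul_apply, Fin.sum_univ_two,
        SpecialLinearGroup.map_apply_coe, RingHom.mapMatrix_apply, Matrix.map_apply,
        Int.coe_castRingHom, SL2_mul_apply, ModularGroup.coe_T_zpow]
      simp
      linear_combination √(e : ℝ) * this
    have hfin : (fun τ => (Up p)^[β] f (γ • τ)) = fun τ =>
        x * (Up p)^[β] f (aff (u 0 0 ^ 2) (u 0 0 * u 0 1) τ) := by
      funext τ
      rw [← (smul_eq_aff_of_one_zero hu10 τ).2, ← hg, hu, ← mul_smul, mul_inv_cancel_left,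
        intCast_smul, mul_smul, T_smul_eq_aff, hF.lexp.periodic]
    rw [hfin]
    refine Asymptotics.IsBigO.const_mul_left ?_ _
    have hb := hF.lexp.isBigO one_pos
    have h0 : (fun τ : ℍ => Real.exp (2 * Real.pi * (0 : ℕ) / (1 : ℕ) * τ.im)) = (1 : ℍ → ℝ) := by
      funext τ; simp
    rw [h0] at hb
    exact hb.comp_tendsto (tendsto_aff (smul_eq_aff_of_one_zero hu10 I).1 _)

/-- `f|U_p^β` is invariant under `Γ₀(pnh)`. -/
theorem Up_iterate_invariant {p α β n h : ℕ} [hp : Fact p.Prime] (hh : h ∣ n) (hn : 0 < n)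
    (hα : α ≤ β + 1) {f : ℍ → ℂ}
    (hf : ∀ δ ∈ Gamma0R (p ^ α * n * h), ∀ τ, f (δ • τ) = f τ) {F : PowerSeries ℚ}
    (hF : HasRatQExpansion ((Up p)^[β] f) F) {γ : SL(2, ℤ)}
    (hγ : γ ∈ CongruenceSubgroup.Gamma0 (p * (n * h))) (τ : ℍ) :
    (Up p)^[β] f (γ • τ) = (Up p)^[β] f τ := by
  obtain ⟨m, rfl⟩ := hh
  have hh0 : 0 < h := Nat.pos_of_mul_pos_right hn
  have hpZ := Nat.prime_iff_prime_int.1 hp.out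
  have hdet := γ.det_coe
  rw [Matrix.det_fin_two] at hdet
  rw [CongruenceSubgroup.Gamma0_mem, ZMod.intCast_zmod_eq_zero_iff_dvd] at hγ
  obtain ⟨C, hC⟩ := hγ
  have hx : ¬ (p : ℤ) ∣ γ 0 0 := fun h' => hpZ.not_dvd_one (hdet ▸ dvd_sub (h'.mul_right _) (by
    rw [hC]; push_cast; exact ⟨γ 0 1 * (h * m * h * C), by ring⟩))
  -- Write γ = w T^i with upper right entry of w divisible by p^β. The conjugate of w lies in Γ₀(p^α
  -- nh), so w acts trivially, and T^i does because the expansion is in integral powers of q.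
  obtain ⟨i, z, hz⟩ := exists_dvd_sub_mul (β := β) hp.out hx (γ 0 1)
  have hd' : γ 0 0 * (γ 1 1 - γ 1 0 * i) * (1 : ℕ) - ((p ^ β : ℕ) * (z * h)) * (p * (C * h)) * m
      = 1 := by
    push_cast at hC hz ⊢
    linear_combination hdet + γ 1 0 * hz + p ^ β * z * hC
  set w := wSL hh0 one_pos hd' with hw
  have hw' : (w : Matrix (Fin 2) (Fin 2) ℝ) =
      wM h 1 m (γ 0 0) ((p ^ β : ℕ) * (z * h)) (p * (C * h)) (γ 1 1 - γ 1 0 * i) := rfl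
  have hconj : conjDiag (pow_pos hp.out.pos β) w ∈ Gamma0R (p ^ α * (h * m) * h) := by
    refine mem_Gamma0R_iff.2 ⟨γ 0 0, z, p ^ (β + 1 - α) * C, γ 1 1 - γ 1 0 * i, ?_, ?_⟩
    · have hpowZ : (p : ℤ) ^ (β + 1 - α) * (p : ℤ) ^ α = p ^ β * p := by
        rw [← pow_add, ← pow_succ]; congr 1; omega
      push_cast at hd' ⊢
      linear_combination hd' - z * C * h * m * h * hpowZ
    · rw [conjDiag_eq_wM hp.out.pos hα hw']
      have h3 : (h : ℝ) ≠ 0 := by positivity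
      simp only [wM]
      push_cast
      ext i j
      fin_cases i <;> fin_cases j <;> simp
      · field_simp
      · ring
  have hg := Up_iterate_smul (p := p) (α := α) (β := β) hh0 one_pos hα (f := f)
    (by simpa using hf) (by exact_mod_cast hd') hw' (x := 1) (fun τ => by
      rw [hf _ hconj, one_mul]) (aff 1 i τ)
  rw [one_mul, hF.lexp.periodic] at hg
  have hγw : ((γ : SL(2, ℤ)) : SL(2, ℝ)) = w * ((ModularGroup.T ^ i : SL(2, ℤ)) : SL(2, ℝ)) := ?_
  · rw [← hg, ← T_smul_eq_aff, ← intCast_smul (ModularGroup.T ^ i), ← mul_smul, ← intCast_smul γ,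
      hγw]
  ext k l
  rw [Matrix.SpecialLinearGroup.coe_mul, hw']
  have hzR : (γ 0 1 : ℝ) = γ 0 0 * i + p ^ β * z := by exact_mod_cast hz
  have hCR : (γ 1 0 : ℝ) = p * (h * m * h) * C := by exact_mod_cast hC
  have h3 : (h : ℝ) ≠ 0 := by positivity
  simp only [wM, Matrix.mul_apply, Fin.sum_univ_two, SpecialLinearGroup.map_apply_coe,
    RingHom.mapMatrix_apply, Matrix.map_apply, Int.coe_castRingHom, ModularGroup.coe_T_zpow]
  fin_cases k <;> fin_cases l <;> simp
  · rw [hzR]; field_simp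
  · rw [hCR]; ring
  · rw [hCR]; ring

end Moonshine

end


/-! ### The form Ê ≡ 1 modulo p, built from quotients of Δ. -/

noncomputable section

namespace Moonshine

/-! ### The quotients `Δ(sτ)^p / Δ(tτ)` -/

local notation "Δ" => ModularForm.discriminant

local notation "ℤtoℂ" => PowerSeries.map (Int.castRingHom ℂ)

/-- `Δ(sτ)^p / Δ(tτ)`. -/
def deltaQuot (p : ℕ) (s t : ℝ) (τ : ℍ) : ℂ := Δ (aff s 0 τ) ^ p / Δ (aff t 0 τ)

theorem mdiff_deltaQuot (p : ℕ) {s t : ℝ} (hs : 0 < s) (ht : 0 < t) : MDiff (deltaQuot p s t) :=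
  ((mdiff_comp_aff mdiff_discriminant hs 0).pow p).div (mdiff_comp_aff mdiff_discriminant ht 0)
    fun _ => ModularForm.discriminant_ne_zero _

theorem discriminant_isBigO : (Δ : ℍ → ℂ) =O[atImInfty]
    fun τ : ℍ => Real.exp (-(2 * Real.pi) * τ.im) := by
  have := CuspFormClass.exp_decay_atImInfty CuspForm.discriminant one_pos one_mem_strictPeriods_SL
  refine this.congr (fun τ => ?_) fun τ => ?_
  · rfl
  · simp

/-- Δ has a simple zero at ∞, so both Δ and 1/Δ are controlled by powers of |q|. The quotient has
order ps - t there. -/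
theorem discriminant_quot_isBigO (p : ℕ) {s t : ℝ} (hs : 0 < s) (ht : 0 < t) (b b' : ℝ) :
    (fun τ => Δ (aff s b τ) ^ p / Δ (aff t b' τ)) =O[atImInfty]
      fun τ : ℍ => Real.exp (-(2 * Real.pi * (p * s - t)) * τ.im) := by
  have h1 := (isBigO_exp_comp_aff discriminant_isBigO hs b).pow p
  have h2 := isBigO_exp_comp_aff inv_discriminant_isBigO ht b'
  refine (h1.mul h2).congr (fun τ => by rw [div_eq_mul_inv]) fun τ => ?_
  rw [← Real.exp_nat_mul, ← Real.exp_add]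
  congr 1
  ring

theorem discriminant_aff_int (k : ℤ) (τ : ℍ) : Δ (aff 1 k τ) = Δ τ := by
  obtain ⟨D, -, h⟩ := exists_lexp_discriminant
  exact h.periodic k τ

/-- Expansion of `Δ(aτ/d)`. -/
theorem lexp_discriminant_aff {D : PowerSeries ℤ} (hD : LExp 1 Δ 0 (PowerSeries.X * ℤtoℂ D))
    {M a d s : ℕ} (ha : 0 < a) (hd : 0 < d) (hM : 0 < M) (hs : s ≠ 0) (h : s * d = a * M) :
    LExp M (fun τ => Δ (aff (a / d) 0 τ)) 0
      (PowerSeries.X ^ s * ℤtoℂ (PowerSeries.expand s hs D)) := by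
  have := hD.comp_aff ha hd hs one_pos hM (by rw [mul_one, h]) 0 (ω := 1) (by simp)
  simp only [Int.cast_zero, zero_div, mul_zero, inv_one, one_pow, map_one, one_mul,
    PowerSeries.rescale_one, RingHom.id_apply, map_mul, PowerSeries.expand_X] at this
  rwa [PowerSeries.map_expand]

/-- In Δ = qD the factor D is invertible over ℤ, so the quotient of expansions is integral as soon
as its order sp - s' is nonnegative. -/
theorem lexp_deltaQuot {D V : PowerSeries ℤ} (hD : LExp 1 Δ 0 (PowerSeries.X * ℤtoℂ D))
    (hDV : D * V = 1) (p : ℕ) {M a d s a' d' s' : ℕ} (ha : 0 < a) (hd : 0 < d) (ha' : 0 < a')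
    (hd' : 0 < d') (hM : 0 < M) (hs : s ≠ 0) (hs' : s' ≠ 0) (h : s * d = a * M)
    (h' : s' * d' = a' * M) (hle : s' ≤ s * p) :
    LExp M (deltaQuot p (a / d) (a' / d')) 0 (ℤtoℂ (PowerSeries.X ^ (s * p - s') *
      (PowerSeries.expand s hs D ^ p * PowerSeries.expand s' hs' V))) := by
  have h1 := (lexp_discriminant_aff hD ha hd hM hs h).pow p
  have h2 := lexp_discriminant_aff hD ha' hd' hM hs' h'
  have hper : ∀ a d s : ℕ, 0 < d → s * d = a * M → 0 < a → ∀ τ, Δ (aff (a / d) 0 (aff 1 M τ)) =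
      Δ (aff (a / d) 0 τ) := fun a d s hd h ha τ => by
    have hd0 : (d : ℝ) ≠ 0 := by positivity
    have hR : (s : ℝ) * d = a * M := by exact_mod_cast h
    rw [← discriminant_aff_int s (aff _ _ τ), aff_aff one_pos (by positivity),
      aff_aff (by positivity) one_pos]
    congr 2
    · ring
    · push_cast; field_simp; linear_combination -hR
  have hE : ∃ r P, LExp M (deltaQuot p (a / d) (a' / d')) r P := by
    refine exists_lexp hM (mdiff_deltaQuot p (by positivity) (by positivity)) (fun τ => ?_)
      (discriminant_quot_isBigO p (by positivity) (by positivity) 0 0)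
    rw [deltaQuot, deltaQuot, hper a d s hd h ha, hper a' d' s' hd' h' ha']
  have h1' : (fun τ => Δ (aff (a' / d') 0 τ)) * deltaQuot p (a / d) (a' / d') =
      (fun τ => Δ (aff (a / d) 0 τ)) ^ p := by
    funext τ
    simp only [Pi.mul_apply, Pi.pow_apply, deltaQuot]
    rw [mul_div_cancel₀ _ (ModularForm.discriminant_ne_zero _)]
  rw [mul_zero, ← h1'] at h1
  have h3 := LExp.of_mul hM hE h2 (V := ℤtoℂ (PowerSeries.expand s' hs' V))
    (by rw [← map_mul, ← map_mul, hDV, map_one, map_one]) h1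
  refine LExp.of_X_pow_mul (s := s') ?_
  rw [add_zero] at h3
  rw [zero_add]
  convert h3 using 1
  obtain ⟨t, ht⟩ := Nat.exists_eq_add_of_le hle
  rw [mul_pow, ← pow_mul, ht, Nat.add_sub_cancel_left, pow_add]
  simp only [map_mul, map_pow, PowerSeries.map_X]
  ring

/-- Frobenius on 𝔽_p⟦q⟧ gives D(q)^p = D(q^p) modulo p, the source of Ê ≡ 1. -/
theorem exists_pow_eq_expand_add (p : ℕ) [hp : Fact p.Prime] (D : PowerSeries ℤ) :
    ∃ R : PowerSeries ℤ, D ^ p = PowerSeries.expand p hp.out.ne_zero D + PowerSeries.C (p : ℤ) * R := by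
  have h : (D ^ p).map (Int.castRingHom (ZMod p)) =
      (PowerSeries.expand p hp.out.ne_zero D).map (Int.castRingHom (ZMod p)) := by
    rw [PowerSeries.map_expand, map_pow]
    have := MvPowerSeries.map_frobenius_expand p hp.out.ne_zero (R := ZMod p) (σ := Unit)
      (f := D.map (Int.castRingHom (ZMod p)))
    rw [ZMod.frobenius_zmod] at this
    rw [← this]
    exact DFunLike.congr_fun MvPowerSeries.map_id _
  have hc : ∀ m, ∃ r : ℤ, PowerSeries.coeff m (D ^ p) - PowerSeries.coeff m
      (PowerSeries.expand p hp.out.ne_zero D) = p * r := fun m => by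
    have := congrArg (PowerSeries.coeff m) h
    rw [PowerSeries.coeff_map, PowerSeries.coeff_map, ← sub_eq_zero, ← map_sub] at this
    exact (ZMod.intCast_zmod_eq_zero_iff_dvd _ p).1 this
  choose r hr using hc
  refine ⟨PowerSeries.mk r, ?_⟩
  ext m
  rw [map_add, PowerSeries.coeff_C_mul, PowerSeries.coeff_mk, ← hr]
  ring

/-- `Δ(sτ)^p / Δ(psτ) ∈ 1 + pℤ⟦q⟧`. -/
theorem exists_lexp_deltaQuot_one (p : ℕ) [hp : Fact p.Prime] {s : ℕ} (hs : 0 < s) :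
    ∃ R : PowerSeries ℤ,
      LExp 1 (deltaQuot p s (p * s)) 0 (ℤtoℂ (1 + PowerSeries.C (p : ℤ) * R)) := by
  obtain ⟨D, hD1, hD⟩ := exists_lexp_discriminant
  obtain ⟨V, hV⟩ := (PowerSeries.isUnit_iff_constantCoeff.2
    (show IsUnit (PowerSeries.constantCoeff D) by simp [hD1])).exists_right_inv
  obtain ⟨R, hR⟩ := exists_pow_eq_expand_add p D
  have h := lexp_deltaQuot hD hV p (M := 1) (d := 1) (s := s) (a' := s * p) (d' := 1) (s' := s * p)
    hs one_pos (Nat.mul_pos hs hp.out.pos) one_pos one_pos hs.ne'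
    (Nat.mul_pos hs hp.out.pos).ne' rfl rfl le_rfl
  refine ⟨PowerSeries.expand s hs.ne' R *
    PowerSeries.expand (s * p) (Nat.mul_pos hs hp.out.pos).ne' V, ?_⟩
  convert h using 2
  · push_cast; ring
  · push_cast; ring
  · rw [Nat.sub_self, pow_zero, one_mul, ← map_pow, hR, map_add, map_mul,
      ← PowerSeries.expand_mul, add_mul, ← map_mul, hV, map_one, PowerSeries.expand_C]
    ring

/-- The expansion of `Δ(sτ)^p / Δ(sτ/p)` at level `pN` is integral. -/
theorem exists_lexp_deltaQuot_div (p : ℕ) [hp : Fact p.Prime] {s N : ℕ} (hs : 0 < s) (hN : 0 < N) :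
    ∃ Y : PowerSeries ℤ, LExp (p * N) (deltaQuot p s (s / p)) 0 (ℤtoℂ Y) := by
  obtain ⟨D, hD1, hD⟩ := exists_lexp_discriminant
  obtain ⟨V, hV⟩ := (PowerSeries.isUnit_iff_constantCoeff.2
    (show IsUnit (PowerSeries.constantCoeff D) by simp [hD1])).exists_right_inv
  have hp0 := hp.out.pos
  have h := lexp_deltaQuot hD hV p (M := p * N) (d := 1) (s := s * (p * N)) (a' := s) (d' := p)
    (s' := s * N) hs one_pos hs hp0 (by positivity) (by positivity) (by positivity) (by ring)
    (by ring) (by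
      calc s * N ≤ s * N * (p * p) := Nat.le_mul_of_pos_right _ (by positivity)
        _ = s * (p * N) * p := by ring)
  rw [Nat.cast_one, div_one] at h
  exact ⟨_, h⟩

/-! ### Transformation of the quotients -/

/-- If `diag(s, 1)` and `diag(t, 1)` transform `γ` into integral matrices, then `Δ(sτ)^p / Δ(tτ)`
transforms accordingly. -/
theorem deltaQuot_smul {p : ℕ} (hp : 0 < p) {s t s' t' b b' l l' : ℝ} {γ : SL(2, ℝ)}
    {γ₀ γ₁ : SL(2, ℤ)} {τ : ℍ} (hl : l ≠ 0) (hl' : l' ≠ 0)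
    (h : aff s 0 (γ • τ) = γ₀ • aff s' b τ ∧ dn γ τ = l * dn γ₀ (aff s' b τ))
    (h' : aff t 0 (γ • τ) = γ₁ • aff t' b' τ ∧ dn γ τ = l' * dn γ₁ (aff t' b' τ)) :
    deltaQuot p s t (γ • τ) = dn γ τ ^ (12 * (p - 1)) * ((l' : ℂ) ^ 12 / (l : ℂ) ^ (12 * p)) *
      (Δ (aff s' b τ) ^ p / Δ (aff t' b' τ)) := by
  have hlC : (l : ℂ) ≠ 0 := by exact_mod_cast hl
  have hlC' : (l' : ℂ) ≠ 0 := by exact_mod_cast hl'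
  have h0 := dn_ne_zero γ τ
  have h1 := ModularForm.discriminant_ne_zero (aff t' b' τ)
  obtain ⟨k, rfl⟩ := Nat.exists_eq_add_of_lt hp
  rw [deltaQuot, discriminant_aff_smul hl h, discriminant_aff_smul hl' h']
  simp only [zero_add, Nat.add_sub_cancel, div_pow, mul_pow, ← pow_mul]
  field_simp
  ring

end Moonshine

end


noncomputable section

namespace Moonshine

/-! ### A form congruent to `1` modulo `p` that vanishes at the cusps of denominator prime to `p` -/

local notation "Δ" => ModularForm.discriminant

local notation "ℤtoℂ" => PowerSeries.map (Int.castRingHom ℂ)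

/-- `∏_{e ∈ S} Δ(ehτ)^p / Δ(pehτ)`, of weight `12 (p - 1) |S|`. -/
def eHat (p h : ℕ) (S : Finset ℕ) : ℍ → ℂ :=
  ∏ e ∈ S, deltaQuot p (e * h : ℕ) (p * (e * h : ℕ))

/-- `∏_{e ∈ S} Δ(ehτ)^p / Δ(ehτ/p)`. -/
def eHatDiv (p h : ℕ) (S : Finset ℕ) : ℍ → ℂ :=
  ∏ e ∈ S, deltaQuot p (e * h : ℕ) ((e * h : ℕ) / p)

section

variable {p h : ℕ} [hp : Fact p.Prime] {S : Finset ℕ}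

theorem mdiff_eHat (hh : 0 < h) (hS : ∀ e ∈ S, 0 < e) : MDiff (eHat p h S) := by
  classical
  rw [eHat]
  induction S using Finset.induction_on with
  | empty => exact mdifferentiable_const
  | insert e S he ih =>
    rw [Finset.prod_insert he]
    have := hS e (Finset.mem_insert_self e S)
    have hp0 := hp.out.pos
    exact (mdiff_deltaQuot p (by positivity) (by positivity)).mul
      (ih fun e' h' => hS e' (Finset.mem_insert_of_mem h'))

theorem exists_lexp_eHat (hh : 0 < h) (hS : ∀ e ∈ S, 0 < e) :
    ∃ R : PowerSeries ℤ, LExp 1 (eHat p h S) 0 (ℤtoℂ (1 + PowerSeries.C (p : ℤ) * R)) := by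
  classical
  rw [eHat]
  induction S using Finset.induction_on with
  | empty => exact ⟨0, by simpa using LExp.one 1⟩
  | insert e S he ih =>
    rw [Finset.prod_insert he]
    have he0 := hS e (Finset.mem_insert_self e S)
    obtain ⟨R, hR⟩ := ih fun e' h' => hS e' (Finset.mem_insert_of_mem h')
    obtain ⟨R', hR'⟩ := exists_lexp_deltaQuot_one p (Nat.mul_pos he0 hh)
    refine ⟨R' + R + PowerSeries.C (p : ℤ) * R' * R, ?_⟩
    convert hR'.mul hR using 1
    rw [← map_mul]
    congr 1
    ring

theorem exists_lexp_eHatDiv (hh : 0 < h) (hS : ∀ e ∈ S, 0 < e) {N : ℕ} (hN : 0 < N) :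
    ∃ Y : PowerSeries ℤ, LExp (p * N) (eHatDiv p h S) 0 (ℤtoℂ Y) := by
  classical
  rw [eHatDiv]
  induction S using Finset.induction_on with
  | empty => exact ⟨1, by simpa using LExp.one (p * N)⟩
  | insert e S he ih =>
    rw [Finset.prod_insert he]
    have he0 := hS e (Finset.mem_insert_self e S)
    obtain ⟨R, hR⟩ := ih fun e' h' => hS e' (Finset.mem_insert_of_mem h')
    obtain ⟨R', hR'⟩ := exists_lexp_deltaQuot_div p (Nat.mul_pos he0 hh) hN
    refine ⟨R' * R, ?_⟩
    convert hR'.mul hR using 1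
    rw [← map_mul]

/-- Growth of `Δ(sτ)^p / Δ(psτ)` at the cusps. -/
theorem deltaQuot_smul_isBigO {s : ℕ} (hs : 0 < s) (γ : SL(2, ℤ)) :
    (fun τ => deltaQuot p s (p * s) (γ • τ) * (dn γ τ ^ (12 * (p - 1)))⁻¹) =O[atImInfty]
      fun τ : ℍ => Real.exp (-(if (p : ℤ) ∣ γ 1 0 then 0 else 2 * Real.pi / s) * τ.im) := by
  have hp0 := hp.out.pos
  obtain ⟨γ₀, a, d, b, ha, hd, had, hag, h00, h01, h10, h11⟩ := exists_hermite hs γ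
  obtain ⟨γ₁, a', d', b', ha', hd', had', hag', h00', h01', h10', h11'⟩ :=
    exists_hermite (Nat.mul_pos hp0 hs) γ
  have e : ∀ τ, deltaQuot p s (p * s) (γ • τ) * (dn γ τ ^ (12 * (p - 1)))⁻¹ =
      ((d' : ℂ) ^ 12 / (d : ℂ) ^ (12 * p)) *
        (Δ (aff (a / d) (b / d) τ) ^ p / Δ (aff (a' / d') (b' / d') τ)) := fun τ => by
    have h1 := aff_smul_of_hermite hs ha hd h00 h01 h10 h11 τ
    have h2 := aff_smul_of_hermite (Nat.mul_pos hp0 hs) ha' hd' h00' h01' h10' h11' τ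
    rw [← Complex.ofReal_natCast d] at h1
    rw [← Complex.ofReal_natCast d', Nat.cast_mul] at h2
    have := deltaQuot_smul hp0 (γ := γ) (by positivity) (by positivity) h1 h2
    rw [intCast_smul] at this
    rw [this]
    have h0 := dn_ne_zero γ τ
    push_cast
    field_simp
  simp only [e]
  refine Asymptotics.IsBigO.const_mul_left (isBigO_exp_mono ?_
    (discriminant_quot_isBigO p (by positivity) (by positivity) _ _)) _
  -- The order at the cusp is proportional to (pa)² - a'², where a and a' are the gcds in the
  -- Hermite forms for s and ps. It is nonnegative by a' ∣ pa. If p ∤ γ₁₀ then a' is prime to p, so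
  -- a' ≤ a and the order is positive.
  have hdvd : a' ∣ p * a := by
    have hg : p * Int.gcd (s * γ 0 0) (γ 1 0) = Int.gcd (p * (s * γ 0 0)) (p * γ 1 0) := by
      rw [Int.gcd_mul_left, Int.natAbs_natCast]
    rw [hag', hag, hg]
    refine Int.dvd_gcd ?_ ?_
    · exact (Int.gcd_dvd_left ..).trans (dvd_of_eq (by push_cast; ring))
    · exact (Int.gcd_dvd_right ..).mul_left _
  have hsR : (0 : ℝ) < s := by positivity
  have hpR : (2 : ℝ) ≤ p := by exact_mod_cast hp.out.two_le
  have e1 : (a : ℝ) / d = a ^ 2 / s := by rw [← had]; push_cast; field_simp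
  have e2 : (a' : ℝ) / d' = a' ^ 2 / (p * s) := by
    have : (p : ℝ) * s = a' * d' := by exact_mod_cast had'.symm
    rw [this]; field_simp
  rw [e1, e2, neg_le_neg_iff]
  have e3 : 2 * Real.pi * (p * ((a : ℝ) ^ 2 / s) - a' ^ 2 / (p * s)) =
      2 * Real.pi / s * (((p * a : ℝ) ^ 2 - a' ^ 2) / p) := by field_simp
  rw [e3]
  split_ifs with hγ
  · have : (a' : ℝ) ≤ p * a := by
      exact_mod_cast Nat.le_of_dvd (Nat.mul_pos hp0 ha) hdvd
    have : (a' : ℝ) ^ 2 ≤ (p * a : ℝ) ^ 2 := by gcongr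
    have := Real.pi_pos
    exact mul_nonneg (by positivity) (div_nonneg (by linarith) (by positivity))
  · have hpa : Nat.Coprime a' p := ((hp.out.coprime_iff_not_dvd).2 fun h' => hγ
      ((Int.natCast_dvd_natCast.2 h').trans (by rw [h10']; exact dvd_mul_left _ _))).symm
    have h1 : (a' : ℝ) ≤ a := by exact_mod_cast Nat.le_of_dvd ha (hpa.dvd_of_dvd_mul_left hdvd)
    have h2 : (a' : ℝ) ^ 2 ≤ (a : ℝ) ^ 2 := by gcongr
    have h3 : (1 : ℝ) ≤ a := by exact_mod_cast ha
    have h4 : (1 : ℝ) ≤ a ^ 2 := one_le_pow₀ h3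
    have := Real.pi_pos
    -- (p²a² - a'²)/p ≥ (p² - 1)/p ≥ 1, which is where the uniform constant 2π/s comes from.
    refine le_mul_of_one_le_right (by positivity) ?_
    rw [le_div_iff₀ (by positivity)]
    nlinarith [mul_le_mul_of_nonneg_left h4 (by nlinarith : (0 : ℝ) ≤ p ^ 2 - 1)]

theorem prod_isBigO_exp {S : Finset ℕ} {u : ℕ → ℍ → ℂ} {c : ℕ → ℝ}
    (h : ∀ e ∈ S, u e =O[atImInfty] fun τ : ℍ => Real.exp (-c e * τ.im)) :
    (fun τ => ∏ e ∈ S, u e τ) =O[atImInfty] fun τ : ℍ => Real.exp (-(∑ e ∈ S, c e) * τ.im) := by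
  classical
  induction S using Finset.induction_on with
  | empty => simpa using Asymptotics.isBigO_const_const (1 : ℂ) (one_ne_zero (α := ℝ)) atImInfty
  | insert e S he ih =>
    refine ((h e (Finset.mem_insert_self e S)).mul
      (ih fun e' h' => h e' (Finset.mem_insert_of_mem h'))).congr (fun τ => ?_) fun τ => ?_
    · rw [Finset.prod_insert he]
    · rw [Finset.sum_insert he, ← Real.exp_add]; congr 1; ring

/-- Growth of `eHat` at the cusps. -/
theorem exists_eHat_isBigO (hh : 0 < h) (hS : ∀ e ∈ S, 0 < e) (hne : S.Nonempty) : ∃ c : ℝ, 0 < c ∧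
    ∀ γ : SL(2, ℤ), (fun τ => eHat p h S (γ • τ) * (dn γ τ ^ (12 * (p - 1) * S.card))⁻¹)
      =O[atImInfty] fun τ : ℍ => Real.exp (-(if (p : ℤ) ∣ γ 1 0 then 0 else c) * τ.im) := by
  refine ⟨∑ e ∈ S, 2 * Real.pi / (e * h : ℕ), Finset.sum_pos (fun e he => ?_) hne, fun γ => ?_⟩
  · have := hS e he
    have := Real.pi_pos
    positivity
  · have := prod_isBigO_exp (S := S) fun e he =>
      deltaQuot_smul_isBigO (p := p) (Nat.mul_pos (hS e he) hh) γ
    refine this.congr (fun τ => ?_) fun τ => ?_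
    · rw [Finset.prod_mul_distrib, Finset.prod_inv_distrib, Finset.prod_const, ← pow_mul, eHat,
        Finset.prod_apply]
    · split_ifs <;> simp

/-- `eHat` at the cusp `0` of the `p`-part. -/
theorem eHat_smul_sigma {N : ℕ} (hh : 0 < h) (hS : ∀ e ∈ S, 0 < e) (hN : ∀ e ∈ S, e * h ∣ N)
    {A B D : ℤ} (hdet : A * (p * D) - B * N = 1) (τ : ℍ) :
    eHat p h S (mkSL A B N (p * D) hdet • τ) = dn (mkSL A B N (p * D) hdet) τ ^
      (12 * (p - 1) * S.card) * p ^ (12 * S.card) * eHatDiv p h S τ := by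
  have hp0 := hp.out.pos
  rw [eHat, eHatDiv, Finset.prod_apply, Finset.prod_apply, pow_mul _ _ S.card, pow_mul _ _ S.card, ← Finset.prod_const,
    ← Finset.prod_const, ← Finset.prod_mul_distrib, ← Finset.prod_mul_distrib]
  refine Finset.prod_congr rfl fun e he => ?_
  obtain ⟨t, ht⟩ := hN e he
  have hs : 0 < e * h := Nat.mul_pos (hS e he) hh
  generalize e * h = s at *
  have hsR : (s : ℝ) ≠ 0 := by positivity
  have hpR : (p : ℝ) ≠ 0 := by positivity
  have htZ : (N : ℤ) = s * t := by exact_mod_cast ht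
  have htR : (N : ℝ) = s * t := by exact_mod_cast ht
  have h1 := aff_smul (s := s) (s' := s) (t := 0) (l := 1) (γ := mkSL A B N (p * D) hdet)
    (γ₀ := mkSL A (s * B) t (p * D) (by rw [htZ] at hdet; linear_combination hdet))
    (by positivity) (by positivity) (by simp; ring) (by simp) (by simp [htR]; ring) (by simp) τ
  -- As the lower right entry of σ is divisible by p, a scalar p splits off from diag(ps, 1)σ and
  -- none from diag(s, 1)σ. Since Δ has weight 12, each e contributes a factor p^12.
  have h2 := aff_smul (s := p * s) (s' := s / p) (t := 0) (l := p) (γ := mkSL A B N (p * D) hdet)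
    (γ₀ := mkSL (p * A) (s * B) t D (by rw [htZ] at hdet; linear_combination hdet))
    (by positivity) (by positivity) (by simp; field_simp) (by simp; ring)
    (by simp [htR]; field_simp) (by simp) τ
  have := deltaQuot_smul hp0 one_ne_zero hpR h1 h2
  rw [intCast_smul] at this
  rw [this, deltaQuot]
  simp

/-- `eHat` is invariant under the elements of `w_e`, `e ∈ S`, with lower left entry divisible
by `p`. -/
theorem eHat_smul_wM {k e' m : ℕ} (hh : 0 < h) (hk : 0 < k)
    (hS : IsExactDivisorSubgroup k (S : Set ℕ)) (he' : e' ∈ S) (hm : k = e' * m) {w : SL(2, ℝ)}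
    {a b c d : ℤ} (hd : a * d * e' - b * (p * c) * m = 1)
    (hw : (w : Matrix (Fin 2) (Fin 2) ℝ) = wM h e' m a b (p * c) d) (τ : ℍ) :
    eHat p h S (w • τ) = dn w τ ^ (12 * (p - 1) * S.card) * eHat p h S τ := by
  have hp0 := hp.out.pos
  have hpos : ∀ e ∈ S, 0 < e := fun e he => (hS.exact e he).pos hk
  -- w carries the factor of e to the factor of e * e', at the cost of a power of (e * e')/e. Since
  -- e ↦ e * e' permutes S, these costs multiply to 1.
  have key : ∀ e ∈ S, deltaQuot p (e * h : ℕ) (p * (e * h : ℕ)) (w • τ) =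
      dn w τ ^ (12 * (p - 1)) * ((exactMul e e' : ℂ) / e) ^ (6 * (p - 1)) *
        deltaQuot p (exactMul e e' * h : ℕ) (p * (exactMul e e' * h : ℕ)) τ := fun e he => by
    obtain ⟨g, u, v, m₁, hg, hu, hv, rfl, rfl, -, -, -, -, hk', hex⟩ :=
      (hS.exact e he).exists_decomp hk (hS.exact e' he')
    obtain rfl : m = u * m₁ := by
      refine Nat.eq_of_mul_eq_mul_left (Nat.mul_pos hg hv) ?_
      rw [← hm, hk']; ring
    rw [hex]
    have hs0 : (0 : ℝ) < √((g * v : ℕ) : ℝ) := Real.sqrt_pos.2 (by positivity)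
    have hs2 : √((g * v : ℕ) : ℝ) ^ 2 = g * v := by rw [Real.sq_sqrt (by positivity)]; push_cast; rfl
    have hpR : (p : ℝ) ≠ 0 := by positivity
    have hw00 : w 0 0 = a * √((g * v : ℕ) : ℝ) := by rw [hw]; simp [wM]
    have hw01 : w 0 1 = b / (h * √((g * v : ℕ) : ℝ)) := by rw [hw]; simp [wM]
    have hw10 : w 1 0 = p * c * h * (u * m₁) * √((g * v : ℕ) : ℝ) := by rw [hw]; simp [wM]
    have hw11 : w 1 1 = d * √((g * v : ℕ) : ℝ) := by rw [hw]; simp [wM]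
    generalize √((g * v : ℕ) : ℝ) = s at *
    have hgR : (g : ℝ) = s ^ 2 / v := by rw [hs2]; field_simp
    have h1 := aff_smul (s := (g * u * h : ℕ)) (s' := (u * v * h : ℕ)) (t := 0) (l := s / v)
      (γ := w) (γ₀ := mkSL (g * a) (u * b) (p * c * m₁) (d * v) (by
        push_cast at hd; linear_combination hd))
      (by positivity) (by positivity) (by rw [hw00]; simp [hgR]; field_simp)
      (by rw [hw01]; simp [hgR]; field_simp) (by rw [hw10]; simp; field_simp)
      (by rw [hw11]; simp; field_simp) τ
    have h2 := aff_smul (s := p * (g * u * h : ℕ)) (s' := p * (u * v * h : ℕ)) (t := 0)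
      (l := s / v)
      (γ := w) (γ₀ := mkSL (g * a) (p * (u * b)) (c * m₁) (d * v) (by
        push_cast at hd; linear_combination hd))
      (by positivity) (by positivity) (by rw [hw00]; simp [hgR]; field_simp)
      (by rw [hw01]; simp [hgR]; field_simp) (by rw [hw10]; simp; field_simp)
      (by rw [hw11]; simp; field_simp) τ
    rw [deltaQuot_smul hp0 (by positivity) (by positivity) h1 h2, deltaQuot]
    congr 2
    have hsC : (s : ℂ) ^ 2 = g * v := by exact_mod_cast hs2
    have hsC0 : (s : ℂ) ≠ 0 := by exact_mod_cast hs0.ne'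
    have hgC : (g : ℂ) ≠ 0 := by exact_mod_cast hg.ne'
    have huC : (u : ℂ) ≠ 0 := by exact_mod_cast hu.ne'
    have hvC : (v : ℂ) ≠ 0 := by exact_mod_cast hv.ne'
    have e1 : ((s / v : ℝ) : ℂ) ^ 2 = g / v := by
      push_cast; rw [div_pow, hsC]; field_simp
    obtain ⟨q, hq⟩ := Nat.exists_eq_add_of_lt hp0
    rw [zero_add] at hq
    have e2 : ∀ j : ℕ, ((s / v : ℝ) : ℂ) ^ (12 * j) = (g / v : ℂ) ^ (6 * j) := fun j => by
      rw [show 12 * j = 2 * (6 * j) by ring, pow_mul, e1]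
    have e3 := e2 1
    rw [mul_one, mul_one] at e3
    rw [e2, e3, hq, Nat.add_sub_cancel, Nat.cast_mul, Nat.cast_mul, mul_comm (g : ℂ),
      mul_div_mul_left _ _ huC, mul_add, mul_one, pow_add]
    have : (g / v : ℂ) ≠ 0 := div_ne_zero hgC hvC
    rw [← inv_div (g : ℂ) v, inv_pow]
    field_simp
  have hbij : ∀ F : ℕ → ℂ, ∏ e ∈ S, F (exactMul e e') = ∏ e ∈ S, F e := fun F => by
    refine Finset.prod_nbij' (fun e => exactMul e e') (fun e => exactMul e e') ?_ ?_ ?_ ?_ ?_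
    · exact fun e he => hS.mul_mem e he e' he'
    · exact fun e he => hS.mul_mem e he e' he'
    · exact fun e he => exactMul_exactMul_cancel hk (hS.exact e he) (hS.exact e' he')
    · exact fun e he => exactMul_exactMul_cancel hk (hS.exact e he) (hS.exact e' he')
    · exact fun e he => rfl
  rw [eHat, Finset.prod_apply, Finset.prod_apply, Finset.prod_congr rfl key,
    Finset.prod_mul_distrib, Finset.prod_mul_distrib, Finset.prod_const, ← pow_mul,
    Finset.prod_pow, Finset.prod_div_distrib,
    hbij fun e => deltaQuot p (e * h : ℕ) (p * (e * h : ℕ)) τ, hbij fun e => (e : ℂ),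
    div_self, one_pow, mul_one]
  exact Finset.prod_ne_zero_iff.2 fun e he => by exact_mod_cast (hpos e he).ne'

end

end Moonshine

end


/-! ### The trace of g Ê^j from Γ₀(pN) to Γ₀(N) and its expansion. -/

noncomputable section

namespace Moonshine

/-! ### The trace from `Γ₀(pN)` to `Γ₀(N)` -/

/-- `r` is a system of representatives of `K \ L`. -/
def IsCosetReps {ι : Type*} (K L : Subgroup SL(2, ℝ)) (r : ι → SL(2, ℝ)) : Prop :=
  (∀ i, r i ∈ L) ∧ ∀ γ ∈ L, ∃! i, γ * (r i)⁻¹ ∈ K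

namespace IsCosetReps

variable {ι : Type*} {K L : Subgroup SL(2, ℝ)} {r r' : ι → SL(2, ℝ)}

theorem mul_right (hr : IsCosetReps K L r) {γ : SL(2, ℝ)} (hγ : γ ∈ L) :
    IsCosetReps K L fun i => r i * γ := by
  refine ⟨fun i => L.mul_mem (hr.1 i) hγ, fun δ hδ => ?_⟩
  obtain ⟨i, hi, hu⟩ := hr.2 (δ * γ⁻¹) (L.mul_mem hδ (L.inv_mem hγ))
  have e : ∀ j, δ * (r j * γ)⁻¹ = δ * γ⁻¹ * (r j)⁻¹ := fun j => by group
  exact ⟨i, by simpa only [e] using hi, fun j hj => hu j (by simpa only [e] using hj)⟩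

theorem conj (hr : IsCosetReps K L r) {w : SL(2, ℝ)} (hL : ∀ δ ∈ L, w⁻¹ * δ * w ∈ L)
    (hL' : ∀ δ ∈ L, w * δ * w⁻¹ ∈ L) (hK : ∀ δ ∈ K, w⁻¹ * δ * w ∈ K)
    (hK' : ∀ δ ∈ K, w * δ * w⁻¹ ∈ K) : IsCosetReps K L fun i => w⁻¹ * r i * w := by
  refine ⟨fun i => hL _ (hr.1 i), fun δ hδ => ?_⟩
  obtain ⟨i, hi, hu⟩ := hr.2 (w * δ * w⁻¹) (hL' _ hδ)
  refine ⟨i, ?_, fun j hj => hu j ?_⟩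
  · have := hK _ hi
    simpa [mul_assoc] using this
  · have := hK' _ hj
    simpa [mul_assoc] using this

/-- G|r depends only on the coset Kr. It is used to replace r by rγ and by w⁻¹rw in the trace. -/
theorem sum_slash_eq [Fintype ι] (hr : IsCosetReps K L r) (hr' : IsCosetReps K L r') {k : ℤ}
    {G : ℍ → ℂ} (hG : ∀ δ ∈ K, G ∣[k] (SpecialLinearGroup.toGL δ : GL (Fin 2) ℝ) = G) :
    ∑ i, G ∣[k] (SpecialLinearGroup.toGL (r i) : GL (Fin 2) ℝ) =
      ∑ i, G ∣[k] (SpecialLinearGroup.toGL (r' i) : GL (Fin 2) ℝ) := by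
  choose φ hφ hu using fun i => hr'.2 (r i) (hr.1 i)
  have hinj : Function.Injective φ := fun i j hij => by
    obtain ⟨l, -, hl⟩ := hr.2 (r i) (hr.1 i)
    rw [hl i (by simp [K.one_mem]), hl j ?_]
    have h1 := hφ i
    rw [hij] at h1
    simpa [mul_assoc] using K.mul_mem h1 (K.inv_mem (hφ j))
  refine Fintype.sum_equiv (Equiv.ofBijective φ (Finite.injective_iff_bijective.1 hinj)) _ _
    fun i => ?_
  rw [Equiv.ofBijective_apply]
  conv_rhs => rw [← hG _ (hφ i), ← SlashAction.slash_mul, ← map_mul, inv_mul_cancel_right]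

end IsCosetReps

theorem mem_Gamma0R_intCast {N : ℕ} {γ : SL(2, ℤ)} :
    (γ : SL(2, ℝ)) ∈ Gamma0R N ↔ (N : ℤ) ∣ γ 1 0 := by
  rw [← ZMod.intCast_zmod_eq_zero_iff_dvd, ← CongruenceSubgroup.Gamma0_mem]
  exact Subgroup.mem_map_iff_mem Matrix.SpecialLinearGroup.map_intCast_injective

/-- The representatives `1` and `σ T^b`, `0 ≤ b < p`, of `Γ₀(pN) \ Γ₀(N)`. -/
def traceReps (p : ℕ) (σ : SL(2, ℤ)) : Option (ZMod p) → SL(2, ℤ)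
  | none => 1
  | some b => σ * ModularGroup.T ^ (b.val : ℤ)

/-- An element with lower row (cN, d) belongs to the coset of 1 if and only if p ∣ c. Otherwise it
belongs to that of σT^b for the unique residue b with d ≡ bcN modulo p, because the lower right
entry of σ is divisible by p. -/
theorem isCosetReps_traceReps {p N : ℕ} [hp : Fact p.Prime] (hpN : ¬ p ∣ N) (hN : 0 < N)
    {A B D : ℤ} (hdet : A * (p * D) - B * N = 1) :
    IsCosetReps (Gamma0R (p * N)) (Gamma0R N)
      fun i => ((traceReps p (mkSL A B N (p * D) hdet) i : SL(2, ℤ)) : SL(2, ℝ)) := by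
  have hpZ := Nat.prime_iff_prime_int.1 hp.out
  have hpN' : ¬ (p : ℤ) ∣ N := fun h => hpN (Int.natCast_dvd_natCast.1 h)
  have hNZ : (N : ℤ) ≠ 0 := by exact_mod_cast hN.ne'
  constructor
  · rintro (_ | b)
    · simp [traceReps, (Gamma0R N).one_mem]
    · rw [mem_Gamma0R_intCast]
      simp [traceReps, SL2_mul_apply, ModularGroup.coe_T_zpow]
  · rintro _ ⟨γ, hγ, rfl⟩
    rw [SetLike.mem_coe, CongruenceSubgroup.Gamma0_mem, ZMod.intCast_zmod_eq_zero_iff_dvd] at hγ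
    obtain ⟨c, hc⟩ := hγ
    have hγdet := γ.det_coe
    rw [Matrix.det_fin_two, hc] at hγdet
    have hmem : ∀ i, ((γ : SL(2, ℤ)) : SL(2, ℝ)) *
        ((traceReps p (mkSL A B N (p * D) hdet) i : SL(2, ℤ)) : SL(2, ℝ))⁻¹ ∈ Gamma0R (p * N) ↔
        match i with
        | none => (p : ℤ) ∣ c
        | some b => (p : ℤ) ∣ γ 1 1 - b.val * (N * c) := by
      intro i
      rw [← map_inv, ← map_mul, mem_Gamma0R_intCast]
      rcases i with _ | b
      · simp only [traceReps, inv_one, mul_one, hc, Nat.cast_mul]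
        rw [mul_comm (p : ℤ), mul_dvd_mul_iff_left hNZ]
      · have e : ((γ * (traceReps p (mkSL A B N (p * D) hdet) (some b))⁻¹ : SL(2, ℤ)) 1 0) =
            N * (p * (c * D) - (γ 1 1 - b.val * (N * c))) := by
          simp only [traceReps, _root_.mul_inv_rev, ← _root_.zpow_neg, SL2_mul_apply, SL2_inv_apply,
            ModularGroup.coe_T_zpow]
          simp [hc]
          ring
        rw [e, Nat.cast_mul, mul_comm (p : ℤ), mul_dvd_mul_iff_left hNZ]
        exact dvd_sub_right (dvd_mul_right _ _)
    by_cases hpc : (p : ℤ) ∣ c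
    · refine ⟨none, (hmem none).2 hpc, ?_⟩
      rintro (_ | b) hi
      · rfl
      · have h1 := (hmem (some b)).1 hi
        have h2 : (p : ℤ) ∣ γ 1 1 := by
          have := dvd_add h1 (((hpc.mul_left N)).mul_left (b.val : ℤ))
          rwa [sub_add_cancel] at this
        exact absurd (hγdet ▸ dvd_sub (h2.mul_left _) ((hpc.mul_left _).mul_left _)) hpZ.not_dvd_one
    · have hcz : (N * c : ZMod p) ≠ 0 := by
        intro h
        have : ((N * c : ℤ) : ZMod p) = 0 := by exact_mod_cast h
        rw [ZMod.intCast_zmod_eq_zero_iff_dvd] at this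
        exact (hpZ.dvd_or_dvd this).elim hpN' hpc
      have key : ∀ b : ZMod p, (p : ℤ) ∣ γ 1 1 - b.val * (N * c) ↔ b = γ 1 1 / (N * c) := fun b => by
        rw [← ZMod.intCast_zmod_eq_zero_iff_dvd, eq_div_iff hcz]
        push_cast
        rw [ZMod.natCast_zmod_val, sub_eq_zero]
        exact eq_comm
      refine ⟨some (γ 1 1 / (N * c)), (hmem (some _)).2 ((key _).2 rfl), ?_⟩
      rintro (_ | b) hi
      · exact absurd ((hmem none).1 hi) hpc
      · exact congrArg some ((key b).1 ((hmem (some b)).1 hi))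

end Moonshine

end


noncomputable section

namespace Moonshine

/-! ### The forms `g eHat^j` and their traces -/

/-- A function on `Γ₀(M)` that is meromorphic at the cusps grows uniformly. -/
theorem InvW.exists_isBigO {M : ℕ} (hM : 0 < M) {g : wring} (hg : InvW M g) : ∃ C : ℝ,
    ∀ γ : SL(2, ℤ), (fun τ => (g : ℍ → ℂ) (γ • τ)) =O[atImInfty]
      fun τ : ℍ => Real.exp (C * τ.im) := by
  have : NeZero M := ⟨hM.ne'⟩
  have : Finite (SL(2, ℤ) ⧸ CongruenceSubgroup.Gamma0 M) := Subgroup.finite_quotient_of_finiteIndex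
  choose C hC using fun x : SL(2, ℤ) ⧸ CongruenceSubgroup.Gamma0 M => g.2.2 x.out⁻¹
  obtain ⟨C₀, hC₀⟩ := (Set.finite_range C).bddAbove
  refine ⟨C₀, fun γ => isBigO_exp_mono (hC₀ ⟨(γ⁻¹ : SL(2, ℤ)), rfl⟩) ?_⟩
  refine (hC ((γ⁻¹ : SL(2, ℤ)) : SL(2, ℤ) ⧸ CongruenceSubgroup.Gamma0 M)).congr_left fun τ => ?_
  obtain ⟨δ, hδ⟩ := QuotientGroup.mk_out_eq_mul (CongruenceSubgroup.Gamma0 M) γ⁻¹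
  rw [hδ, _root_.mul_inv_rev, inv_inv, mul_smul]
  exact hg _ (inv_mem δ.2) _

theorem mul_eHat_slash_apply {p h : ℕ} {S : Finset ℕ} (g : ℍ → ℂ) (j : ℕ) (w : SL(2, ℝ)) (τ : ℍ) :
    ((g * eHat p h S ^ j) ∣[((12 * (p - 1) * S.card * j : ℕ) : ℤ)]
      (SpecialLinearGroup.toGL w : GL (Fin 2) ℝ)) τ =
      g (w • τ) * (eHat p h S (w • τ) * (dn w τ ^ (12 * (p - 1) * S.card))⁻¹) ^ j := by
  rw [slash_toGL_apply, _root_.zpow_neg, zpow_natCast, mul_pow, inv_pow, ← pow_mul, Pi.mul_apply,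
    Pi.pow_apply, mul_assoc]

section

variable {p h : ℕ} [hp : Fact p.Prime] {S : Finset ℕ}

/-- For large `j`, `g eHat^j` is holomorphic at all cusps. -/
theorem exists_forall_isBoundedAtImInfty {M : ℕ} (hM : 0 < M) (hh : 0 < h) (hS : ∀ e ∈ S, 0 < e)
    (hne : S.Nonempty) {g : wring} (hg : InvW M g)
    (hb : ∀ γ : SL(2, ℤ), (p : ℤ) ∣ γ 1 0 →
      (fun τ => (g : ℍ → ℂ) (γ • τ)) =O[atImInfty] (1 : ℍ → ℝ)) :
    ∃ j₀ : ℕ, ∀ j, j₀ ≤ j → ∀ γ : SL(2, ℤ), IsBoundedAtImInfty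
      (((g : ℍ → ℂ) * eHat p h S ^ j) ∣[((12 * (p - 1) * S.card * j : ℕ) : ℤ)]
        (SpecialLinearGroup.toGL (γ : SL(2, ℝ)) : GL (Fin 2) ℝ)) := by
  obtain ⟨C, hC⟩ := hg.exists_isBigO hM
  obtain ⟨c, hc, hE⟩ := exists_eHat_isBigO (p := p) hh hS hne
  -- For cj ≥ C the zero of Ê^j outweighs the pole of g at every cusp of denominator prime to p; at
  -- the others both factors are bounded.
  obtain ⟨j₀, hj₀⟩ := exists_nat_ge (C / c)
  refine ⟨j₀, fun j hj γ => ?_⟩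
  have h1 := (hE γ).pow j
  have hfun : ((g : ℍ → ℂ) * eHat p h S ^ j) ∣[((12 * (p - 1) * S.card * j : ℕ) : ℤ)]
        (SpecialLinearGroup.toGL (γ : SL(2, ℝ)) : GL (Fin 2) ℝ) = fun τ => (g : ℍ → ℂ) (γ • τ) *
      (eHat p h S (γ • τ) * (dn γ τ ^ (12 * (p - 1) * S.card))⁻¹) ^ j := by
    funext τ
    rw [mul_eHat_slash_apply, intCast_smul]
  rw [hfun]
  by_cases hγ : (p : ℤ) ∣ γ 1 0
  · refine ((hb γ hγ).mul h1).trans ?_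
    simp only [hγ, if_true, neg_zero, zero_mul, Real.exp_zero, one_pow, Pi.one_apply, mul_one]
    exact Asymptotics.isBigO_refl _ _
  · refine ((hC γ).mul h1).trans (Asymptotics.IsBigO.of_bound 1 (Eventually.of_forall fun τ => ?_))
    simp only [hγ, if_false, Pi.one_apply, norm_one, mul_one]
    rw [← Real.exp_nat_mul, ← Real.exp_add, Real.norm_of_nonneg (Real.exp_nonneg _)]
    refine Real.exp_le_one_iff.2 ?_
    have h2 : C ≤ c * j := by
      have h3 : C / c ≤ j := hj₀.trans (by exact_mod_cast hj)
      rw [div_le_iff₀ hc] at h3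
      linarith
    nlinarith [τ.im_pos]

/-- `g eHat^j` is an eigenfunction of the elements of `w_e`, `e ∈ S`, with lower left entry
divisible by `p`, if `g` is. -/
theorem mul_eHat_slash_wM {k e' m : ℕ} (hh : 0 < h) (hk : 0 < k)
    (hS : IsExactDivisorSubgroup k (S : Set ℕ)) (he' : e' ∈ S) (hm : k = e' * m) {w : SL(2, ℝ)}
    {a b c d : ℤ} (hd : a * d * e' - b * (p * c) * m = 1)
    (hw : (w : Matrix (Fin 2) (Fin 2) ℝ) = wM h e' m a b (p * c) d) {g : ℍ → ℂ} {x : ℂ}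
    (hg : ∀ τ, g (w • τ) = x * g τ) (j : ℕ) :
    (g * eHat p h S ^ j) ∣[((12 * (p - 1) * S.card * j : ℕ) : ℤ)]
      (SpecialLinearGroup.toGL w : GL (Fin 2) ℝ) = x • (g * eHat p h S ^ j) := by
  funext τ
  rw [mul_eHat_slash_apply, hg, eHat_smul_wM hh hk hS he' hm hd hw, mul_comm (dn w τ ^ _),
    mul_inv_cancel_right₀ (pow_ne_zero _ (dn_ne_zero _ _))]
  simp [mul_assoc]

theorem mul_eHat_slash_Gamma0R {n : ℕ} (hh : h ∣ n) (hn : 0 < n)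
    (hS : IsExactDivisorSubgroup (n / h) (S : Set ℕ)) {g : wring} (hg : InvW (p * (n * h)) g)
    (j : ℕ) {δ : SL(2, ℝ)} (hδ : δ ∈ Gamma0R (p * (n * h))) :
    ((g : ℍ → ℂ) * eHat p h S ^ j) ∣[((12 * (p - 1) * S.card * j : ℕ) : ℤ)]
      (SpecialLinearGroup.toGL δ : GL (Fin 2) ℝ) = (g : ℍ → ℂ) * eHat p h S ^ j := by
  obtain ⟨m, rfl⟩ := hh
  have hh0 : 0 < h := Nat.pos_of_mul_pos_right hn
  rw [Nat.mul_div_cancel_left _ hh0] at hS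
  obtain ⟨a, b, c, d, hd, hδM⟩ := mem_Gamma0R_iff.1 hδ
  have h1 := mul_eHat_slash_wM (p := p) (S := S) hh0 (Nat.pos_of_mul_pos_left hn) hS hS.one_mem
    (one_mul m).symm (w := δ) (a := a) (b := b * h) (c := c * h) (d := d)
    (by push_cast at hd ⊢; linear_combination hd) (by
      have h3 : (h : ℝ) ≠ 0 := by positivity
      rw [hδM, wM]
      push_cast
      ext i j
      fin_cases i <;> fin_cases j <;> simp
      · field_simp
      · ring) (g := (g : ℍ → ℂ)) (x := 1) (by
      obtain ⟨γ, hγ, rfl⟩ := hδ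
      intro τ
      rw [one_mul]
      exact hg γ hγ τ) j
  rwa [one_smul] at h1

/-- The trace of `g eHat^j` to `Γ₀(N)`. -/
def traceForm (p h : ℕ) [Fact p.Prime] (S : Finset ℕ) (σ : SL(2, ℤ)) (g : ℍ → ℂ) (j : ℕ) : ℍ → ℂ :=
  ∑ i, (g * eHat p h S ^ j) ∣[((12 * (p - 1) * S.card * j : ℕ) : ℤ)]
    (SpecialLinearGroup.toGL ((traceReps p σ i : SL(2, ℤ)) : SL(2, ℝ)) : GL (Fin 2) ℝ)

theorem sum_slash {ι : Type*} [Fintype ι] (k : ℤ) (w : SL(2, ℝ)) (u : ι → ℍ → ℂ) :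
    (∑ i, u i) ∣[k] (SpecialLinearGroup.toGL w : GL (Fin 2) ℝ) =
      ∑ i, u i ∣[k] (SpecialLinearGroup.toGL w : GL (Fin 2) ℝ) := by
  funext τ
  simp only [slash_toGL_apply, Finset.sum_apply, Finset.sum_mul]

theorem smul_slash_SL (k : ℤ) (w : SL(2, ℝ)) (x : ℂ) (u : ℍ → ℂ) :
    (x • u) ∣[k] (SpecialLinearGroup.toGL w : GL (Fin 2) ℝ) =
      x • u ∣[k] (SpecialLinearGroup.toGL w : GL (Fin 2) ℝ) := by
  funext τ
  simp only [slash_toGL_apply, Pi.smul_apply, smul_eq_mul, mul_assoc]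

theorem traceForm_slash_Gamma0R {n : ℕ} (hpn : ¬ p ∣ n * h) (hn : 0 < n) (hh : h ∣ n)
    (hS : IsExactDivisorSubgroup (n / h) (S : Set ℕ)) {g : wring} (hg : InvW (p * (n * h)) g)
    {A B D : ℤ} (hdet : A * (p * D) - B * (n * h : ℕ) = 1)
    (j : ℕ) {γ : SL(2, ℝ)} (hγ : γ ∈ Gamma0R (n * h)) :
    traceForm p h S (mkSL A B (n * h : ℕ) (p * D) hdet) g j
      ∣[((12 * (p - 1) * S.card * j : ℕ) : ℤ)] (SpecialLinearGroup.toGL γ : GL (Fin 2) ℝ) =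
      traceForm p h S (mkSL A B (n * h : ℕ) (p * D) hdet) g j := by
  have hr := isCosetReps_traceReps hpn (Nat.mul_pos hn (Nat.pos_of_dvd_of_pos hh hn)) hdet
  rw [traceForm, sum_slash]
  simp only [← SlashAction.slash_mul, ← map_mul]
  have := (hr.mul_right hγ).sum_slash_eq hr (k := ((12 * (p - 1) * S.card * j : ℕ) : ℤ))
    (G := (g : ℍ → ℂ) * eHat p h S ^ j) fun δ hδ => mul_eHat_slash_Gamma0R hh hn hS hg j hδ
  exact this

/-- For G = g Ê^j, (G|r)|w = (G|w)|(w⁻¹rw) = x G|(w⁻¹rw). As w belongs to w_e at both levels n|h and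
pn|h, it normalizes Γ₀(nh) and Γ₀(pnh), so the w⁻¹rw are again coset representatives. -/
theorem traceForm_slash_wM {n : ℕ} (hpn : ¬ p ∣ n * h) (hn : 0 < n) (hh : h ∣ n) (h24 : h ∣ 24)
    (hS : IsExactDivisorSubgroup (n / h) (S : Set ℕ)) {g : wring} (hg : InvW (p * (n * h)) g)
    {A B D : ℤ} (hdet : A * (p * D) - B * (n * h : ℕ) = 1)
    (j : ℕ) {e m : ℕ} (he : e ∈ S) (hm : n = h * e * m) {w : SL(2, ℝ)}
    {a b c d : ℤ} (hd : a * d * e - b * (p * c) * m = 1)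
    (hw : (w : Matrix (Fin 2) (Fin 2) ℝ) = wM h e m a b (p * c) d) {x : ℂ}
    (hx : ∀ τ, (g : ℍ → ℂ) (w • τ) = x * (g : ℍ → ℂ) τ) :
    traceForm p h S (mkSL A B (n * h : ℕ) (p * D) hdet) g j
      ∣[((12 * (p - 1) * S.card * j : ℕ) : ℤ)] (SpecialLinearGroup.toGL w : GL (Fin 2) ℝ) =
      x • traceForm p h S (mkSL A B (n * h : ℕ) (p * D) hdet) g j := by
  have hh0 := Nat.pos_of_dvd_of_pos hh hn
  have hk : 0 < n / h := Nat.div_pos (Nat.le_of_dvd hn hh) hh0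
  have he0 : 0 < e := (hS.exact e he).pos hk
  have hnh : n / h = e * m := by
    rw [hm, mul_assoc, Nat.mul_div_cancel_left _ hh0]
  have hpnh : p * n / h = e * (p * m) := by
    rw [Nat.mul_div_assoc _ hh, hnh]; ring
  have hr := isCosetReps_traceReps hpn (Nat.mul_pos hn hh0) hdet
  have hw1 : w ∈ wCoset n h e := by
    rw [hm]
    exact (mem_wCoset_iff hh0 he0).2 ⟨a, b, p * c, d, hd, hw⟩
  have hw2 : w ∈ wCoset (p * n) h e := by
    rw [show p * n = h * e * (p * m) by rw [hm]; ring]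
    refine (mem_wCoset_iff hh0 he0).2 ⟨a, b, c, d, by push_cast; linear_combination hd, ?_⟩
    rw [hw, wM, wM]
    ext i j
    fin_cases i <;> fin_cases j <;> simp
    left; ring
  have hw1' : w⁻¹ ∈ wCoset n h e := by
    rw [hm] at hw1 ⊢; exact inv_mem_wCoset hh0 he0 hw1
  have hw2' : w⁻¹ ∈ wCoset (p * n) h e := by
    rw [show p * n = h * e * (p * m) by rw [hm]; ring] at hw2 ⊢
    exact inv_mem_wCoset hh0 he0 hw2
  have hc1 := fun (v : SL(2, ℝ)) (hv : v ∈ wCoset n h e) δ hδ =>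
    conj_mem_Gamma0R (δ := δ) hn hh h24 (hnh ▸ dvd_mul_right e m) hv hδ
  have hc2 := fun (v : SL(2, ℝ)) (hv : v ∈ wCoset (p * n) h e) δ hδ =>
    conj_mem_Gamma0R (δ := δ) (Nat.mul_pos hp.out.pos hn) (hh.mul_left p) h24
      (hpnh ▸ dvd_mul_right e (p * m)) hv hδ
  rw [mul_assoc] at hc2
  have hr' := hr.conj (w := w) (hc1 w hw1)
    (fun δ hδ => by simpa using hc1 _ hw1' δ hδ) (hc2 w hw2)
    (fun δ hδ => by simpa using hc2 _ hw2' δ hδ)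
  have hsum := hr'.sum_slash_eq hr (k := ((12 * (p - 1) * S.card * j : ℕ) : ℤ))
    (G := (g : ℍ → ℂ) * eHat p h S ^ j) fun δ hδ => mul_eHat_slash_Gamma0R hh hn hS hg j hδ
  have hG := mul_eHat_slash_wM (p := p) hh0 hk hS he hnh hd hw hx j
  rw [traceForm, sum_slash, ← hsum, Finset.smul_sum]
  refine Finset.sum_congr rfl fun i _ => ?_
  rw [← smul_slash_SL, ← hG, ← SlashAction.slash_mul, ← SlashAction.slash_mul, ← map_mul,
    ← map_mul]
  congr 2
  group

end

end Moonshine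

end


noncomputable section

namespace Moonshine

/-! ### Expansion of the trace -/

local notation "ℤtoℂ" => PowerSeries.map (Int.castRingHom ℂ)

theorem LExp.expand {u : ℍ → ℂ} {P : PowerSeries ℂ} (hu : LExp 1 u 0 P) {M : ℕ} (hM : 0 < M) :
    LExp M u 0 (PowerSeries.expand M hM.ne' P) := by
  have := hu.comp_aff (a := 1) (d := 1) one_pos one_pos hM.ne' one_pos hM (by ring) 0 (ω := 1)
    (by simp)
  have e : ∀ τ : ℍ, aff 1 0 τ = τ := fun τ => by ext; rw [coe_aff one_pos]; simp
  simpa [e] using this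

/-- The coefficients of `∑_b K(τ + b)`, if this function has period `1`. -/
theorem LExp.coeff_sum_translates {p N : ℕ} [hp : Fact p.Prime] (hN : 0 < N) {K W : ℍ → ℂ} {r : ℕ}
    {P w : PowerSeries ℂ} (hK : LExp (p * N) K r P) (hW : LExp 1 W 0 w)
    (h : ∀ τ, W τ = ∑ b : ZMod p, K (aff 1 b.val τ)) (i : ℕ) :
    PowerSeries.coeff i w = p * PowerSeries.coeff (p * N * i + r) P := by
  have hM : 0 < p * N := Nat.mul_pos hp.out.pos hN
  have hMC : ((p * N : ℕ) : ℂ) ≠ 0 := by exact_mod_cast hM.ne'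
  let ω : ZMod p → ℂ := fun b => Complex.exp (2 * Real.pi * Complex.I * (((b.val : ℤ) : ℂ) /
    (((1 : ℕ) : ℂ) * (p * N : ℕ))))
  have hω0 : ∀ b, ω b ≠ 0 := fun b => Complex.exp_ne_zero _
  have hωM : ∀ b, ω b ^ (p * N) = 1 := fun b => by
    rw [← Complex.exp_nat_mul, Complex.exp_eq_one_iff]
    exact ⟨b.val, by field_simp; push_cast; ring⟩
  have h1 : ∀ b : ZMod p, LExp (p * N) (fun τ => K (aff 1 b.val τ)) r
      (PowerSeries.C ((ω b)⁻¹ ^ r) * PowerSeries.rescale (ω b) P) := fun b => by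
    have := hK.comp_aff (a := 1) (d := 1) (s := 1) one_pos one_pos one_ne_zero hM hM (by ring)
      (b.val : ℤ) (ω := ω b) rfl
    simpa using this
  have h2 := LExp.sum Finset.univ fun b _ => h1 b
  have e : ∑ b : ZMod p, (fun τ => K (aff 1 b.val τ)) = W := by
    funext τ; rw [h τ, Finset.sum_apply]
  rw [e] at h2
  have h3 := congrArg (PowerSeries.coeff (p * N * i + r)) ((hW.expand hM).unique hM h2)
  rw [PowerSeries.coeff_X_pow_mul, PowerSeries.coeff_expand_mul, pow_zero, one_mul, map_sum] at h3
  rw [h3]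
  -- Coefficients at integral powers of q sit at exponents divisible by pN, where the twists are
  -- trivial because ω_b^(pN) = 1. So each translate contributes the same amount.
  have h4 : ∀ b : ZMod p, PowerSeries.coeff (p * N * i + r) (PowerSeries.C ((ω b)⁻¹ ^ r) *
      PowerSeries.rescale (ω b) P) = PowerSeries.coeff (p * N * i + r) P := fun b => by
    rw [PowerSeries.coeff_C_mul, PowerSeries.coeff_rescale, pow_add, pow_mul, hωM, one_pow, one_mul,
      ← mul_assoc, ← mul_pow, inv_mul_cancel₀ (hω0 b), one_pow, one_mul]
  simp only [h4]
  rw [Finset.sum_const, Finset.card_univ, ZMod.card, nsmul_eq_mul]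

section

variable {p h : ℕ} [hp : Fact p.Prime] {S : Finset ℕ}

/-- The trace, explicitly. -/
theorem traceForm_apply {N : ℕ} (hh : 0 < h) (hS : ∀ e ∈ S, 0 < e) (hN : ∀ e ∈ S, e * h ∣ N)
    {A B D : ℤ} (hdet : A * (p * D) - B * N = 1) (g : ℍ → ℂ) (j : ℕ) (τ : ℍ) :
    traceForm p h S (mkSL A B N (p * D) hdet) g j τ = (g * eHat p h S ^ j) τ +
      ∑ b : ZMod p, ((fun τ => g (mkSL A B N (p * D) hdet • τ)) *
        ((p : ℂ) ^ (12 * S.card) • eHatDiv p h S) ^ j) (aff 1 b.val τ) := by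
  rw [traceForm, Fintype.sum_option, Pi.add_apply, Finset.sum_apply]
  congr 1
  · simp only [traceReps, map_one, SlashAction.slash_one]
  · refine Finset.sum_congr rfl fun b _ => ?_
    have hdn : dn ((ModularGroup.T ^ (b.val : ℤ) : SL(2, ℤ)) : SL(2, ℝ)) τ = 1 := by
      simp only [dn, SpecialLinearGroup.map_apply_coe, RingHom.mapMatrix_apply, Matrix.map_apply,
        Int.coe_castRingHom, ModularGroup.coe_T_zpow]
      simp
    rw [traceReps, map_mul, map_mul, SlashAction.slash_mul, slash_toGL_apply, hdn, _root_.one_zpow, mul_one,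
      mul_eHat_slash_apply, intCast_smul (ModularGroup.T ^ _), T_smul_eq_aff, intCast_smul,
      eHat_smul_sigma hh hS hN hdet, mul_assoc (dn _ _ ^ _), mul_comm (dn _ _ ^ _),
      mul_inv_cancel_right₀ (pow_ne_zero _ (dn_ne_zero _ _))]
    simp

theorem mdiff_traceForm (hh : 0 < h) (hS : ∀ e ∈ S, 0 < e) (σ : SL(2, ℤ)) {g : ℍ → ℂ}
    (hg : MDiff g) (j : ℕ) : MDiff (traceForm p h S σ g j) := by
  rw [traceForm]
  have hG : MDiff (g * eHat p h S ^ j) := hg.mul ((mdiff_eHat hh hS).pow j)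
  refine MDifferentiable.sum fun i _ => ?_
  exact hG.slash _ _

/-- The trace as a modular form on `Γ₀(nh)`. -/
theorem exists_modularForm_traceForm {n : ℕ} (hpn : ¬ p ∣ n * h) (hn : 0 < n) (hh : h ∣ n)
    (hS : IsExactDivisorSubgroup (n / h) (S : Set ℕ)) {g : wring} (hg : InvW (p * (n * h)) g)
    {A B D : ℤ} (hdet : A * (p * D) - B * (n * h : ℕ) = 1) {j : ℕ}
    (hj : ∀ γ : SL(2, ℤ), IsBoundedAtImInfty
      (((g : ℍ → ℂ) * eHat p h S ^ j) ∣[((12 * (p - 1) * S.card * j : ℕ) : ℤ)]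
        (SpecialLinearGroup.toGL (γ : SL(2, ℝ)) : GL (Fin 2) ℝ))) :
    ∃ f : ModularForm ((CongruenceSubgroup.Gamma0 (n * h)).map (SpecialLinearGroup.mapGL ℝ))
      ((12 * (p - 1) * S.card * j : ℕ) : ℤ),
      (f : ℍ → ℂ) = traceForm p h S (mkSL A B (n * h : ℕ) (p * D) hdet) g j := by
  have hh0 := Nat.pos_of_dvd_of_pos hh hn
  have : NeZero (n * h) := ⟨(Nat.mul_pos hn hh0).ne'⟩
  have hk : 0 < n / h := Nat.div_pos (Nat.le_of_dvd hn hh) hh0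
  refine ⟨{ toFun := traceForm p h S (mkSL A B (n * h : ℕ) (p * D) hdet) g j
            slash_action_eq' := ?_
            holo' := mdiff_traceForm hh0 (fun e he => (hS.exact e he).pos hk) _ g.2.1 j
            bdd_at_cusps' := ?_ }, rfl⟩
  · rintro _ ⟨γ, hγ, rfl⟩
    exact traceForm_slash_Gamma0R hpn hn hh hS hg hdet j (γ := (γ : SL(2, ℝ))) ⟨γ, hγ, rfl⟩
  · intro c hc
    rw [Subgroup.IsArithmetic.isCusp_iff_isCusp_SL2Z] at hc
    rw [OnePoint.isBoundedAt_iff_forall_SL2Z hc]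
    intro γ _
    have e : traceForm p h S (mkSL A B (n * h : ℕ) (p * D) hdet) g j
        ∣[((12 * (p - 1) * S.card * j : ℕ) : ℤ)] γ =
        ∑ i, ((g : ℍ → ℂ) * eHat p h S ^ j) ∣[((12 * (p - 1) * S.card * j : ℕ) : ℤ)]
          (SpecialLinearGroup.toGL ((traceReps p (mkSL A B (n * h : ℕ) (p * D) hdet) i * γ :
            SL(2, ℤ)) : SL(2, ℝ)) : GL (Fin 2) ℝ) := by
      simp only [map_mul, SlashAction.slash_mul]
      exact sum_slash _ _ _
    rw [e]
    exact Asymptotics.IsBigO.sum fun i _ => hj _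

end

end Moonshine

end


/-! ### The p-adic limit of the traces and the proof of the lemma. -/

noncomputable section

namespace Moonshine

/-! ### `p`-adic approximation -/

local notation "ℤtoℂ" => PowerSeries.map (Int.castRingHom ℂ)

theorem map_int_mem_coeffIn (A : Subring ℂ) (Q : PowerSeries ℤ) : ℤtoℂ Q ∈ coeffIn A :=
  map_mem_coeffIn _ (fun x => intCast_mem A x) Q

/-- Each p-th power improves a congruence to 1 modulo p^k to one modulo p^(k+1). -/
theorem exists_pow_eq_one_add {p : ℕ} (R : PowerSeries ℤ) (m : ℕ) : ∃ R' : PowerSeries ℤ,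
    (1 + PowerSeries.C (p : ℤ) * R) ^ p ^ m = 1 + PowerSeries.C ((p : ℤ) ^ (m + 1)) * R' := by
  have := dvd_sub_pow_of_dvd_sub (R := PowerSeries ℤ) (p := p)
    (a := 1 + PowerSeries.C (p : ℤ) * R) (b := 1) ⟨R, by simp⟩ m
  obtain ⟨R', hR'⟩ := this
  refine ⟨R', ?_⟩
  rw [one_pow] at hR'
  rw [← sub_eq_iff_eq_add', hR']
  simp

section

variable {p h : ℕ} [hp : Fact p.Prime] {S : Finset ℕ}

/-- A power of `p` clears the denominators of the expansion of a function in `bddRing`. -/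
theorem LExp.exists_pow_mul_mem {M : ℕ} (hM : 0 < M) {u : ℍ → ℂ} {r : ℕ} {P : PowerSeries ℂ}
    (hu : LExp M u r P) (h : u ∈ bddRing p M) :
    ∃ s₀ : ℕ, ∀ s, s₀ ≤ s → PowerSeries.C ((p : ℂ) ^ s) * P ∈ coeffIn (pint p) := by
  obtain ⟨s₀, hs₀⟩ := h
  refine ⟨s₀, fun s hs => ?_⟩
  obtain ⟨t, rfl⟩ := Nat.exists_eq_add_of_le hs
  have := (hu.smul ((p : ℂ) ^ s₀)).mem_coeffIn hM hs₀
  rw [pow_add, mul_comm ((p : ℂ) ^ s₀), map_mul, mul_assoc]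
  exact mul_mem (C_mem_coeffIn (pow_mem (natCast_mem _ p) t)) this

theorem norm_le_of_pow_mul_eq {x : ℚ} {y : ℂ} (hy : y ∈ pint p) {s m : ℕ}
    (h : (p : ℂ) ^ s * x = (p : ℂ) ^ m * y) : ‖(x : ℚ_[p])‖ ≤ (p : ℝ) ^ s * ((p : ℝ) ^ m)⁻¹ := by
  have hp0 : (p : ℂ) ≠ 0 := by exact_mod_cast hp.out.ne_zero
  have hpR : (0 : ℝ) < p := by exact_mod_cast hp.out.pos
  have e : (((p : ℚ) ^ s * x / (p : ℚ) ^ m : ℚ) : ℂ) = y := by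
    push_cast; rw [h]; field_simp
  have h1 := norm_ratCast_le_one_of_mem_pint (p := p) (x := (p : ℚ) ^ s * x / (p : ℚ) ^ m)
    (by rw [e]; exact hy)
  push_cast at h1
  rw [norm_div, norm_mul, norm_pow, norm_pow, Padic.norm_p, inv_pow, inv_pow, div_inv_eq_mul,
    mul_assoc, inv_mul_le_iff₀ (by positivity), mul_one] at h1
  rwa [← div_eq_mul_inv, le_div_iff₀ (by positivity)]

/-- The traces of `g eHat^(p^m)` have rational expansions, which converge `p`-adically to the
expansion of `g`. -/
theorem exists_approximation {n : ℕ} (hpn : ¬ p ∣ n * h) (hn : 0 < n) (hh : h ∣ n)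
    (hS : IsExactDivisorSubgroup (n / h) (S : Set ℕ)) {g : wring} (hg : InvW (p * (n * h)) g)
    (hb : ∀ γ : SL(2, ℤ), (p : ℤ) ∣ γ 1 0 →
      (fun τ => (g : ℍ → ℂ) (γ • τ)) =O[atImInfty] (1 : ℍ → ℝ))
    {F : PowerSeries ℚ} (hF : HasRatQExpansion g F)
    {A B D : ℤ} (hdet : A * (p * D) - B * (n * h : ℕ) = 1) :
    ∃ s j₀ : ℕ, ∀ m, j₀ ≤ m → ∃ (v : PowerSeries ℚ)
      (f : ModularForm ((CongruenceSubgroup.Gamma0 (n * h)).map (SpecialLinearGroup.mapGL ℝ))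
        ((12 * (p - 1) * S.card * p ^ m : ℕ) : ℤ)),
      (f : ℍ → ℂ) = traceForm p h S (mkSL A B (n * h : ℕ) (p * D) hdet) g (p ^ m) ∧
      HasRatQExpansion f v ∧
      ∀ i, ‖((PowerSeries.coeff i v - PowerSeries.coeff i F : ℚ) : ℚ_[p])‖ ≤
        (p : ℝ) ^ s * ((p : ℝ) ^ (m + 1))⁻¹ := by
  have hh0 := Nat.pos_of_dvd_of_pos hh hn
  have hp0 := hp.out.pos
  have hk : 0 < n / h := Nat.div_pos (Nat.le_of_dvd hn hh) hh0
  have hNpos : 0 < n * h := Nat.mul_pos hn hh0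
  have hM : 0 < p * (n * h) := Nat.mul_pos hp0 hNpos
  have : NeZero (n * h) := ⟨hNpos.ne'⟩
  have hSpos : ∀ e ∈ S, 0 < e := fun e he => (hS.exact e he).pos hk
  have hSdvd : ∀ e ∈ S, e * h ∣ n * h := fun e he =>
    Nat.mul_dvd_mul_right ((hS.exact e he).1.trans (Nat.div_dvd_of_dvd hh)) h
  have hcard : 0 < S.card := Finset.card_pos.2 ⟨1, hS.one_mem⟩
  obtain ⟨j₀, hj₀⟩ := exists_forall_isBoundedAtImInfty hM hh0 hSpos ⟨1, hS.one_mem⟩ hg hb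
  obtain ⟨R, hE⟩ := exists_lexp_eHat (p := p) hh0 hSpos
  obtain ⟨Y, hY⟩ := exists_lexp_eHatDiv (p := p) hh0 hSpos hNpos
  have hFC := hF.lexp
  have hFrat : F.map (algebraMap ℚ ℂ) ∈ coeffIn ratRing := map_mem_coeffIn (algebraMap ℚ ℂ)
    (fun x => (⟨x, rfl⟩ : algebraMap ℚ ℂ x ∈ ratRing)) F
  have hgr : g ∈ lringW (p * (n * h)) ratRing :=
    (hFC.expand hM).mem_lring (expand_mem_coeffIn _ hFrat)
  -- `g` and its conjugate have bounded denominators at `p`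
  have hg1 := (conj_rat_and_bdd hpn hM hg hgr (γ := 1) (γ₀ := 1) hM one_pos (mul_one _)
    (by simp) (by simp) (by simp) (by simp)).2
  -- diag(pN, 1)σ = γ₀ diag(N, p): here σ turns j(pNτ) into j(Nτ/p), a Hermite form without
  -- translation, so g|σ keeps rational coefficients.
  have hgσ := conj_rat_and_bdd hpn hM hg hgr (γ := mkSL A B (n * h : ℕ) (p * D) hdet)
    (γ₀ := mkSL (p * A) (B * (n * h : ℕ)) 1 D (by linear_combination hdet)) hNpos hp0
    (mul_comm _ _) (by simp; ring) (by simp; ring) (by simp) (by simp; ring)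
  have e1 : (actW (1 : SL(2, ℤ))⁻¹ g : ℍ → ℂ) = g := by
    funext τ; rw [actW_apply]; simp only [inv_one, one_smul]
  have e2 : (actW (mkSL A B (n * h : ℕ) (p * D) hdet)⁻¹ g : ℍ → ℂ) =
      fun τ => (g : ℍ → ℂ) (mkSL A B (n * h : ℕ) (p * D) hdet • τ) := by
    funext τ; rw [actW_apply, inv_inv]
  rw [e1] at hg1
  rw [e2] at hgσ
  obtain ⟨⟨r, P, hP, hH⟩, hHb⟩ := hgσ
  obtain ⟨s₁, hs₁⟩ := (hFC.expand hM).exists_pow_mul_mem hM hg1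
  obtain ⟨s₂, hs₂⟩ := hH.exists_pow_mul_mem hM hHb
  have hFs := hs₁ (s₁ + s₂) (Nat.le_add_right _ _)
  have hPs := hs₂ (s₁ + s₂) (Nat.le_add_left _ _)
  generalize s₁ + s₂ = s at hFs hPs
  have hFs' : PowerSeries.C ((p : ℂ) ^ s) * F.map (algebraMap ℚ ℂ) ∈ coeffIn (pint p) :=
    mem_coeffIn.2 fun i => by
      have := mem_coeffIn.1 hFs (p * (n * h) * i)
      rwa [PowerSeries.coeff_C_mul, PowerSeries.coeff_expand_mul, ← PowerSeries.coeff_C_mul] at this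
  refine ⟨s, j₀, fun m hm => ?_⟩
  have hmp : m ≤ p ^ m := (Nat.lt_pow_self hp.out.one_lt).le
  obtain ⟨f, hf⟩ := exists_modularForm_traceForm hpn hn hh hS hg hdet
    (hj₀ (p ^ m) (hm.trans hmp))
  have hfexp : LExp 1 f 0 (qExpansion 1 f) := fun τ => by
    have := ModularForm.hasSum_qExpansion f one_pos (by simp) τ
    simpa [HasEval] using this
  have hG := hFC.mul (hE.pow (p ^ m))
  have hK := hH.mul ((hY.smul ((p : ℂ) ^ (12 * S.card))).pow (p ^ m))
  simp only [mul_zero, add_zero] at hG hK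
  have hW := hfexp.sub hG
  obtain ⟨R', hR'⟩ := exists_pow_eq_one_add (p := p) R m
  rw [← map_pow, hR'] at hW
  have hcoeff := hK.coeff_sum_translates hNpos hW fun τ => by
    rw [Pi.sub_apply, hf, traceForm_apply hh0 hSpos hSdvd, add_sub_cancel_left]
  generalize qExpansion 1 f = V at hfexp hcoeff
  -- The trace differs from g by g(Ê^(p^m) - 1), divisible by p^(m+1) up to the denominators of g,
  -- and by the terms coming from σ.
  have hVF : V - F.map (algebraMap ℚ ℂ) = F.map (algebraMap ℚ ℂ) *
      (PowerSeries.C ((p : ℂ) ^ (m + 1)) * ℤtoℂ R') + (V - F.map (algebraMap ℚ ℂ) *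
        ℤtoℂ (1 + PowerSeries.C ((p : ℤ) ^ (m + 1)) * R')) := by
    simp
    ring
  -- the coefficients of the trace
  have hV : ∀ i, PowerSeries.coeff i V - (PowerSeries.coeff i F : ℚ) = (p : ℂ) ^ (m + 1) *
      PowerSeries.coeff i (F.map (algebraMap ℚ ℂ) * ℤtoℂ R') + p * (p : ℂ) ^ (12 * S.card * p ^ m) *
        PowerSeries.coeff (p * (n * h) * i + r) (P * ℤtoℂ Y ^ p ^ m) := fun i => by
    have h1 := congrArg (PowerSeries.coeff i) hVF
    rw [map_add, hcoeff, map_sub] at h1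
    have h2 : PowerSeries.coeff i (F.map (algebraMap ℚ ℂ)) = ((PowerSeries.coeff i F : ℚ) : ℂ) := by
      rw [PowerSeries.coeff_map]; rfl
    rw [h2] at h1
    rw [h1, mul_left_comm (F.map _), PowerSeries.coeff_C_mul, mul_pow, ← map_pow, ← pow_mul,
      mul_left_comm P, PowerSeries.coeff_C_mul, mul_assoc (p : ℂ)]
  have hrat : ∀ i, ∃ x : ℚ, (x : ℂ) = PowerSeries.coeff i V := fun i => by
    have : PowerSeries.coeff i V ∈ ratRing := by
      rw [← sub_add_cancel (PowerSeries.coeff i V) ((PowerSeries.coeff i F : ℚ) : ℂ), hV i]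
      refine add_mem (add_mem (mul_mem (pow_mem (natCast_mem _ p) _) (mem_coeffIn.1
        (mul_mem hFrat (map_int_mem_coeffIn _ _)) i)) (mul_mem (mul_mem (natCast_mem _ p)
          (pow_mem (natCast_mem _ p) _)) (mem_coeffIn.1 (mul_mem hP
            (pow_mem (map_int_mem_coeffIn _ _) _)) _))) (ratCast_mem_ratRing _)
    obtain ⟨x, hx⟩ := this
    exact ⟨x, hx⟩
  choose v hv using hrat
  refine ⟨PowerSeries.mk v, f, hf, fun τ => ?_, fun i => ?_⟩
  · have := hfexp τ
    rw [pow_zero, one_mul, HasEval] at this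
    refine this.congr_fun fun i => ?_
    rw [PowerSeries.coeff_mk, hv]
    simp [Function.Periodic.qParam]
  -- The power p^(12|S|p^m) contains p^m, and the factor p from the sum of translates completes it
  -- to p^(m+1). The exponent s for the denominators of g and g|σ does not depend on m.
  · obtain ⟨t, ht⟩ := Nat.exists_eq_add_of_le (show m ≤ 12 * S.card * p ^ m from
      hmp.trans (Nat.le_mul_of_pos_left _ (by positivity)))
    refine norm_le_of_pow_mul_eq (y := PowerSeries.coeff i (PowerSeries.C ((p : ℂ) ^ s) *
      F.map (algebraMap ℚ ℂ) * ℤtoℂ R') + (p : ℂ) ^ t * PowerSeries.coeff (p * (n * h) * i + r)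
        (PowerSeries.C ((p : ℂ) ^ s) * P * ℤtoℂ Y ^ p ^ m)) ?_ ?_
    · exact add_mem (mem_coeffIn.1 (mul_mem hFs' (map_int_mem_coeffIn _ _)) i)
        (mul_mem (pow_mem (natCast_mem _ p) _) (mem_coeffIn.1 (mul_mem hPs
          (pow_mem (map_int_mem_coeffIn _ _) _)) _))
    · rw [PowerSeries.coeff_mk, Rat.cast_sub, hv, hV i, ht, mul_assoc (PowerSeries.C _),
        mul_assoc (PowerSeries.C _), PowerSeries.coeff_C_mul, PowerSeries.coeff_C_mul]
      ring

end

end Moonshine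

end


noncomputable section

namespace Moonshine

/-! ### `f|U_p^β` as a `p`-adic modular form -/

theorem IsWeaklyHolomorphic.mem_wring {N : ℕ} {f : ℍ → ℂ} (hf : IsWeaklyHolomorphic N 0 f) :
    f ∈ wring := by
  refine ⟨hf.holo, fun γ => ?_⟩
  obtain ⟨C, hC⟩ := hf.mero_at_cusps γ
  refine ⟨C, hC.congr_left fun τ => ?_⟩
  rw [slash_SL_apply, neg_zero, zpow_zero, mul_one]

theorem IsWeaklyHolomorphic.smul_eq {N : ℕ} {f : ℍ → ℂ} (hf : IsWeaklyHolomorphic N 0 f)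
    {δ : SL(2, ℝ)} (hδ : δ ∈ Gamma0R N) (τ : ℍ) : f (δ • τ) = f τ := by
  obtain ⟨γ, hγ, rfl⟩ := hδ
  have := congrFun (hf.slash_eq γ hγ) τ
  rwa [slash_SL_apply, neg_zero, zpow_zero, mul_one] at this

theorem HasEigenvalues.smul_eq {h : ℕ} {Γ : Subgroup SL(2, ℝ)} {χ : Γ →* rootsOfUnity (2 * h) ℂ}
    {f : ℍ → ℂ} (hf : HasEigenvalues χ 0 f) (γ : Γ) (τ : ℍ) :
    f ((γ : SL(2, ℝ)) • τ) = ((χ γ : ℂˣ) : ℂ) * f τ := by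
  have := congrFun (hf γ) τ
  rwa [slash_toGL_apply, neg_zero, zpow_zero, mul_one] at this

theorem IsExactDivisorSubgroup.finite {N : ℕ} (hN : 0 < N) {S : Set ℕ}
    (hS : IsExactDivisorSubgroup N S) : S.Finite :=
  N.divisors.finite_toSet.subset fun e he => by
    rw [Finset.mem_coe, Nat.mem_divisors]
    exact ⟨(hS.exact e he).1, hN.ne'⟩

theorem tendsto_natCast_mul_pow (p : ℕ) [hp : Fact p.Prime] (κ j₀ : ℕ) :
    Tendsto (fun m : ℕ => (((κ * p ^ (m + j₀) : ℕ) : ℤ) : ℤ_[p])) atTop (𝓝 0) := by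
  have h1 : Tendsto (fun m : ℕ => (p : ℤ_[p]) ^ (m + j₀)) atTop (𝓝 0) := by
    refine (tendsto_pow_atTop_nhds_zero_of_norm_lt_one ?_).comp (tendsto_add_atTop_nat j₀)
    rw [PadicInt.norm_p]
    exact inv_lt_one_of_one_lt₀ (by exact_mod_cast hp.out.one_lt)
  have h2 := h1.const_mul (κ : ℤ_[p])
  rw [mul_zero] at h2
  refine h2.congr fun m => ?_
  push_cast
  rfl

section

variable {p α β n h : ℕ} [hp : Fact p.Prime] {Γ Γ' : Subgroup SL(2, ℝ)}

/-- The traces are forms on `(Γ', χ')`. -/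
theorem hasEigenvalues_traceForm (hpn : ¬ p ∣ n * h) (hα : α ≤ β + 1)
    (hΓ : IsTypeGroup (p ^ α * n) h Γ) (hΓ' : IsTypeGroup n h Γ')
    (hAL : ∀ E : ℕ, E ∈ AL n h Γ' ↔ E ∈ AL (p ^ α * n) h Γ ∧ ¬ p ∣ E)
    {S : Finset ℕ} (hS : IsExactDivisorSubgroup (n / h) (S : Set ℕ))
    (hSΓ : Γ' = Subgroup.closure (⋃ e ∈ (S : Set ℕ), wCoset n h e))
    {χ : Γ →* rootsOfUnity (2 * h) ℂ} {f : ℍ → ℂ}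
    (hf : IsWeaklyHolomorphicOn (p ^ α * n) h χ 0 f) {χ' : Γ' →* rootsOfUnity (2 * h) ℂ}
    (hχ' : IsEigenvalueMap n h χ')
    (hχχ' : ∀ (w : Γ') (w₁ : Γ), (w₁ : SL(2, ℝ)) = conjDiag (pow_pos hp.out.pos β) (w : SL(2, ℝ)) →
      (∃ e ∈ (S : Set ℕ), (w₁ : SL(2, ℝ)) ∈ wCoset (p ^ α * n) h e) → χ' w = χ w₁)
    {g : wring} (hgf : (g : ℍ → ℂ) = (Up p)^[β] f) (hg : InvW (p * (n * h)) g) {A B D : ℤ}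
    (hdet : A * (p * D) - B * (n * h : ℕ) = 1) (j : ℕ) :
    HasEigenvalues χ' ((12 * (p - 1) * S.card * j : ℕ) : ℤ)
      (traceForm p h S (mkSL A B (n * h : ℕ) (p * D) hdet) g j) := by
  have hn := hΓ'.pos_left
  have hh := hΓ'.dvd
  have hh0 := hΓ'.pos_right
  have hk : 0 < n / h := Nat.div_pos (Nat.le_of_dvd hn hh) hh0
  have hsub : ∀ e ∈ S, wCoset n h e ⊆ Γ' := fun e he γ hγ => by
    rw [hSΓ]
    exact Subgroup.subset_closure (Set.mem_biUnion (Finset.mem_coe.2 he) hγ)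
  rintro ⟨γ, hγ⟩
  obtain ⟨e, he, hγe⟩ := (mem_closure_wCoset_iff hn hh hS).1 (hSΓ ▸ hγ)
  have heS : e ∈ S := he
  have he0 := (hS.exact e he).pos hk
  obtain ⟨m, hm⟩ := (hS.exact e he).1
  have hnm : n = h * e * m := by
    rw [mul_assoc, ← hm, Nat.mul_div_cancel' hh]
  have hpn' : ¬ p ∣ n := fun h' => hpn (h'.mul_right h)
  rw [hnm] at hγe
  obtain ⟨δ, hδ, a, b, c, d, hd, hw⟩ := exists_mul_eq_wM hh0 he0 hp.out
    (fun h' => hpn (h'.mul_left n)) (fun h' => hpn' (by rw [hnm]; exact (h'.mul_left h).mul_right m))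
    (fun h' => hpn' (by rw [hnm]; exact h'.mul_left _)) β hγe
  rw [← hnm] at hδ
  have hδΓ : δ ∈ Γ' := hsub 1 hS.one_mem (Gamma0R_le_wCoset hh0 hδ)
  have hwΓ : γ * δ ∈ Γ' := Γ'.mul_mem hγ hδΓ
  have hconj : conjDiag (pow_pos hp.out.pos β) (γ * δ) ∈ wCoset (p ^ α * n) h e := by
    rw [hnm, show p ^ α * (h * e * m) = h * e * (p ^ α * m) by ring]
    refine (mem_wCoset_iff hh0 he0).2 ⟨a, b, _, d, ?_, conjDiag_eq_wM hp.out.pos hα hw⟩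
    have hpow : (p : ℤ) ^ (β + 1 - α) * (p : ℤ) ^ α = p ^ β * p := by
      rw [← pow_add, ← pow_succ]; congr 1; omega
    push_cast at hd ⊢
    linear_combination hd - b * c * m * hpow
  have hconjΓ := wCoset_subset_of_AL hpn hΓ hΓ' hAL (hS.exact e he) (hsub e he) hconj
  have hχw : χ' ⟨γ, hγ⟩ = χ ⟨_, hconjΓ⟩ := by
    rw [← hχχ' ⟨γ * δ, hwΓ⟩ ⟨_, hconjΓ⟩ rfl ⟨e, he, hconj⟩]
    have : (⟨γ * δ, hwΓ⟩ : Γ') = ⟨γ, hγ⟩ * ⟨δ, hδΓ⟩ := rfl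
    rw [this, map_mul, hχ' ⟨δ, hδΓ⟩ hδ, mul_one]
  have hx := Up_iterate_smul (p := p) (α := α) (β := β) hh0 he0 hα (f := f) (fun δ hδ τ =>
    hf.weaklyHolomorphic.smul_eq (hnm ▸ hδ) τ) hd hw (hf.eigenvalues.smul_eq ⟨_, hconjΓ⟩)
  rw [← hgf] at hx
  have hV := traceForm_slash_wM hpn hn hh hΓ'.dvd_24 hS hg hdet j heS hnm hd hw hx
  have hVδ := traceForm_slash_Gamma0R hpn hn hh hS hg hdet j ((Gamma0R (n * h)).inv_mem hδ)
  have e1 : (SpecialLinearGroup.toGL γ : GL (Fin 2) ℝ) = SpecialLinearGroup.toGL (γ * δ) *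
      SpecialLinearGroup.toGL δ⁻¹ := by rw [← map_mul, mul_inv_cancel_right]
  change _ ∣[_] (SpecialLinearGroup.toGL γ : GL (Fin 2) ℝ) = _
  rw [e1, SlashAction.slash_mul, hV, smul_slash_SL, hVδ, hχw]

/-- `f|U_p^β` is a `p`-adic modular form of weight `0`. -/
theorem isPadicModularForm_Up_iterate (hpn : ¬ p ∣ n * h) (hα : α ≤ β + 1)
    (hΓ : IsTypeGroup (p ^ α * n) h Γ) (hΓ' : IsTypeGroup n h Γ')
    (hAL : ∀ E : ℕ, E ∈ AL n h Γ' ↔ E ∈ AL (p ^ α * n) h Γ ∧ ¬ p ∣ E)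
    {S : Set ℕ} (hS : IsExactDivisorSubgroup (n / h) S)
    (hSΓ : Γ' = Subgroup.closure (⋃ e ∈ S, wCoset n h e))
    {χ : Γ →* rootsOfUnity (2 * h) ℂ} {f : ℍ → ℂ}
    (hf : IsWeaklyHolomorphicOn (p ^ α * n) h χ 0 f) (hf_infty : HolomorphicAwayFromInfty Γ 0 f)
    {F : PowerSeries ℚ} (hF : HasRatQExpansion ((Up p)^[β] f) F)
    {χ' : Γ' →* rootsOfUnity (2 * h) ℂ} (hχ' : IsEigenvalueMap n h χ')
    (hχχ' : ∀ (w : Γ') (w₁ : Γ), (w₁ : SL(2, ℝ)) = conjDiag (pow_pos hp.out.pos β) (w : SL(2, ℝ)) →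
      (∃ e ∈ S, (w₁ : SL(2, ℝ)) ∈ wCoset (p ^ α * n) h e) → χ' w = χ w₁) :
    IsPadicModularForm p n h χ' 0 (F.map (algebraMap ℚ ℚ_[p])) := by
  have hn := hΓ'.pos_left
  have hh := hΓ'.dvd
  have hk : 0 < n / h := Nat.div_pos (Nat.le_of_dvd hn hh) hΓ'.pos_right
  obtain ⟨S, rfl⟩ := (hS.finite hk).exists_finset_coe
  let g : wring := ⟨(Up p)^[β] f, Up_iterate_mem_wring hf.weaklyHolomorphic.mem_wring β⟩
  have hfδ : ∀ δ ∈ Gamma0R (p ^ α * n * h), ∀ τ, f (δ • τ) = f τ := fun δ hδ τ =>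
    hf.weaklyHolomorphic.smul_eq hδ τ
  have hg : InvW (p * (n * h)) g := fun γ hγ τ => Up_iterate_invariant hh hn hα hfδ hF hγ τ
  have hb : ∀ γ : SL(2, ℤ), (p : ℤ) ∣ γ 1 0 →
      (fun τ => (g : ℍ → ℂ) (γ • τ)) =O[atImInfty] (1 : ℍ → ℝ) := fun γ hγ =>
    Up_iterate_isBigO hpn hα hΓ hfδ (fun w hw => ⟨_, hf.eigenvalues.smul_eq ⟨w, hw⟩⟩) hf_infty hF hγ
  obtain ⟨A, B, D, hdet⟩ : ∃ A B D : ℤ, A * (p * D) - B * (n * h : ℕ) = 1 := by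
    obtain ⟨x, y, hxy⟩ := Nat.isCoprime_iff_coprime.2 ((hp.out.coprime_iff_not_dvd).2 hpn)
    exact ⟨x, -y, 1, by linear_combination hxy⟩
  obtain ⟨s, j₀, happrox⟩ := exists_approximation hpn hn hh hS hg hb (g := g) hF hdet
  choose v V hV hVv hVF using fun m : ℕ => happrox (m + j₀) (Nat.le_add_left _ _)
  -- The shift by j₀ discards the exponents for which g Ê^(p^m) may still have poles.
  refine ⟨fun m => ((12 * (p - 1) * S.card * p ^ (m + j₀) : ℕ) : ℤ), v, fun m => ?_, ?_, ?_, ?_⟩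
  · refine ⟨V m, ?_, hVv m⟩
    rw [hV m]
    exact hasEigenvalues_traceForm hpn hα hΓ hΓ' hAL hS hSΓ hf hχ' hχχ' rfl hg hdet _
  · have hpR : (1 : ℝ) < p := by exact_mod_cast hp.out.one_lt
    have hlim : Tendsto (fun m : ℕ => (p : ℝ) ^ s * ((p : ℝ) ^ (m + j₀ + 1))⁻¹) atTop (𝓝 0) := by
      have h1 := (tendsto_pow_atTop_atTop_of_one_lt hpR).comp (tendsto_add_atTop_nat (j₀ + 1))
      have h2 := h1.inv_tendsto_atTop.const_mul ((p : ℝ) ^ s)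
      rw [mul_zero] at h2
      exact h2
    rw [Metric.tendstoUniformly_iff]
    intro ε hε
    filter_upwards [hlim.eventually_lt_const hε] with m hm i
    refine lt_of_le_of_lt ?_ hm
    have := hVF m i
    rw [dist_comm, dist_eq_norm, PowerSeries.coeff_map]
    push_cast at this
    exact this
  · exact tendsto_natCast_mul_pow p _ j₀
  · refine Eventually.of_forall fun m => ?_
    have : (((12 * (p - 1) * S.card * p ^ (m + j₀) : ℕ) : ℤ) : ZMod (2 * (p - 1))) =
        ((2 * (p - 1) : ℕ) : ZMod (2 * (p - 1))) * ((6 * S.card * p ^ (m + j₀) : ℕ) :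
          ZMod (2 * (p - 1))) := by
      rw [← Nat.cast_mul, Int.cast_natCast]
      congr 1
      ring
    rw [this, ZMod.natCast_self, zero_mul]
    rfl

end

end Moonshine

end

theorem lemma3p7 (p : ℕ) [Fact p.Prime] (α β n h : ℕ) (hp : ¬ p ∣ n * h)
    (hβ : β = max 1 (α - 1))
    (Γ : Subgroup SL(2, ℝ)) (hΓ : Moonshine.IsTypeGroup (p ^ α * n) h Γ)
    (χ : Γ →* rootsOfUnity (2 * h) ℂ) (hχ : Moonshine.IsEigenvalueMap (p ^ α * n) h χ)
    (f : ℍ → ℂ) (hf : Moonshine.IsWeaklyHolomorphicOn (p ^ α * n) h χ 0 f)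
    (hf_infty : Moonshine.HolomorphicAwayFromInfty Γ 0 f)
    -- `f|U_p^β` has a `q`-expansion in `ℚ⟦q⟧`, namely `F`
    (F : PowerSeries ℚ) (hF : Moonshine.HasRatQExpansion ((Moonshine.Up p)^[β] f) F)
    (Γ' : Subgroup SL(2, ℝ)) (hΓ' : Moonshine.IsTypeGroup n h Γ')
    (hAL : ∀ E : ℕ, E ∈ Moonshine.AL n h Γ' ↔ E ∈ Moonshine.AL (p ^ α * n) h Γ ∧ ¬ p ∣ E) :
    (∃! χ' : Γ' →* rootsOfUnity (2 * h) ℂ,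
      Moonshine.IsInducedEigenvalueMap p α β n h hΓ hΓ' χ χ') ∧
    ∀ χ' : Γ' →* rootsOfUnity (2 * h) ℂ,
      Moonshine.IsInducedEigenvalueMap p α β n h hΓ hΓ' χ χ' →
      Moonshine.IsPadicModularForm p n h χ' 0 (F.map (algebraMap ℚ ℚ_[p])) := by
  -- The choice of β enters through this inequality: conjugation by diag(1, p^β) raises a factor p
  -- in the lower left entry to p^(β+1), which has to absorb p^α.
  have hα : α ≤ β + 1 := by omega
  obtain ⟨-, -, S, hS, hSΓ⟩ := id hΓ'
  obtain ⟨χ₀, hχ₀, hconj⟩ :=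
    Moonshine.exists_inducedEigenvalueMap hp hα hΓ hΓ' hAL hS hSΓ χ hχ
  refine ⟨⟨χ₀, hχ₀, fun χ₁ hχ₁ =>
    Moonshine.inducedEigenvalueMap_unique hΓ hΓ' hAL hχ₁ hχ₀⟩, fun χ' hχ' => ?_⟩
  obtain rfl := Moonshine.inducedEigenvalueMap_unique hΓ hΓ' hAL hχ' hχ₀
  exact Moonshine.isPadicModularForm_Up_iterate hp hα hΓ hΓ' hAL hS hSΓ hf hf_infty hF
    hχ'.isEigenvalueMap hconj
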